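/- Let $1\le p\le\infty$ and $N\ge1$ with $(N,p)\ne(1,1)$, let $\Omega\subseteq\mathbb R^N$ be open, $T>0$, $\Omega_T=\Omega\times(0,T)$. For $\varepsilon>0$ and $(x,t)\in\mathbb R^{N}\times\mathbb R$ let $$E_\varepsilon(x,t)=\{(y,s)\in\mathbb R^{N+1}: s<t,\ \Phi(x-y,t-s)>\varepsilon^{-N}\},\qquad \Phi(y,s)=(4\pi s)^{-N/2}e^{-|y|^2/(4s)}\ (s>0),$$ be the heat ball, equipped with the measure $d\nu(y,s)=\frac{|x-y|^2}{(t-s)^2}\,dy\,ds$, and let $\pi_p(\varepsilon,u)(x,t)$ be the unique $\pi\in\mathbb R$ such that $$\|u-\pi\|_{L^p(E_\varepsilon(x,t),\nu)}=\min_{\lambda\in\mathbb R}\|u-\lambda\|_{L^p(E_\varepsilon(x,t),\nu)}.$$ Let $\nabla$ and $\nabla^2$ denote the gradient and Hessian in the space variables, and let $$\Delta_p^n u=\frac{\operatorname{div}(|\nabla u|^{p-2}\nabla u)}{|\nabla u|^{p-2}}\ \ (1\le p<\infty),\qquad \Delta_\infty^n u=\frac{\langle\nabla^2u\,\nabla u,\nabla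 u\rangle}{|\nabla u|^2}$$ be the normalized $p$-Laplacian in the space variables. Theorem (Asymptotics for $\pi_p(\varepsilon,u)$ as $\varepsilon\to0$). Let $u\in C^2(\Omega_T)$ and let $(x,t)\in\Omega_T$ be such that $\nabla u(x,t)\ne0$. Then $\pi_p(\varepsilon,u)(x,t)$ is well defined (the minimizer exists and is unique) for all sufficiently small $\varepsilon>0$ and, as $\varepsilon\to0^+$, if $p<\infty$, $$\pi_p(\varepsilon,u)(x,t)=u(x,t)+\frac1{4\pi}\Bigl(1-\frac2{N+p}\Bigr)^{\frac{N+p}2+1}\Bigl\{-u_t(x,t)+\frac{N}{N+p-2}\,\Delta_p^n u(x,t)\Bigr\}\varepsilon^2+o(\varepsilon^2),$$ and, if $p=\infty$ (where the coefficients are replaced by their limits as $p\to\infty$), $$\pi_\infty(\varepsilon,u)(x,t)=u(x,t)+\frac1{4\pi e}\bigl\{-u_t(x,t)+N\,\Delta_\infty^n u(x,t)\bigr\}\varepsilon^2+o(\varepsilon^2).$$ -/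

import Mathlib

open MeasureTheory Filter Topology Asymptotics
open scoped ENNReal

noncomputable section

/-- The fundamental solution `Φ(y,s)` of the heat equation in `ℝᴺ × ℝ`, extended by zero to
`s ≤ 0`. -/
def heatFundamental {N : ℕ} (y : EuclideanSpace ℝ (Fin N)) (s : ℝ) : ℝ :=
  if 0 < s then (4 * Real.pi * s) ^ (-(N : ℝ) / 2) * Real.exp (-(‖y‖ ^ 2 / (4 * s))) else 0

/-- The heat ball `E_ε(x,t)`. -/
def heatBall {N : ℕ} (ε : ℝ) (x : EuclideanSpace ℝ (Fin N)) (t : ℝ) :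
    Set (EuclideanSpace ℝ (Fin N) × ℝ) :=
  {q | q.2 < t ∧ (ε ^ N)⁻¹ < heatFundamental (x - q.1) (t - q.2)}

/-- The measure `dν(y,s) = |x-y|²/(t-s)² dy ds` on the heat ball `E_ε(x,t)`. -/
def heatBallMeasure {N : ℕ} (ε : ℝ) (x : EuclideanSpace ℝ (Fin N)) (t : ℝ) :
    Measure (EuclideanSpace ℝ (Fin N) × ℝ) :=
  (volume.restrict (heatBall ε x t)).withDensity
    fun q => ENNReal.ofReal (‖x - q.1‖ ^ 2 / (t - q.2) ^ 2)

/-- `m` minimizes `c ↦ ‖u - c‖` in `L^p(E_ε(x,t), ν)` over the real numbers. -/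
def IsHeatPMean {N : ℕ} (p : ℝ≥0∞) (ε : ℝ) (u : EuclideanSpace ℝ (Fin N) × ℝ → ℝ)
    (x : EuclideanSpace ℝ (Fin N)) (t : ℝ) (m : ℝ) : Prop :=
  ∀ c : ℝ, eLpNorm (fun q => u q - m) p (heatBallMeasure ε x t) ≤
    eLpNorm (fun q => u q - c) p (heatBallMeasure ε x t)

/-- The heat `p`-mean `π_p(ε,u)(x,t)`: the minimizer of `c ↦ ‖u - c‖` in `L^p(E_ε(x,t), ν)`
(an arbitrary number if there is no minimizer). -/
def heatPMean {N : ℕ} (p : ℝ≥0∞) (ε : ℝ) (u : EuclideanSpace ℝ (Fin N) × ℝ → ℝ)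
    (x : EuclideanSpace ℝ (Fin N)) (t : ℝ) : ℝ :=
  Classical.epsilon (IsHeatPMean p ε u x t)

/-- The divergence of a vector field on `ℝᴺ`. -/
def vectorDiv {N : ℕ} (V : EuclideanSpace ℝ (Fin N) → EuclideanSpace ℝ (Fin N))
    (x : EuclideanSpace ℝ (Fin N)) : ℝ :=
  ∑ i : Fin N, (fderiv ℝ V x (EuclideanSpace.single i 1)) i

/-- The normalized `p`-Laplacian: `div(|∇v|^(p-2) ∇v) / |∇v|^(p-2)` for finite `p`, and
`⟨∇²v ∇v, ∇v⟩ / |∇v|²` for `p = ∞`. -/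
def normalizedPLaplacian {N : ℕ} (p : ℝ≥0∞) (v : EuclideanSpace ℝ (Fin N) → ℝ)
    (x : EuclideanSpace ℝ (Fin N)) : ℝ :=
  if p = ∞ then
    inner ℝ (fderiv ℝ (gradient v) x (gradient v x)) (gradient v x) / ‖gradient v x‖ ^ 2
  else
    vectorDiv (fun y => ‖gradient v y‖ ^ (p.toReal - 2) • gradient v y) x /
      ‖gradient v x‖ ^ (p.toReal - 2)

end

/-!
A parabolic rescaling composed with a rotation and a time reversal (`heatScaling`) maps a fixed
domain `heatDomain N (2 * N)` onto the heat ball `E_ε(x,t)` and carries `|y|² / s² dy ds` to a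
multiple of `ν`. If the rotation takes the first axis to the direction of `∇u(x,t)`, Taylor's
formula turns the increments of `u`, divided by `ε`, into functions
`f_ε = λ y₀ + ε (⟨Q y, y⟩ / 2 + b s) + o(ε)`, where `λ = |∇u|`, `Q` is the Hessian in the rotated
basis and `b = -u_t` (`isHeatExpansion_of_contDiffOn`). The means commute with affine changes
(`isHeatPMean_iff`), so the claim is that the `p`-mean of `f_ε` is `ε c + o(ε)` with the right `c`.

*Finite `p`.* The function `c ↦ ∫ |f - c|^p` is convex with subgradient
`-p ∫ sign (f - c) |f - c|^(p-1)`, so the sign of the last integral tells on which side of `c` the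
means lie (`IsPMean.le_of_integral_pos`, `IsPMean.le_of_integral_neg`). It is enough to find the
first-order behaviour of this integral at the points `c = ε k`. The leading part
`sign y₀ |λ y₀|^(p-1)` is odd and integrates to zero.

* For `p > 1`, dominated convergence gives the limit `(p-1) λ^(p-2) ∫ |y₀|^(p-2) (P - k)`, where `P`
  is the second-order part (`IsHeatExpansion.tendsto_integral_signedPow`). Hence `c` is the mean of
  `P` with weight `|y₀|^(p-2)`.
* For `p = 1` the mass concentrates on the hyperplane `y₀ = 0`. Slicing by parallel hyperplanes and
  rescaling the distance to it by `ε` gives the limit `(2/λ) ∫ (P - k)` over the slice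
  (`IsHeatExpansion.tendsto_integral_sign`). The slice is a heat domain of dimension `N - 1`, which
  is why `N = 1` is excluded.

The weighted moments of the heat domain are explicit (`integral_weight_mul_taylor`): the time
integrals become Gamma integrals under `s = e^(-τ) / (4π)`, and the integrals over the unit ball are
compared, through polar coordinates, with Gaussian integrals, which factor over the coordinates.

*`p = ∞`.* The mean is the midpoint of the essential range (`exists_isPMean_top_iff`). The linear
function `λ y₀` has a unique maximum point and a unique minimum point on the closed domain, both at
time `1 / (4πe)`. They are opposite to each other, so that the contributions `± λ y₀` cancel in the
midpoint, and `P`, even in `y`, has there the common value `c`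
(`IsHeatExpansion.isPMean_top_approx`).

Existence holds by compactness. Uniqueness needs, for `p = 1`, that a continuous function on the
connected domain has no gap in its range (`IsPMean.eq`, `ae_le_or_ae_ge_of_gap`). Finally the
normalized `p`-Laplacian is `tr Q + (p - 2) Q₀₀`, or `Q₀₀` for `p = ∞`
(`normalizedPLaplacian_of_ne_top`, `normalizedPLaplacian_top`).
-/

/-! ### Means of order `p` on a finite measure space -/

/-- `m` minimizes `c ↦ ‖f - c‖` in `L^p(μ)` over the real constants. -/
def IsPMean {X : Type*} [MeasurableSpace X] (p : ℝ≥0∞) (f : X → ℝ) (μ : Measure X) (m : ℝ) :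
    Prop :=
  ∀ c : ℝ, eLpNorm (fun z => f z - m) p μ ≤ eLpNorm (fun z => f z - c) p μ

/-- The odd power `sign a * |a| ^ q`. For `q = 0` it is the sign function, so that
`p * signedPow (p - 1)` is a subgradient of `|·| ^ p` for every `p ≥ 1`. -/
noncomputable def signedPow (q a : ℝ) : ℝ := Real.sign a * |a| ^ q

theorem signedPow_of_pos {q a : ℝ} (ha : 0 < a) : signedPow q a = a ^ q := by
  rw [signedPow, Real.sign_of_pos ha, abs_of_pos ha, one_mul]

theorem signedPow_of_neg {q a : ℝ} (ha : a < 0) : signedPow q a = -(-a) ^ q := by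
  rw [signedPow, Real.sign_of_neg ha, abs_of_neg ha, neg_one_mul]

theorem signedPow_zero_right (q : ℝ) : signedPow q 0 = 0 := by
  simp [signedPow, Real.sign_zero]

theorem signedPow_neg (q a : ℝ) : signedPow q (-a) = -signedPow q a := by
  simp [signedPow, Real.sign_neg]

theorem signedPow_zero_left (a : ℝ) : signedPow 0 a = Real.sign a := by
  simp [signedPow]

theorem measurable_real_sign : Measurable Real.sign := by
  unfold Real.sign
  exact Measurable.ite measurableSet_Iio measurable_const
    (Measurable.ite measurableSet_Ioi measurable_const measurable_const)

theorem measurable_signedPow (q : ℝ) : Measurable (signedPow q) :=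
  measurable_real_sign.mul (measurable_abs.pow_const q)

theorem abs_sign_le_one (a : ℝ) : |Real.sign a| ≤ 1 := by
  rcases Real.sign_apply_eq a with h | h | h <;> rw [h] <;> norm_num

theorem abs_signedPow_le (q a : ℝ) : |signedPow q a| ≤ |a| ^ q := by
  rw [signedPow, abs_mul, abs_of_nonneg (Real.rpow_nonneg (abs_nonneg a) q)]
  exact mul_le_of_le_one_left (Real.rpow_nonneg (abs_nonneg a) q) (abs_sign_le_one a)

theorem signedPow_strictMono {q : ℝ} (hq : 0 < q) : StrictMono (signedPow q) := by
  intro a b hab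
  rcases lt_trichotomy a 0 with ha | ha | ha
  · rw [signedPow_of_neg ha]
    rcases lt_trichotomy b 0 with hb | hb | hb
    · rw [signedPow_of_neg hb, neg_lt_neg_iff]
      exact Real.rpow_lt_rpow (by linarith) (by linarith) hq
    · rw [hb, signedPow_zero_right]
      have := Real.rpow_pos_of_pos (neg_pos.2 ha) q
      linarith
    · rw [signedPow_of_pos hb]
      have := Real.rpow_pos_of_pos (neg_pos.2 ha) q
      have := Real.rpow_pos_of_pos hb q
      linarith
  · subst ha
    rw [signedPow_zero_right, signedPow_of_pos hab]
    exact Real.rpow_pos_of_pos hab q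
  · rw [signedPow_of_pos ha, signedPow_of_pos (ha.trans hab)]
    exact Real.rpow_lt_rpow ha.le hab hq

theorem sign_monotone : Monotone Real.sign := by
  intro a b hab
  unfold Real.sign
  split_ifs <;> first | (exfalso; linarith) | norm_num

theorem signedPow_monotone {q : ℝ} (hq : 0 ≤ q) : Monotone (signedPow q) := by
  rcases hq.eq_or_lt with rfl | hq
  · simpa only [funext signedPow_zero_left] using sign_monotone
  · exact (signedPow_strictMono hq).monotone

/-- The subgradient inequality for `|·| ^ p`, which is Bernoulli's inequality after scaling. -/
theorem abs_rpow_sub_le_abs_sub_rpow {p : ℝ} (hp : 1 ≤ p) (a d : ℝ) :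
    |a| ^ p - p * signedPow (p - 1) a * d ≤ |a - d| ^ p := by
  rcases eq_or_ne a 0 with rfl | ha
  · rw [signedPow_zero_right, abs_zero, Real.zero_rpow (by linarith)]
    simpa using Real.rpow_nonneg (abs_nonneg d) p
  have ha' : 0 < |a| := abs_pos.2 ha
  have key : 1 - p * (d / a) ≤ |1 - d / a| ^ p := by
    rcases le_total (d / a) 1 with h | h
    · rw [abs_of_nonneg (by linarith)]
      have := one_add_mul_self_le_rpow_one_add (s := -(d / a)) (by linarith) hp
      rwa [mul_neg, ← sub_eq_add_neg, ← sub_eq_add_neg] at this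
    · refine le_trans ?_ (Real.rpow_nonneg (abs_nonneg _) p)
      nlinarith
  have h1 : |a - d| ^ p = |a| ^ p * |1 - d / a| ^ p := by
    rw [← Real.mul_rpow (abs_nonneg _) (abs_nonneg _), ← abs_mul, mul_sub, mul_one,
      mul_div_cancel₀ _ ha]
  have h2 : signedPow (p - 1) a * d = |a| ^ p * (d / a) := by
    rcases lt_or_gt_of_ne ha with h | h
    · rw [signedPow_of_neg h, abs_of_neg h, Real.rpow_sub_one (by linarith)]
      field_simp
    · rw [signedPow_of_pos h, abs_of_pos h, Real.rpow_sub_one (by linarith)]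
      field_simp
  rw [h1, mul_assoc, h2]
  have := mul_le_mul_of_nonneg_left key (Real.rpow_nonneg ha'.le p)
  linarith

section PMean

variable {X : Type*} [MeasurableSpace X] {μ : Measure X} [IsFiniteMeasure μ] {f : X → ℝ} {K : ℝ}

theorem integrable_comp_sub_of_bounded (hf : AEStronglyMeasurable f μ) (hK : ∀ᵐ z ∂μ, |f z| ≤ K)
    {g : ℝ → ℝ} (hg : Measurable g) {B : ℝ} {c : ℝ} (hB : ∀ a, |a| ≤ K + |c| → |g a| ≤ B) :
    Integrable (fun z => g (f z - c)) μ := by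
  refine Integrable.of_bound (C := B)
    (hg.comp_aemeasurable (hf.aemeasurable.sub_const c)).aestronglyMeasurable ?_
  filter_upwards [hK] with z hz
  refine hB _ ((abs_sub _ _).trans (by linarith))

theorem integrable_abs_sub_rpow (hf : AEStronglyMeasurable f μ) (hK : ∀ᵐ z ∂μ, |f z| ≤ K)
    {q : ℝ} (hq : 0 ≤ q) (c : ℝ) : Integrable (fun z => |f z - c| ^ q) μ := by
  refine integrable_comp_sub_of_bounded (g := fun a => |a| ^ q) (B := (K + |c|) ^ q) hf hK
    (measurable_abs.pow_const q) fun a ha => ?_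
  rw [abs_of_nonneg (Real.rpow_nonneg (abs_nonneg _) _)]
  exact Real.rpow_le_rpow (abs_nonneg _) ha hq

theorem integrable_signedPow_sub (hf : AEStronglyMeasurable f μ) (hK : ∀ᵐ z ∂μ, |f z| ≤ K)
    {q : ℝ} (hq : 0 ≤ q) (c : ℝ) : Integrable (fun z => signedPow q (f z - c)) μ := by
  refine integrable_comp_sub_of_bounded (B := (K + |c|) ^ q) hf hK
    (measurable_signedPow q) fun a ha => ?_
  exact (abs_signedPow_le q a).trans (Real.rpow_le_rpow (abs_nonneg _) ha hq)

theorem isPMean_iff_integral_le (hf : AEStronglyMeasurable f μ) (hK : ∀ᵐ z ∂μ, |f z| ≤ K)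
    {p : ℝ≥0∞} (hp : 1 ≤ p) (hp' : p ≠ ∞) (m : ℝ) :
    IsPMean p f μ m ↔
      ∀ c, ∫ z, |f z - m| ^ p.toReal ∂μ ≤ ∫ z, |f z - c| ^ p.toReal ∂μ := by
  have hp0 : p ≠ 0 := (zero_lt_one.trans_le hp).ne'
  have hpr : 0 < p.toReal := ENNReal.toReal_pos hp0 hp'
  have hm : ∀ c, eLpNorm (fun z => f z - c) p μ =
      ENNReal.ofReal ((∫ z, |f z - c| ^ p.toReal ∂μ) ^ p.toReal⁻¹) := fun c => by
    have hmem : MemLp (fun z => f z - c) p μ := by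
      refine MemLp.of_bound (hf.sub aestronglyMeasurable_const) (K + |c|) ?_
      filter_upwards [hK] with z hz
      exact (norm_sub_le _ _).trans (add_le_add hz le_rfl)
    rw [hmem.eLpNorm_eq_integral_rpow_norm hp0 hp']
    rfl
  have hnn : ∀ c, 0 ≤ ∫ z, |f z - c| ^ p.toReal ∂μ := fun c =>
    integral_nonneg fun z => Real.rpow_nonneg (abs_nonneg _) _
  refine forall_congr' fun c => ?_
  rw [hm, hm, ENNReal.ofReal_le_ofReal_iff (Real.rpow_nonneg (hnn c) _),
    Real.rpow_le_rpow_iff (hnn m) (hnn c) (inv_pos.2 hpr)]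

/-- The subgradient inequality integrated: moving from `c` against the sign of
`∫ signedPow (p - 1) (f - c)` does not decrease the `L^p` distance. -/
theorem integral_abs_sub_rpow_ge (hf : AEStronglyMeasurable f μ) (hK : ∀ᵐ z ∂μ, |f z| ≤ K)
    {p : ℝ} (hp : 1 ≤ p) (c m : ℝ) :
    ∫ z, |f z - c| ^ p ∂μ - p * (m - c) * ∫ z, signedPow (p - 1) (f z - c) ∂μ ≤
      ∫ z, |f z - m| ^ p ∂μ := by
  rw [← integral_const_mul, ← integral_sub (integrable_abs_sub_rpow hf hK (by linarith) c)
    ((integrable_signedPow_sub hf hK (by linarith) c).const_mul _)]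
  refine integral_mono ((integrable_abs_sub_rpow hf hK (by linarith) c).sub
    ((integrable_signedPow_sub hf hK (by linarith) c).const_mul _))
    (integrable_abs_sub_rpow hf hK (by linarith) m) fun z => ?_
  have := abs_rpow_sub_le_abs_sub_rpow hp (f z - c) (m - c)
  rw [sub_sub_sub_cancel_right] at this
  exact le_trans (le_of_eq (by ring)) this

/-- The sign of `∫ signedPow (p - 1) (f - c)` tells on which side of `c` the means lie. -/
theorem IsPMean.le_of_integral_pos {p : ℝ≥0∞} (hp : 1 ≤ p) (hp' : p ≠ ∞)
    (hf : AEStronglyMeasurable f μ) (hK : ∀ᵐ z ∂μ, |f z| ≤ K) {m c : ℝ} (hm : IsPMean p f μ m)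
    (hc : 0 < ∫ z, signedPow (p.toReal - 1) (f z - c) ∂μ) : c ≤ m := by
  have hpr : 1 ≤ p.toReal := by simpa using ENNReal.toReal_mono hp' hp
  by_contra! h
  have h1 := (isPMean_iff_integral_le hf hK hp hp' m).1 hm c
  have h2 := integral_abs_sub_rpow_ge hf hK hpr c m
  have : 0 < p.toReal * (c - m) * ∫ z, signedPow (p.toReal - 1) (f z - c) ∂μ := by
    have : 0 < c - m := by linarith
    positivity
  nlinarith

theorem IsPMean.le_of_integral_neg {p : ℝ≥0∞} (hp : 1 ≤ p) (hp' : p ≠ ∞)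
    (hf : AEStronglyMeasurable f μ) (hK : ∀ᵐ z ∂μ, |f z| ≤ K) {m c : ℝ} (hm : IsPMean p f μ m)
    (hc : ∫ z, signedPow (p.toReal - 1) (f z - c) ∂μ < 0) : m ≤ c := by
  have hpr : 1 ≤ p.toReal := by simpa using ENNReal.toReal_mono hp' hp
  by_contra! h
  have h1 := (isPMean_iff_integral_le hf hK hp hp' m).1 hm c
  have h2 := integral_abs_sub_rpow_ge hf hK hpr c m
  have : 0 < p.toReal * (m - c) * -∫ z, signedPow (p.toReal - 1) (f z - c) ∂μ := by
    have : 0 < m - c := by linarith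
    have := neg_pos.2 hc
    positivity
  nlinarith

theorem exists_isPMean {p : ℝ≥0∞} (hp : 1 ≤ p) (hp' : p ≠ ∞)
    (hf : AEStronglyMeasurable f μ) (hK : ∀ᵐ z ∂μ, |f z| ≤ K) (hK0 : 0 ≤ K) :
    ∃ m, IsPMean p f μ m := by
  have hpr : 1 ≤ p.toReal := by simpa using ENNReal.toReal_mono hp' hp
  have hcont : ContinuousOn (fun c => ∫ z, |f z - c| ^ p.toReal ∂μ) (Set.Icc (-K) K) := by
    refine continuousOn_of_dominated (bound := fun _ => (2 * K) ^ p.toReal)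
      (fun c _ => (integrable_abs_sub_rpow hf hK (by linarith) c).aestronglyMeasurable)
      (fun c hc => ?_) (integrable_const _) (ae_of_all _ fun z => ?_)
    · filter_upwards [hK] with z hz
      rw [Real.norm_of_nonneg (Real.rpow_nonneg (abs_nonneg _) _)]
      have := abs_le.2 hc
      exact Real.rpow_le_rpow (abs_nonneg _) ((abs_sub _ _).trans (by linarith)) (by linarith)
    · exact ((continuous_const.sub continuous_id).abs.rpow_const
        fun _ => Or.inr (by linarith)).continuousOn
  obtain ⟨m, -, hm⟩ := isCompact_Icc.exists_isMinOn
    (Set.nonempty_Icc.2 (by linarith : -K ≤ K)) hcont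
  refine ⟨m, (isPMean_iff_integral_le hf hK hp hp' m).2 fun c => ?_⟩
  -- Projecting a constant to `[-K, K]` brings it closer to every value of `f`.
  refine (hm (a := max (-K) (min K c)) ⟨le_max_left _ _, max_le (by linarith)
    (min_le_left _ _)⟩).trans ?_
  refine integral_mono_ae (integrable_abs_sub_rpow hf hK (by linarith) _)
    (integrable_abs_sub_rpow hf hK (by linarith) c) ?_
  filter_upwards [hK] with z hz
  refine Real.rpow_le_rpow (abs_nonneg _) ?_ (by linarith)
  have := abs_le.1 hz
  rcases le_total K c with h1 | h1
  · rw [min_eq_left h1, max_eq_right (by linarith), abs_of_nonpos (by linarith),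
      abs_of_nonpos (by linarith)]
    linarith
  · rw [min_eq_right h1]
    rcases le_total (-K) c with h2 | h2
    · rw [max_eq_right h2]
    · rw [max_eq_left h2, abs_of_nonneg (by linarith), abs_of_nonneg (by linarith)]
      linarith

/-- Uniqueness of the mean of order `p < ∞`. For `p = 1` the mean is a median, and the hypothesis
`hconn`, that `f` has no gap in its essential range, cannot be dropped. -/
theorem IsPMean.eq {p : ℝ≥0∞} (hp : 1 ≤ p) (hp' : p ≠ ∞) (hμ : μ ≠ 0)
    (hf : AEStronglyMeasurable f μ) (hK : ∀ᵐ z ∂μ, |f z| ≤ K)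
    (hconn : ∀ a b, a < b → (∀ᵐ z ∂μ, f z ≤ a ∨ b ≤ f z) →
      (∀ᵐ z ∂μ, f z ≤ a) ∨ ∀ᵐ z ∂μ, b ≤ f z)
    {m₁ m₂ : ℝ} (h₁ : IsPMean p f μ m₁) (h₂ : IsPMean p f μ m₂) : m₁ = m₂ := by
  have hpr : 1 ≤ p.toReal := by simpa using ENNReal.toReal_mono hp' hp
  wlog hlt : m₁ < m₂ generalizing m₁ m₂
  · rcases lt_trichotomy m₁ m₂ with h | h | h
    · exact this h₁ h₂ h
    · exact h
    · exact (this h₂ h₁ h).symm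
  exfalso
  have := (ae_neBot (μ := μ)).2 hμ
  have hG : ∀ c ∈ Set.Ioo m₁ m₂, ∫ z, signedPow (p.toReal - 1) (f z - c) ∂μ = 0 := by
    intro c hc
    refine le_antisymm (not_lt.1 fun h => ?_) (not_lt.1 fun h => ?_)
    · exact absurd (h₁.le_of_integral_pos hp hp' hf hK h) (not_le.2 hc.1)
    · exact absurd (h₂.le_of_integral_neg hp hp' hf hK h) (not_le.2 hc.2)
  obtain ⟨a, ha1, ha2⟩ := exists_between hlt
  obtain ⟨b, hb1, hb2⟩ := exists_between ha2
  have hGa := hG a ⟨ha1, ha2⟩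
  have hGb := hG b ⟨ha1.trans hb1, hb2⟩
  have hia := integrable_signedPow_sub hf hK (q := p.toReal - 1) (by linarith) a
  have hib := integrable_signedPow_sub hf hK (q := p.toReal - 1) (by linarith) b
  have hae : ∀ᵐ z ∂μ, signedPow (p.toReal - 1) (f z - a) = signedPow (p.toReal - 1) (f z - b) := by
    have h0 : ∫ z, (signedPow (p.toReal - 1) (f z - a) - signedPow (p.toReal - 1) (f z - b)) ∂μ
        = 0 := by
      rw [integral_sub hia hib, hGa, hGb, sub_zero]
    rw [integral_eq_zero_iff_of_nonneg_ae (ae_of_all _ fun z => sub_nonneg.2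
      (signedPow_monotone (by linarith) (by linarith))) (hia.sub hib)] at h0
    filter_upwards [h0] with z hz using sub_eq_zero.1 hz
  rcases hpr.eq_or_lt with h1 | h1
  · simp only [← h1, sub_self, signedPow_zero_left] at hae hGa hGb
    have hgap : ∀ᵐ z ∂μ, f z ≤ a ∨ b ≤ f z := by
      filter_upwards [hae] with z hz
      by_contra! h
      rw [Real.sign_of_pos (by linarith), Real.sign_of_neg (by linarith)] at hz
      norm_num at hz
    have hpos : 0 < μ.real Set.univ := by
      rw [Measure.real, ENNReal.toReal_pos_iff]
      exact ⟨(Measure.measure_univ_pos).2 hμ, measure_lt_top _ _⟩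
    rcases hconn a b hb1 hgap with h | h
    · have : ∫ z, Real.sign (f z - b) ∂μ = ∫ z, (-1 : ℝ) ∂μ := by
        refine integral_congr_ae ?_
        filter_upwards [h] with z hz using Real.sign_of_neg (by linarith)
      rw [hGb, integral_const] at this
      simp at this
      linarith
    · have : ∫ z, Real.sign (f z - a) ∂μ = ∫ z, (1 : ℝ) ∂μ := by
        refine integral_congr_ae ?_
        filter_upwards [h] with z hz using Real.sign_of_pos (by linarith)
      rw [hGa, integral_const] at this
      simp at this
      linarith
  · obtain ⟨z, hz⟩ := hae.exists
    exact absurd ((signedPow_strictMono (by linarith)).injective hz) (by linarith)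

end PMean

section PMeanTop

variable {X : Type*} [MeasurableSpace X] {μ : Measure X} {f : X → ℝ} {K : ℝ}

theorem exists_essential_upper_bound (hμ : μ ≠ 0) (hK : ∀ᵐ z ∂μ, |f z| ≤ K) :
    ∃ S : ℝ, ∀ r, (∀ᵐ z ∂μ, f z ≤ r) ↔ S ≤ r := by
  have := (ae_neBot (μ := μ)).2 hμ
  have hb : IsBoundedUnder (· ≤ ·) (ae μ) f :=
    ⟨K, by rw [eventually_map]; filter_upwards [hK] with z hz using (abs_le.1 hz).2⟩
  have hb' : IsBoundedUnder (· ≥ ·) (ae μ) f :=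
    ⟨-K, by rw [eventually_map]; filter_upwards [hK] with z hz using (abs_le.1 hz).1⟩
  refine ⟨essSup f μ, fun r => ⟨fun h => essSup_le_of_ae_le r h hb'.isCoboundedUnder_le,
    fun h => ?_⟩⟩
  filter_upwards [ae_le_essSup hb] with z hz using hz.trans h

/-- In `L^∞` the best constant is the midpoint of the essential range. -/
theorem exists_isPMean_top_iff (hμ : μ ≠ 0) (hK : ∀ᵐ z ∂μ, |f z| ≤ K) :
    ∃ S I : ℝ, (∀ r, (∀ᵐ z ∂μ, f z ≤ r) ↔ S ≤ r) ∧ (∀ r, (∀ᵐ z ∂μ, r ≤ f z) ↔ r ≤ I) ∧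
      ∀ m, IsPMean ∞ f μ m ↔ m = (S + I) / 2 := by
  have := (ae_neBot (μ := μ)).2 hμ
  obtain ⟨S, hS⟩ := exists_essential_upper_bound hμ hK
  obtain ⟨I', hI'⟩ := exists_essential_upper_bound (f := fun z => -f z) hμ (by simpa using hK)
  have hI : ∀ r, (∀ᵐ z ∂μ, r ≤ f z) ↔ r ≤ -I' := fun r => by
    rw [le_neg, ← hI' (-r)]
    simp only [neg_le_neg_iff]
  refine ⟨S, -I', hS, hI, fun m => ?_⟩
  have hIS : -I' ≤ S := by
    obtain ⟨z, h1, h2⟩ := (((hS S).2 le_rfl).and ((hI _).2 le_rfl)).exists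
    exact h2.trans h1
  have hle : ∀ c r : ℝ, 0 ≤ r → (eLpNorm (fun z => f z - c) ∞ μ ≤ ENNReal.ofReal r ↔
      S - c ≤ r ∧ c + I' ≤ r) := by
    intro c r hr
    rw [eLpNorm_exponent_top, eLpNormEssSup,
      show essSup (fun z => ‖f z - c‖ₑ) μ ≤ ENNReal.ofReal r ↔
        ∀ᵐ z ∂μ, ‖f z - c‖ₑ ≤ ENNReal.ofReal r from
        ⟨fun h => (ENNReal.ae_le_essSup _).mono fun z hz => hz.trans h,
          fun h => essSup_le_of_ae_le _ h⟩]
    have : (∀ᵐ z ∂μ, ‖f z - c‖ₑ ≤ ENNReal.ofReal r) ↔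
        (∀ᵐ z ∂μ, f z ≤ r + c) ∧ ∀ᵐ z ∂μ, c - r ≤ f z := by
      rw [← eventually_and]
      refine eventually_congr (ae_of_all _ fun z => ?_)
      rw [← ofReal_norm, ENNReal.ofReal_le_ofReal_iff hr, Real.norm_eq_abs, abs_le]
      constructor <;> rintro ⟨h1, h2⟩ <;> constructor <;> linarith
    rw [this, hS, hI]
    constructor <;> rintro ⟨h1, h2⟩ <;> constructor <;> linarith
  have hval : ∀ c : ℝ, eLpNorm (fun z => f z - c) ∞ μ =
      ENNReal.ofReal (max (S - c) (c + I')) := by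
    intro c
    have h0 : 0 ≤ max (S - c) (c + I') := by
      rcases le_total c S with h | h
      · exact le_max_of_le_left (by linarith)
      · exact le_max_of_le_right (by linarith)
    have hub := (hle c _ h0).2 ⟨le_max_left _ _, le_max_right _ _⟩
    refine le_antisymm hub ?_
    have hfin : eLpNorm (fun z => f z - c) ∞ μ ≠ ∞ := ne_top_of_le_ne_top ENNReal.ofReal_ne_top hub
    have h1 := (hle c _ ENNReal.toReal_nonneg).1 (ENNReal.ofReal_toReal hfin).ge
    rw [← ENNReal.ofReal_toReal hfin]
    exact ENNReal.ofReal_le_ofReal (max_le h1.1 h1.2)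
  constructor
  · intro h
    have h1 := h ((S + -I') / 2)
    rw [hval, hval, ENNReal.ofReal_le_ofReal_iff (le_max_of_le_left (by linarith))] at h1
    have h2 := max_le_iff.1 h1
    rw [max_eq_left (by linarith)] at h2
    linarith
  · rintro rfl c
    rw [hval, hval]
    refine ENNReal.ofReal_le_ofReal (max_le ?_ ?_) <;>
      rw [le_max_iff] <;> rcases le_total c ((S + -I') / 2) with h | h
    all_goals first | (left; linarith) | (right; linarith)

end PMeanTop

/-! ### The normalized heat ball -/

/-- The function `s ↦ s * log (1 / (4πs))`, to which the squared radius of the time slices of a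
heat ball is proportional. -/
noncomputable def heatProfile (s : ℝ) : ℝ := Real.negMulLog (4 * Real.pi * s) / (4 * Real.pi)

/-- The heat ball of size `1` with pole at the origin, with time reversed, in space dimension `n`.
The factor `α` in the squared radius of the slices is `2n` for the genuine heat ball; other values
occur for the slice of a heat ball by a hyperplane. -/
def heatDomain (n : ℕ) (α : ℝ) : Set (EuclideanSpace ℝ (Fin n) × ℝ) :=
  {q | 0 < q.2 ∧ ‖q.1‖ ^ 2 < α * heatProfile q.2}

/-- The measure `|y|² / s² dy ds` on `heatDomain n α`. -/
noncomputable def heatDomainMeasure (n : ℕ) (α : ℝ) : Measure (EuclideanSpace ℝ (Fin n) × ℝ) :=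
  (volume.restrict (heatDomain n α)).withDensity fun q => ENNReal.ofReal (‖q.1‖ ^ 2 / q.2 ^ 2)

theorem heatProfile_eq (s : ℝ) : heatProfile s = s * -Real.log (4 * Real.pi * s) := by
  rw [heatProfile, Real.negMulLog]
  have := Real.pi_pos
  field_simp

theorem continuous_heatProfile : Continuous heatProfile := by
  unfold heatProfile
  fun_prop

theorem heatProfile_pos {s : ℝ} (hs : s ∈ Set.Ioo 0 (1 / (4 * Real.pi))) : 0 < heatProfile s := by
  have hpi := Real.pi_pos
  rw [heatProfile_eq]
  refine mul_pos hs.1 (neg_pos.2 (Real.log_neg (by have := hs.1; positivity) ?_))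
  have := hs.2
  rw [lt_div_iff₀ (by positivity)] at this
  linarith

theorem lt_of_heatProfile_pos {s : ℝ} (hs : 0 < s) (h : 0 < heatProfile s) :
    s < 1 / (4 * Real.pi) := by
  have hpi := Real.pi_pos
  rw [heatProfile_eq] at h
  have h1 : Real.log (4 * Real.pi * s) < 0 := by
    have := (pos_iff_pos_of_mul_pos h).1 hs
    linarith
  have h2 : 4 * Real.pi * s < 1 := by
    by_contra! h3
    exact absurd (Real.log_nonneg h3) (by linarith)
  rw [lt_div_iff₀ (by positivity)]
  linarith

/-- The slices of the heat ball are largest at time `1 / (4πe)`. -/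
theorem heatProfile_le {s : ℝ} (hs : 0 ≤ s) : heatProfile s ≤ 1 / (4 * Real.pi * Real.exp 1) := by
  have hpi := Real.pi_pos
  have he := Real.exp_pos 1
  have h1 := Real.negMulLog_le_one_sub_self (x := 4 * Real.pi * s * Real.exp 1) (by positivity)
  rw [Real.negMulLog_mul] at h1
  have h2 : Real.negMulLog (Real.exp 1) = -Real.exp 1 := by simp [Real.negMulLog]
  rw [h2] at h1
  rw [heatProfile, div_le_div_iff₀ (by positivity) (by positivity)]
  nlinarith

theorem heatProfile_lt {s : ℝ} (hs : 0 ≤ s) (hne : s ≠ 1 / (4 * Real.pi * Real.exp 1)) :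
    heatProfile s < 1 / (4 * Real.pi * Real.exp 1) := by
  have hpi := Real.pi_pos
  have he := Real.exp_pos 1
  have hne' : 4 * Real.pi * s * Real.exp 1 ≠ 1 := by
    intro h
    apply hne
    rw [eq_div_iff (by positivity)]
    linarith
  have h1 := Real.negMulLog_lt_one_sub_self (x := 4 * Real.pi * s * Real.exp 1) (by positivity) hne'
  rw [Real.negMulLog_mul] at h1
  have h2 : Real.negMulLog (Real.exp 1) = -Real.exp 1 := by simp [Real.negMulLog]
  rw [h2] at h1
  rw [heatProfile, div_lt_div_iff₀ (by positivity) (by positivity)]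
  nlinarith

theorem heatProfile_max :
    heatProfile (1 / (4 * Real.pi * Real.exp 1)) = 1 / (4 * Real.pi * Real.exp 1) := by
  have hpi := Real.pi_pos
  have he := Real.exp_pos 1
  have h : 4 * Real.pi * (1 / (4 * Real.pi * Real.exp 1)) = (Real.exp 1)⁻¹ := by field_simp
  rw [heatProfile_eq, h, Real.log_inv, Real.log_exp, neg_neg, mul_one]

section

variable {n : ℕ} {α : ℝ}

theorem isOpen_heatDomain : IsOpen (heatDomain n α) :=
  (isOpen_lt continuous_const continuous_snd).inter
    (isOpen_lt (by fun_prop) (continuous_const.mul (continuous_heatProfile.comp continuous_snd)))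

theorem measurableSet_heatDomain : MeasurableSet (heatDomain n α) := isOpen_heatDomain.measurableSet

theorem heatProfile_pos_of_mem (hα : 0 < α) {q : EuclideanSpace ℝ (Fin n) × ℝ}
    (hq : q ∈ heatDomain n α) : 0 < heatProfile q.2 :=
  pos_of_mul_pos_right ((sq_nonneg _).trans_lt hq.2) hα.le

theorem snd_mem_Ioo_of_mem_heatDomain (hα : 0 < α) {q : EuclideanSpace ℝ (Fin n) × ℝ}
    (hq : q ∈ heatDomain n α) : q.2 ∈ Set.Ioo 0 (1 / (4 * Real.pi)) :=
  ⟨hq.1, lt_of_heatProfile_pos hq.1 (heatProfile_pos_of_mem hα hq)⟩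

theorem norm_sq_le_of_mem_heatDomain (hα : 0 < α) {q : EuclideanSpace ℝ (Fin n) × ℝ}
    (hq : q ∈ heatDomain n α) : ‖q.1‖ ^ 2 ≤ α / (4 * Real.pi * Real.exp 1) := by
  have := mul_le_mul_of_nonneg_left (heatProfile_le hq.1.le) hα.le
  rw [mul_one_div] at this
  exact hq.2.le.trans this

theorem heatDomain_subset (hα : 0 < α) : ∃ M, heatDomain n α ⊆
    Metric.closedBall 0 M ×ˢ Set.Icc 0 1 := by
  refine ⟨Real.sqrt (α / (4 * Real.pi * Real.exp 1)), fun q hq => ⟨?_, hq.1.le, ?_⟩⟩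
  · rw [mem_closedBall_zero_iff]
    exact Real.le_sqrt_of_sq_le (norm_sq_le_of_mem_heatDomain hα hq)
  · refine (snd_mem_Ioo_of_mem_heatDomain hα hq).2.le.trans ?_
    rw [div_le_one (by positivity)]
    linarith [Real.pi_gt_three]

theorem zero_mem_heatDomain (hα : 0 < α) {s : ℝ} (hs : s ∈ Set.Ioo 0 (1 / (4 * Real.pi))) :
    ((0 : EuclideanSpace ℝ (Fin n)), s) ∈ heatDomain n α := by
  refine ⟨hs.1, ?_⟩
  simpa using mul_pos hα (heatProfile_pos hs)

theorem heatDomain_nonempty (hα : 0 < α) : (heatDomain n α).Nonempty := by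
  have hpi := Real.pi_pos
  obtain ⟨s, hs⟩ := exists_between (show (0 : ℝ) < 1 / (4 * Real.pi) by positivity)
  exact ⟨_, zero_mem_heatDomain hα hs⟩

theorem isPreconnected_heatDomain (hα : 0 < α) : IsPreconnected (heatDomain n α) := by
  have hpi := Real.pi_pos
  obtain ⟨s₀, hs₀⟩ := exists_between (show (0 : ℝ) < 1 / (4 * Real.pi) by positivity)
  refine isPreconnected_of_forall (0, s₀) fun q hq => ?_
  have hq2 := snd_mem_Ioo_of_mem_heatDomain hα hq
  have hR := heatProfile_pos hq2
  -- Every point is joined to the time axis inside its time slice.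
  refine ⟨({0} ×ˢ Set.Ioo 0 (1 / (4 * Real.pi))) ∪
    (Metric.ball 0 (Real.sqrt (α * heatProfile q.2)) ×ˢ {q.2}), ?_, Or.inl ⟨rfl, hs₀⟩,
    Or.inr ⟨?_, rfl⟩, ?_⟩
  · rintro ⟨y, s⟩ (⟨hy, hs⟩ | ⟨hy, hs⟩)
    · obtain rfl : y = 0 := hy
      exact zero_mem_heatDomain hα hs
    · obtain rfl : s = q.2 := hs
      rw [mem_ball_zero_iff, Real.lt_sqrt (norm_nonneg _)] at hy
      exact ⟨hq2.1, hy⟩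
  · rw [mem_ball_zero_iff, Real.lt_sqrt (norm_nonneg _)]
    exact hq.2
  · refine IsPreconnected.union ((0 : EuclideanSpace ℝ (Fin n)), q.2) ⟨rfl, hq2⟩ ⟨?_, rfl⟩ ?_ ?_
    · exact Metric.mem_ball_self (Real.sqrt_pos.2 (mul_pos hα hR))
    · exact isPreconnected_singleton.prod isPreconnected_Ioo
    · exact (convex_ball _ _).isPreconnected.prod isPreconnected_singleton

theorem measurable_heatDensity : Measurable
    fun q : EuclideanSpace ℝ (Fin n) × ℝ => ‖q.1‖ ^ 2 / q.2 ^ 2 :=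
  (measurable_fst.norm.pow_const 2).div (measurable_snd.pow_const 2)

theorem heatDomainMeasure_absolutelyContinuous :
    heatDomainMeasure n α ≪ volume.restrict (heatDomain n α) :=
  withDensity_absolutelyContinuous _ _

theorem ae_heatDomainMeasure_of_forall {P : EuclideanSpace ℝ (Fin n) × ℝ → Prop}
    (h : ∀ q ∈ heatDomain n α, P q) : ∀ᵐ q ∂heatDomainMeasure n α, P q :=
  heatDomainMeasure_absolutelyContinuous.ae_le
    ((ae_restrict_iff' measurableSet_heatDomain).2 (ae_of_all _ h))

theorem aestronglyMeasurable_heatDomainMeasure {f : EuclideanSpace ℝ (Fin n) × ℝ → ℝ}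
    (hf : ContinuousOn f (heatDomain n α)) : AEStronglyMeasurable f (heatDomainMeasure n α) :=
  (hf.aestronglyMeasurable measurableSet_heatDomain).mono_ac heatDomainMeasure_absolutelyContinuous

theorem volume_setOf_fst_eq [Nonempty (Fin n)] (x : EuclideanSpace ℝ (Fin n)) :
    volume {q : EuclideanSpace ℝ (Fin n) × ℝ | q.1 = x} = 0 := by
  have : {q : EuclideanSpace ℝ (Fin n) × ℝ | q.1 = x} = {x} ×ˢ Set.univ := by
    ext q; simp
  rw [this, Measure.volume_eq_prod, Measure.prod_prod, measure_singleton, zero_mul]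

/-- The measure charges every nonempty open subset of the domain, since its density only
vanishes on the time axis. -/
theorem eq_empty_of_ae_notMem [Nonempty (Fin n)] {U : Set (EuclideanSpace ℝ (Fin n) × ℝ)}
    (hU : IsOpen U) (hUD : U ⊆ heatDomain n α) (h : ∀ᵐ q ∂heatDomainMeasure n α, q ∉ U) :
    U = ∅ := by
  rw [heatDomainMeasure, ae_withDensity_iff measurable_heatDensity.ennreal_ofReal,
    ae_restrict_iff' measurableSet_heatDomain] at h
  have h0 : ∀ᵐ q : EuclideanSpace ℝ (Fin n) × ℝ, q.1 ≠ 0 := by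
    rw [ae_iff]
    simpa using volume_setOf_fst_eq (n := n) 0
  have h1 : volume U = 0 := by
    rw [measure_eq_zero_iff_ae_notMem]
    filter_upwards [h, h0] with q hq hq0 hqU
    refine hq (hUD hqU) ?_ hqU
    have := (hUD hqU).1
    have := norm_pos_iff.2 hq0
    rw [ne_eq, ENNReal.ofReal_eq_zero, not_le]
    positivity
  exact (hU.measure_eq_zero_iff volume).1 h1

theorem heatDomainMeasure_ne_zero [Nonempty (Fin n)] (hα : 0 < α) :
    heatDomainMeasure n α ≠ 0 := by
  intro h
  have := eq_empty_of_ae_notMem (n := n) (α := α) isOpen_heatDomain subset_rfl (by simp [h])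
  exact (heatDomain_nonempty hα).ne_empty this

theorem forall_le_of_ae_le [Nonempty (Fin n)] {f : EuclideanSpace ℝ (Fin n) × ℝ → ℝ}
    (hf : ContinuousOn f (heatDomain n α)) {r : ℝ} (h : ∀ᵐ q ∂heatDomainMeasure n α, f q ≤ r) :
    ∀ q ∈ heatDomain n α, f q ≤ r := by
  have hU := hf.isOpen_inter_preimage isOpen_heatDomain (isOpen_Ioi (a := r))
  have := eq_empty_of_ae_notMem hU Set.inter_subset_left
    (h.mono fun q hq hqU => not_lt.2 hq hqU.2)
  intro q hq
  by_contra! hlt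
  exact (this.subset ⟨hq, hlt⟩ : q ∈ (∅ : Set _))

/-- By connectedness of the heat ball, a continuous function has no gap in its essential range. -/
theorem ae_le_or_ae_ge_of_gap [Nonempty (Fin n)] (hα : 0 < α)
    {f : EuclideanSpace ℝ (Fin n) × ℝ → ℝ} (hf : ContinuousOn f (heatDomain n α)) {a b : ℝ}
    (hab : a < b) (h : ∀ᵐ q ∂heatDomainMeasure n α, f q ≤ a ∨ b ≤ f q) :
    (∀ᵐ q ∂heatDomainMeasure n α, f q ≤ a) ∨ ∀ᵐ q ∂heatDomainMeasure n α, b ≤ f q := by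
  have hU := hf.isOpen_inter_preimage isOpen_heatDomain (isOpen_Ioo (a := a) (b := b))
  have hempty := eq_empty_of_ae_notMem hU Set.inter_subset_left
    (h.mono fun q hq hqU => hq.elim (not_le.2 hqU.2.1) (not_le.2 hqU.2.2))
  have hgap : ∀ q ∈ heatDomain n α, f q ∉ Set.Ioo a b := fun q hq hqf =>
    (hempty.subset ⟨hq, hqf⟩ : q ∈ (∅ : Set _))
  by_contra hcon
  rw [not_or] at hcon
  have h1 : ∃ q ∈ heatDomain n α, a < f q := by
    by_contra! h1
    exact hcon.1 (ae_heatDomainMeasure_of_forall h1)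
  have h2 : ∃ q ∈ heatDomain n α, f q < b := by
    by_contra! h2
    exact hcon.2 (ae_heatDomainMeasure_of_forall h2)
  obtain ⟨q₁, hq₁, h1⟩ := h1
  obtain ⟨q₂, hq₂, h2⟩ := h2
  have h1' : b ≤ f q₁ := not_lt.1 fun h => hgap q₁ hq₁ ⟨h1, h⟩
  have h2' : f q₂ ≤ a := not_lt.1 fun h => hgap q₂ hq₂ ⟨h, h2⟩
  have hoc := ((isPreconnected_heatDomain hα).image f hf).ordConnected
  obtain ⟨c, hc1, hc2⟩ := exists_between hab
  obtain ⟨q, hq, rfl⟩ := hoc.out (Set.mem_image_of_mem f hq₂) (Set.mem_image_of_mem f hq₁)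
    ⟨h2'.trans hc1.le, hc2.le.trans h1'⟩
  exact hgap q hq ⟨hc1, hc2⟩

end

/-! ### Integrals of homogeneous functions -/

section Polar

variable {E : Type*} [NormedAddCommGroup E] [NormedSpace ℝ E] [FiniteDimensional ℝ E]
  [MeasurableSpace E] [BorelSpace E]

/-- `f` is positively homogeneous of degree `d`. -/
def PosHomogeneous {E : Type*} [SMul ℝ E] (d : ℝ) (f : E → ℝ) : Prop :=
  ∀ r : ℝ, 0 < r → ∀ y, f (r • y) = r ^ d * f y

/-- Integration in polar coordinates of a homogeneous function times a radial one. -/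
theorem PosHomogeneous.integral_mul_norm [Nontrivial E] (μ : Measure E) [μ.IsAddHaarMeasure]
    {f : E → ℝ} {d : ℝ} (hf : PosHomogeneous d f) (g : ℝ → ℝ) :
    ∫ y, f y * g ‖y‖ ∂μ = (∫ θ : Metric.sphere (0 : E) 1, f θ ∂μ.toSphere) *
      ∫ r in Set.Ioi (0 : ℝ), r ^ ((Module.finrank ℝ E : ℝ) - 1 + d) * g r :=
  calc
    ∫ y, f y * g ‖y‖ ∂μ = ∫ y : ({(0)}ᶜ : Set E), f y.1 * g (‖y.1‖) ∂(μ.comap (↑)) := by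
      rw [integral_subtype_comap (measurableSet_singleton _).compl fun y ↦ f y * g (‖y‖),
        restrict_compl_singleton]
    _ = ∫ z : Metric.sphere (0 : E) 1 × Set.Ioi (0 : ℝ), f z.1 * ((z.2 : ℝ) ^ d * g z.2)
          ∂μ.toSphere.prod (.volumeIoiPow (Module.finrank ℝ E - 1)) := by
      rw [← μ.measurePreserving_homeomorphUnitSphereProd.integral_comp
        (Homeomorph.measurableEmbedding _)]
      refine integral_congr_ae (ae_of_all _ fun y => ?_)
      have hy : 0 < ‖(y : E)‖ := norm_pos_iff.2 y.2
      have h := hf ‖(y : E)‖ hy (‖(y : E)‖⁻¹ • (y : E))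
      rw [smul_smul, mul_inv_cancel₀ hy.ne', one_smul] at h
      simp only [homeomorphUnitSphereProd_apply_snd_coe, homeomorphUnitSphereProd_apply_fst_coe]
      rw [h]
      ring
    _ = _ := by
      rw [integral_prod_mul (fun θ : Metric.sphere (0 : E) 1 => f θ)
        (fun r : Set.Ioi (0 : ℝ) => (r : ℝ) ^ d * g r)]
      congr 1
      simp only [Measure.volumeIoiPow, ENNReal.ofReal]
      rw [integral_withDensity_eq_integral_smul
          (measurable_subtype_coe.pow_const _).real_toNNReal,
        integral_subtype_comap measurableSet_Ioi
          fun a ↦ Real.toNNReal (a ^ (Module.finrank ℝ E - 1)) • (a ^ d * g a),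
        setIntegral_congr_fun measurableSet_Ioi fun x hx ↦ ?_]
      have hx : 0 < x := hx
      have h1 : 1 ≤ Module.finrank ℝ E := Module.finrank_pos
      rw [NNReal.smul_def, Real.coe_toNNReal _ (pow_nonneg hx.le _), smul_eq_mul, ← mul_assoc,
        Real.rpow_add hx, ← Real.rpow_natCast, Nat.cast_sub h1, Nat.cast_one]

theorem PosHomogeneous.mul_norm_sq {E : Type*} [NormedAddCommGroup E] [NormedSpace ℝ E]
    {f : E → ℝ} {d : ℝ} (hf : PosHomogeneous d f) :
    PosHomogeneous (d + 2) fun y => f y * ‖y‖ ^ 2 := by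
  intro r hr y
  simp only [hf r hr, norm_smul, Real.norm_of_nonneg hr.le, Real.rpow_add hr, mul_pow,
    Real.rpow_two]
  ring

theorem setOf_norm_sq_lt {E : Type*} [SeminormedAddGroup E] (c : ℝ) :
    {y : E | ‖y‖ ^ 2 < c} = Metric.ball 0 (Real.sqrt c) := by
  ext y
  rw [mem_ball_zero_iff, Real.lt_sqrt (norm_nonneg _)]
  rfl

open scoped Pointwise in
theorem setOf_norm_sq_lt_eq_smul {E : Type*} [NormedAddCommGroup E] [NormedSpace ℝ E] {c : ℝ}
    (hc : 0 < c) :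
    {y : E | ‖y‖ ^ 2 < c} = Real.sqrt c • Metric.ball (0 : E) 1 := by
  rw [setOf_norm_sq_lt, smul_unitBall_of_pos (Real.sqrt_pos.2 hc)]

theorem PosHomogeneous.setIntegral_norm_sq_lt (μ : Measure E) [μ.IsAddHaarMeasure]
    {f : E → ℝ} {d : ℝ} (hf : PosHomogeneous d f) {c : ℝ} (hc : 0 < c) :
    ∫ y in {y : E | ‖y‖ ^ 2 < c}, f y ∂μ =
      c ^ (((Module.finrank ℝ E : ℝ) + d) / 2) * ∫ y in Metric.ball 0 1, f y ∂μ := by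
  have hR := Real.sqrt_pos.2 hc
  have h := Measure.setIntegral_comp_smul_of_pos μ f (Metric.ball 0 1) hR
  rw [← setOf_norm_sq_lt_eq_smul hc] at h
  simp only [hf _ hR] at h
  rw [integral_const_mul, smul_eq_mul, eq_inv_mul_iff_mul_eq₀ (pow_pos hR _).ne'] at h
  rw [← h, ← mul_assoc]
  congr 1
  rw [← Real.rpow_natCast, ← Real.rpow_add hR, Real.sqrt_eq_rpow, ← Real.rpow_mul hc.le]
  congr 1
  ring

theorem PosHomogeneous.integrableOn_norm_sq_lt (μ : Measure E) [μ.IsAddHaarMeasure]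
    {f : E → ℝ} {d : ℝ} (hf : PosHomogeneous d f) (hfi : IntegrableOn f (Metric.ball 0 1) μ)
    {c : ℝ} (hc : 0 < c) : IntegrableOn f {y : E | ‖y‖ ^ 2 < c} μ := by
  have hR := Real.sqrt_pos.2 hc
  have hm : MeasurableSet {y : E | ‖y‖ ^ 2 < c} :=
    (isOpen_lt (by fun_prop) continuous_const).measurableSet
  rw [← integrable_indicator_iff hm, ← integrable_comp_smul_iff μ _ hR.ne']
  rw [← integrable_indicator_iff measurableSet_ball] at hfi
  refine (hfi.const_mul (Real.sqrt c ^ d)).congr (ae_of_all _ fun y => ?_)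
  have : Real.sqrt c • y ∈ {y : E | ‖y‖ ^ 2 < c} ↔ y ∈ Metric.ball (0 : E) 1 := by
    rw [setOf_norm_sq_lt_eq_smul hc, Set.smul_mem_smul_set_iff₀ hR.ne']
  by_cases hy : y ∈ Metric.ball (0 : E) 1
  · simp only [Set.indicator_of_mem hy, Set.indicator_of_mem (this.2 hy), hf _ hR]
  · simp only [Set.indicator_of_notMem hy, Set.indicator_of_notMem (mt this.1 hy), mul_zero]

end Polar

section Domain

variable {n : ℕ} {α : ℝ} {f : EuclideanSpace ℝ (Fin n) → ℝ} {d : ℝ} {w : ℝ → ℝ}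

theorem indicator_heatDomain_eq (hα : 0 < α) (q : EuclideanSpace ℝ (Fin n) × ℝ) :
    (heatDomain n α).indicator (fun q => f q.1 * w q.2) q =
      (Set.Ioo 0 (1 / (4 * Real.pi))).indicator w q.2 *
        {y : EuclideanSpace ℝ (Fin n) | ‖y‖ ^ 2 < α * heatProfile q.2}.indicator f q.1 := by
  by_cases hq : q ∈ heatDomain n α
  · rw [Set.indicator_of_mem hq, Set.indicator_of_mem (snd_mem_Ioo_of_mem_heatDomain hα hq),
      Set.indicator_of_mem (show q.1 ∈ {y : EuclideanSpace ℝ (Fin n) |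
        ‖y‖ ^ 2 < α * heatProfile q.2} from hq.2), mul_comm]
  · rw [Set.indicator_of_notMem hq]
    by_cases hs : q.2 ∈ Set.Ioo 0 (1 / (4 * Real.pi))
    · rw [Set.indicator_of_notMem (s := {y | _}) (a := q.1), mul_zero]
      exact fun h => hq ⟨hs.1, h⟩
    · rw [Set.indicator_of_notMem hs, zero_mul]

theorem measurableSet_norm_sq_lt (c : ℝ) :
    MeasurableSet {y : EuclideanSpace ℝ (Fin n) | ‖y‖ ^ 2 < c} :=
  (isOpen_lt (by fun_prop) continuous_const).measurableSet

theorem integral_slice (hα : 0 < α) (hf : PosHomogeneous d f) (s : ℝ) :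
    ∫ y, (Set.Ioo 0 (1 / (4 * Real.pi))).indicator w s *
        {y : EuclideanSpace ℝ (Fin n) | ‖y‖ ^ 2 < α * heatProfile s}.indicator f y =
      (Set.Ioo 0 (1 / (4 * Real.pi))).indicator
        (fun s => (α * heatProfile s) ^ (((n : ℝ) + d) / 2) * w s) s *
        ∫ y in Metric.ball 0 1, f y := by
  by_cases hs : s ∈ Set.Ioo 0 (1 / (4 * Real.pi))
  · simp only [Set.indicator_of_mem hs]
    rw [integral_const_mul, integral_indicator (measurableSet_norm_sq_lt _),
      hf.setIntegral_norm_sq_lt _ (mul_pos hα (heatProfile_pos hs)), finrank_euclideanSpace_fin]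
    ring
  · simp only [Set.indicator_of_notMem hs, zero_mul, integral_zero]

/-- Integrability over the heat ball of a homogeneous function of space times a function of time
reduces to integrability over the unit ball and over the time interval. -/
theorem PosHomogeneous.integrableOn_heatDomain (hα : 0 < α) (hf : PosHomogeneous d f)
    (hfm : Measurable f) (hwm : Measurable w) (hfi : IntegrableOn f (Metric.ball 0 1))
    (hw : IntegrableOn (fun s => (α * heatProfile s) ^ (((n : ℝ) + d) / 2) * w s)
      (Set.Ioo 0 (1 / (4 * Real.pi)))) :
    IntegrableOn (fun q : EuclideanSpace ℝ (Fin n) × ℝ => f q.1 * w q.2) (heatDomain n α) := by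
  have hm : Measurable fun q : EuclideanSpace ℝ (Fin n) × ℝ => f q.1 * w q.2 :=
    (hfm.comp measurable_fst).mul (hwm.comp measurable_snd)
  rw [← integrable_indicator_iff measurableSet_heatDomain, Measure.volume_eq_prod,
    integrable_prod_iff' (hm.indicator measurableSet_heatDomain).aestronglyMeasurable]
  simp only [indicator_heatDomain_eq hα]
  constructor
  · refine ae_of_all _ fun s => ?_
    by_cases hs : s ∈ Set.Ioo 0 (1 / (4 * Real.pi))
    · refine Integrable.const_mul ?_ _
      rw [integrable_indicator_iff (measurableSet_norm_sq_lt _)]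
      exact hf.integrableOn_norm_sq_lt _ hfi (mul_pos hα (heatProfile_pos hs))
    · simp only [Set.indicator_of_notMem hs, zero_mul]
      exact integrable_zero _ _ _
  · have hf' : PosHomogeneous d fun y => ‖f y‖ := by
      intro r hr y
      simp only [hf r hr, norm_mul, Real.norm_of_nonneg (Real.rpow_nonneg hr.le _)]
    have h := integral_slice (w := fun s => ‖w s‖) hα hf'
    simp only [norm_mul, norm_indicator_eq_indicator_norm]
    simp only [h]
    refine Integrable.mul_const ?_ _
    rw [integrable_indicator_iff measurableSet_Ioo]
    refine IntegrableOn.congr_fun hw.norm (fun s hs => ?_) measurableSet_Ioo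
    have := mul_pos hα (heatProfile_pos hs)
    simp only [norm_mul]
    rw [Real.norm_of_nonneg (Real.rpow_nonneg this.le _)]

theorem PosHomogeneous.setIntegral_heatDomain (hα : 0 < α) (hf : PosHomogeneous d f)
    (hi : IntegrableOn (fun q : EuclideanSpace ℝ (Fin n) × ℝ => f q.1 * w q.2)
      (heatDomain n α)) :
    ∫ q in heatDomain n α, f q.1 * w q.2 =
      (∫ s in Set.Ioo 0 (1 / (4 * Real.pi)),
        (α * heatProfile s) ^ (((n : ℝ) + d) / 2) * w s) * ∫ y in Metric.ball 0 1, f y := by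
  rw [← integrable_indicator_iff measurableSet_heatDomain, Measure.volume_eq_prod] at hi
  rw [← integral_indicator measurableSet_heatDomain, Measure.volume_eq_prod,
    integral_prod_symm _ hi]
  simp only [indicator_heatDomain_eq hα, integral_slice hα hf]
  rw [integral_mul_const, integral_indicator measurableSet_Ioo]

end Domain

/-! ### Moments of the heat ball -/

section Gaussian

theorem integral_abs_rpow_mul_exp_neg_sq {r : ℝ} (hr : -1 < r) :
    ∫ x : ℝ, |x| ^ r * Real.exp (-x ^ 2) = Real.Gamma ((r + 1) / 2) := by
  have h := integral_comp_abs (f := fun x : ℝ => x ^ r * Real.exp (-x ^ (2 : ℝ)))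
  rw [integral_rpow_mul_exp_neg_rpow two_pos hr] at h
  simp only [Real.rpow_two, sq_abs] at h
  rw [h]
  ring

theorem integrable_abs_rpow_mul_exp_neg_sq {r : ℝ} (hr : -1 < r) :
    Integrable fun x : ℝ => |x| ^ r * Real.exp (-x ^ 2) := by
  by_contra h
  have h0 := integral_abs_rpow_mul_exp_neg_sq hr
  rw [integral_undef h] at h0
  exact absurd (Real.Gamma_pos_of_pos (by linarith : 0 < (r + 1) / 2)) (by rw [← h0]; simp)

theorem integral_eq_zero_of_neg_eq_neg {g : ℝ → ℝ} (hg : ∀ x, g (-x) = -g x) : ∫ x, g x = 0 := by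
  have h := integral_neg_eq_self g volume
  simp only [hg, integral_neg] at h
  linarith

variable {n : ℕ}

/-- The exponent of `|y l|` in the weight `|y 0| ^ (p - 2)`. -/
noncomputable def weightExponent (n : ℕ) (p : ℝ) (l : Fin (n + 1)) : ℝ :=
  if l = 0 then p - 2 else 0

theorem neg_one_lt_weightExponent {p : ℝ} (hp : 1 < p) (l : Fin (n + 1)) :
    -1 < weightExponent n p l := by
  unfold weightExponent
  split_ifs <;> linarith

theorem integral_euclidean_prod (g : Fin n → ℝ → ℝ) :
    ∫ y : EuclideanSpace ℝ (Fin n), ∏ l, g l (y l) = ∏ l, ∫ x, g l x := by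
  rw [← integral_fintype_prod_volume_eq_prod, ← (PiLp.volume_preserving_toLp (Fin n)).integral_comp
    (MeasurableEquiv.toLp 2 (Fin n → ℝ)).measurableEmbedding]

theorem integrable_euclidean_prod {g : Fin n → ℝ → ℝ} (hg : ∀ l, Integrable (g l)) :
    Integrable fun y : EuclideanSpace ℝ (Fin n) => ∏ l, g l (y l) := by
  rw [← (PiLp.volume_preserving_toLp (Fin n)).integrable_comp_emb
    (MeasurableEquiv.toLp 2 (Fin n → ℝ)).measurableEmbedding]
  exact Integrable.fintype_prod hg

theorem exp_neg_norm_sq_eq_prod (y : EuclideanSpace ℝ (Fin n)) :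
    Real.exp (-‖y‖ ^ 2) = ∏ l, Real.exp (-y l ^ 2) := by
  rw [← Real.exp_sum, EuclideanSpace.norm_sq_eq, Finset.sum_neg_distrib]
  simp

theorem abs_rpow_mul_exp_eq_prod (p : ℝ) (y : EuclideanSpace ℝ (Fin (n + 1))) :
    |y 0| ^ (p - 2) * Real.exp (-‖y‖ ^ 2) =
      ∏ l, (|y l| ^ weightExponent n p l * Real.exp (-y l ^ 2)) := by
  rw [Finset.prod_mul_distrib, ← exp_neg_norm_sq_eq_prod]
  congr 1
  rw [Finset.prod_eq_single 0 (fun l _ hl => by simp [weightExponent, hl]) (by simp)]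
  simp [weightExponent]

theorem integral_gaussian_weight {p : ℝ} (hp : 1 < p) :
    ∫ y : EuclideanSpace ℝ (Fin (n + 1)), |y 0| ^ (p - 2) * Real.exp (-‖y‖ ^ 2) =
      ∏ l, Real.Gamma ((weightExponent n p l + 1) / 2) := by
  simp only [abs_rpow_mul_exp_eq_prod]
  rw [integral_euclidean_prod fun l x => |x| ^ weightExponent n p l * Real.exp (-x ^ 2)]
  exact Finset.prod_congr rfl fun l _ =>
    integral_abs_rpow_mul_exp_neg_sq (neg_one_lt_weightExponent hp l)

theorem integrable_gaussian_weight {p : ℝ} (hp : 1 < p) :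
    Integrable fun y : EuclideanSpace ℝ (Fin (n + 1)) =>
      |y 0| ^ (p - 2) * Real.exp (-‖y‖ ^ 2) := by
  simp only [abs_rpow_mul_exp_eq_prod]
  exact integrable_euclidean_prod fun l =>
    integrable_abs_rpow_mul_exp_neg_sq (neg_one_lt_weightExponent hp l)

theorem integral_gaussian_weight_pos {p : ℝ} (hp : 1 < p) :
    0 < ∫ y : EuclideanSpace ℝ (Fin (n + 1)), |y 0| ^ (p - 2) * Real.exp (-‖y‖ ^ 2) := by
  rw [integral_gaussian_weight hp]
  exact Finset.prod_pos fun l _ => Real.Gamma_pos_of_pos (by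
    have := neg_one_lt_weightExponent hp l
    linarith)

theorem gaussian_moment_prod (p : ℝ) (i j : Fin (n + 1)) (y : EuclideanSpace ℝ (Fin (n + 1))) :
    |y 0| ^ (p - 2) * (y i * y j) * Real.exp (-‖y‖ ^ 2) =
      ∏ l, (|y l| ^ weightExponent n p l * Real.exp (-y l ^ 2) *
        ((if l = i then y l else 1) * if l = j then y l else 1)) := by
  rw [Finset.prod_mul_distrib, ← abs_rpow_mul_exp_eq_prod, Finset.prod_mul_distrib,
    Finset.prod_ite_eq', Finset.prod_ite_eq']
  simp only [Finset.mem_univ, if_true]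
  ring

/-- The second moments of the Gaussian with weight `|y 0| ^ (p - 2)`. -/
theorem integral_gaussian_moment {p : ℝ} (hp : 1 < p) (i j : Fin (n + 1)) :
    ∫ y : EuclideanSpace ℝ (Fin (n + 1)), |y 0| ^ (p - 2) * (y i * y j) * Real.exp (-‖y‖ ^ 2) =
      (if i = j then (weightExponent n p i + 1) / 2 else 0) *
        ∫ y : EuclideanSpace ℝ (Fin (n + 1)), |y 0| ^ (p - 2) * Real.exp (-‖y‖ ^ 2) := by
  simp only [gaussian_moment_prod]
  rw [integral_euclidean_prod fun l x => |x| ^ weightExponent n p l * Real.exp (-x ^ 2) *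
        ((if l = i then x else 1) * if l = j then x else 1)]
  split_ifs with hij
  · subst hij
    rw [integral_gaussian_weight hp]
    have : ∀ l, ∫ x : ℝ, |x| ^ weightExponent n p l * Real.exp (-x ^ 2) *
        ((if l = i then x else 1) * if l = i then x else 1) =
        (if l = i then (weightExponent n p l + 1) / 2 else 1) *
          Real.Gamma ((weightExponent n p l + 1) / 2) := by
      intro l
      have hl := neg_one_lt_weightExponent hp l
      split_ifs with h
      · have h2 : ∀ x : ℝ, |x| ^ weightExponent n p l * Real.exp (-x ^ 2) * (x * x) =
            |x| ^ (weightExponent n p l + 2) * Real.exp (-x ^ 2) := by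
          intro x
          rw [Real.rpow_add' (abs_nonneg x) (by linarith), Real.rpow_two, sq_abs]
          ring
        simp only [h2]
        rw [integral_abs_rpow_mul_exp_neg_sq (by linarith), ← Real.Gamma_add_one (by linarith)]
        congr 1
        ring
      · simp only [mul_one, one_mul]
        exact integral_abs_rpow_mul_exp_neg_sq hl
    rw [Finset.prod_congr rfl fun l _ => this l, Finset.prod_mul_distrib, Finset.prod_ite_eq']
    simp
  · rw [zero_mul]
    refine Finset.prod_eq_zero (Finset.mem_univ i) (integral_eq_zero_of_neg_eq_neg fun x => ?_)
    simp [hij]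

end Gaussian

section Ball

variable {n : ℕ} {p : ℝ}

theorem posHomogeneous_weight (p : ℝ) :
    PosHomogeneous (p - 2) fun y : EuclideanSpace ℝ (Fin (n + 1)) => |y 0| ^ (p - 2) := by
  intro r hr y
  simp only [PiLp.smul_apply, smul_eq_mul, abs_mul, abs_of_pos hr]
  rw [Real.mul_rpow hr.le (abs_nonneg _)]

theorem posHomogeneous_weight_mul (p : ℝ) (i j : Fin (n + 1)) :
    PosHomogeneous p fun y : EuclideanSpace ℝ (Fin (n + 1)) => |y 0| ^ (p - 2) * (y i * y j) := by
  intro r hr y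
  have h : r ^ p = r ^ (p - 2) * r ^ 2 := by
    rw [← Real.rpow_two, ← Real.rpow_add hr]; ring_nf
  simp only [PiLp.smul_apply, smul_eq_mul, abs_mul, abs_of_pos hr]
  rw [Real.mul_rpow hr.le (abs_nonneg _), h]
  ring

/-- Averages of a homogeneous function over the unit ball and against a Gaussian agree up to a
constant that depends on the degree only. -/
theorem PosHomogeneous.ball_integral_eq {f : EuclideanSpace ℝ (Fin (n + 1)) → ℝ} {d : ℝ}
    (hf : PosHomogeneous d f) (hd : 0 < (n : ℝ) + 1 + d) :
    (∫ y in Metric.ball 0 1, f y * ‖y‖ ^ 2) * (n + 3 + d) *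
      Real.Gamma (((n : ℝ) + 1 + d) / 2) = 2 * ∫ y, f y * Real.exp (-‖y‖ ^ 2) := by
  have h1 := hf.integral_mul_norm volume fun r => if r < 1 then r ^ 2 else 0
  have h2 := hf.integral_mul_norm volume fun r => Real.exp (-r ^ 2)
  have hb : ∫ y in Metric.ball 0 1, f y * ‖y‖ ^ 2 =
      ∫ y, f y * (if ‖y‖ < 1 then ‖y‖ ^ 2 else 0) := by
    rw [← integral_indicator measurableSet_ball]
    refine integral_congr_ae (ae_of_all _ fun y => ?_)
    by_cases hy : ‖y‖ < 1 <;> simp [hy]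
  have hr : ∫ r in Set.Ioi (0 : ℝ), r ^ ((n : ℝ) + d) * (if r < 1 then r ^ 2 else 0) =
      1 / (n + 3 + d) := by
    have : ∀ r ∈ Set.Ioi (0 : ℝ), r ^ ((n : ℝ) + d) * (if r < 1 then r ^ 2 else 0) =
        (Set.Iio 1).indicator (fun r => r ^ ((n : ℝ) + d + 2)) r := by
      intro r hr
      have hr : 0 < r := hr
      simp only [Set.indicator_apply, Set.mem_Iio]
      split_ifs
      · rw [Real.rpow_add hr _ 2, Real.rpow_two]
      · simp
    rw [setIntegral_congr_fun measurableSet_Ioi this, setIntegral_indicator measurableSet_Iio,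
      Set.Ioi_inter_Iio, ← integral_Ioc_eq_integral_Ioo,
      ← intervalIntegral.integral_of_le zero_le_one, integral_rpow (Or.inl (by linarith))]
    rw [Real.one_rpow, Real.zero_rpow (by linarith)]
    ring_nf
  have hg : ∫ r in Set.Ioi (0 : ℝ), r ^ ((n : ℝ) + d) * Real.exp (-r ^ 2) =
      1 / 2 * Real.Gamma (((n : ℝ) + 1 + d) / 2) := by
    have := integral_rpow_mul_exp_neg_rpow (p := 2) (q := n + d) two_pos (by linarith)
    simp only [Real.rpow_two] at this
    rw [this]
    ring_nf
  rw [finrank_euclideanSpace_fin, Nat.cast_add, Nat.cast_one, add_sub_cancel_right] at h1 h2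
  rw [hb, h1, h2, hr, hg]
  have : (n : ℝ) + 3 + d ≠ 0 := by linarith
  field_simp

theorem measurable_weight (p : ℝ) :
    Measurable fun y : EuclideanSpace ℝ (Fin (n + 1)) => |y 0| ^ (p - 2) := by
  have : Measurable fun y : EuclideanSpace ℝ (Fin (n + 1)) => y 0 := by fun_prop
  exact this.abs.pow_const _

theorem integrableOn_ball_weight (hp : 1 < p) :
    IntegrableOn (fun y : EuclideanSpace ℝ (Fin (n + 1)) => |y 0| ^ (p - 2)) (Metric.ball 0 1) := by
  refine Integrable.mono' ((integrable_gaussian_weight hp).integrableOn.const_mul (Real.exp 1))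
    (measurable_weight p).aestronglyMeasurable ?_
  refine (ae_restrict_iff' measurableSet_ball).2 (ae_of_all _ fun y hy => ?_)
  rw [mem_ball_zero_iff] at hy
  have h0 : 0 ≤ |y 0| ^ (p - 2) := Real.rpow_nonneg (abs_nonneg _) _
  rw [Real.norm_of_nonneg h0, mul_left_comm, ← Real.exp_add]
  refine le_mul_of_one_le_right h0 (Real.one_le_exp ?_)
  nlinarith [norm_nonneg y]

theorem abs_coord_le_norm (y : EuclideanSpace ℝ (Fin n)) (i : Fin n) : |y i| ≤ ‖y‖ :=
  PiLp.norm_apply_le y i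

theorem integrableOn_ball_weight_mul (hp : 1 < p) {g : EuclideanSpace ℝ (Fin (n + 1)) → ℝ}
    (hg : Measurable g) (hb : ∀ y, ‖y‖ < 1 → |g y| ≤ 1) :
    IntegrableOn (fun y : EuclideanSpace ℝ (Fin (n + 1)) => |y 0| ^ (p - 2) * g y)
      (Metric.ball 0 1) := by
  refine Integrable.mono (integrableOn_ball_weight hp)
    ((measurable_weight p).mul hg).aestronglyMeasurable ?_
  refine (ae_restrict_iff' measurableSet_ball).2 (ae_of_all _ fun y hy => ?_)
  rw [norm_mul]
  exact mul_le_of_le_one_right (norm_nonneg _) (hb y (mem_ball_zero_iff.1 hy))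

theorem integral_ball_weight_pos (hp : 1 < p) :
    0 < ∫ y : EuclideanSpace ℝ (Fin (n + 1)) in Metric.ball 0 1, |y 0| ^ (p - 2) * ‖y‖ ^ 2 := by
  have hn : (0 : ℝ) ≤ n := n.cast_nonneg
  have h := (posHomogeneous_weight (n := n) p).ball_integral_eq (by linarith)
  have h1 := integral_gaussian_weight_pos (n := n) hp
  have h2 := Real.Gamma_pos_of_pos (by linarith : 0 < ((n : ℝ) + 1 + (p - 2)) / 2)
  have h3 : 0 < (n : ℝ) + 3 + (p - 2) := by linarith
  rw [mul_assoc] at h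
  refine pos_of_mul_pos_left
    (b := ((n : ℝ) + 3 + (p - 2)) * Real.Gamma (((n : ℝ) + 1 + (p - 2)) / 2)) ?_ (by positivity)
  rw [h]
  positivity

/-- The weighted second moments of the unit ball. Comparing degrees `p - 2` and `p` in
`PosHomogeneous.ball_integral_eq` reduces them to the Gaussian ones, which factor. -/
theorem integral_ball_moment (hp : 1 < p) (i j : Fin (n + 1)) :
    ∫ y : EuclideanSpace ℝ (Fin (n + 1)) in Metric.ball 0 1,
        |y 0| ^ (p - 2) * (y i * y j) * ‖y‖ ^ 2 =
      (if i = j then weightExponent n p i + 1 else 0) / (n + p - 1) *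
        ((n + 1 + p) / (n + 3 + p)) *
        ∫ y : EuclideanSpace ℝ (Fin (n + 1)) in Metric.ball 0 1, |y 0| ^ (p - 2) * ‖y‖ ^ 2 := by
  have hn : (0 : ℝ) ≤ n := n.cast_nonneg
  have h0 := (posHomogeneous_weight (n := n) p).ball_integral_eq (by linarith)
  have h1 := (posHomogeneous_weight_mul (n := n) p i j).ball_integral_eq (by linarith)
  rw [integral_gaussian_moment hp i j] at h1
  have hG : Real.Gamma (((n : ℝ) + 1 + p) / 2) =
      ((n : ℝ) + 1 + (p - 2)) / 2 * Real.Gamma (((n : ℝ) + 1 + (p - 2)) / 2) := by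
    rw [← Real.Gamma_add_one (by linarith)]
    congr 1
    ring
  have h2 := Real.Gamma_pos_of_pos (by linarith : 0 < ((n : ℝ) + 1 + (p - 2)) / 2)
  rw [hG] at h1
  have h3 : (n : ℝ) + 3 + p ≠ 0 := by linarith
  have h4 : (n : ℝ) + p - 1 ≠ 0 := by linarith
  have h5 : (if i = j then (weightExponent n p i + 1) / 2 else 0) =
      (if i = j then weightExponent n p i + 1 else 0) / 2 := by split_ifs <;> simp
  rw [h5] at h1
  set c := if i = j then weightExponent n p i + 1 else 0
  set G := Real.Gamma (((n : ℝ) + 1 + (p - 2)) / 2)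
  rw [div_mul_div_comm, div_mul_eq_mul_div, eq_div_iff (mul_ne_zero h4 h3)]
  refine mul_right_cancel₀ h2.ne' ?_
  linear_combination 2 * h1 - c * h0

end Ball

section Time

theorem hasDerivAt_exp_neg_div (x : ℝ) :
    HasDerivAt (fun τ : ℝ => Real.exp (-τ) / (4 * Real.pi))
      (-(Real.exp (-x) / (4 * Real.pi))) x := by
  have := ((hasDerivAt_neg x).exp).div_const (4 * Real.pi)
  rwa [mul_neg_one, neg_div] at this

theorem image_exp_neg_div :
    (fun τ : ℝ => Real.exp (-τ) / (4 * Real.pi)) '' Set.Ioi 0 =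
      Set.Ioo 0 (1 / (4 * Real.pi)) := by
  have hpi := Real.pi_pos
  ext s
  constructor
  · rintro ⟨τ, hτ, rfl⟩
    have hτ : 0 < τ := hτ
    have : Real.exp (-τ) < 1 := by rw [Real.exp_lt_one_iff]; linarith
    exact ⟨by positivity, (div_lt_div_iff_of_pos_right (by positivity)).2 this⟩
  · rintro ⟨h0, h1⟩
    rw [lt_div_iff₀ (by positivity)] at h1
    refine ⟨-Real.log (s * (4 * Real.pi)), neg_pos.2 (Real.log_neg (by positivity) h1), ?_⟩
    simp only [neg_neg]
    rw [Real.exp_log (by positivity)]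
    field_simp

theorem injOn_exp_neg_div : Set.InjOn (fun τ : ℝ => Real.exp (-τ) / (4 * Real.pi)) (Set.Ioi 0) := by
  intro a _ b _ hab
  have hpi := Real.pi_pos
  simp only at hab
  rw [div_left_inj' (by positivity), Real.exp_eq_exp, neg_inj] at hab
  exact hab

variable {α β m : ℝ}

theorem time_integrand_subst (hα : 0 < α) {τ : ℝ} (hτ : 0 < τ) :
    |-(Real.exp (-τ) / (4 * Real.pi))| •
      ((α * heatProfile (Real.exp (-τ) / (4 * Real.pi))) ^ β *
        (Real.exp (-τ) / (4 * Real.pi)) ^ m) =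
    α ^ β * (4 * Real.pi) ^ (-(β + m + 1)) *
      (τ ^ β * Real.exp (-(β + m + 1) * τ ^ (1 : ℝ))) := by
  have hpi := Real.pi_pos
  have he := Real.exp_pos (-τ)
  have h1 : heatProfile (Real.exp (-τ) / (4 * Real.pi)) = Real.exp (-τ) / (4 * Real.pi) * τ := by
    rw [heatProfile_eq, mul_div_cancel₀ _ (by positivity), Real.log_exp, neg_neg]
  have h2 : (0 : ℝ) < 4 * Real.pi := by positivity
  have h3 : ∀ r : ℝ, (Real.exp (-τ) / (4 * Real.pi)) ^ r =
      Real.exp (-τ * r) * (4 * Real.pi) ^ (-r) := by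
    intro r
    rw [Real.div_rpow he.le h2.le, ← Real.exp_mul, Real.rpow_neg h2.le, div_eq_mul_inv]
  rw [h1, abs_neg, abs_of_pos (by positivity), smul_eq_mul, Real.rpow_one,
    Real.mul_rpow hα.le (by positivity), Real.mul_rpow (by positivity) hτ.le]
  have h4 : Real.exp (-τ) / (4 * Real.pi) = (Real.exp (-τ) / (4 * Real.pi)) ^ (1 : ℝ) :=
    (Real.rpow_one _).symm
  have h5 : (Real.exp (-τ) / (4 * Real.pi)) ^ (1 : ℝ) * (Real.exp (-τ) / (4 * Real.pi)) ^ β *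
      (Real.exp (-τ) / (4 * Real.pi)) ^ m = (4 * Real.pi) ^ (-(β + m + 1)) *
      Real.exp (-(β + m + 1) * τ) := by
    rw [← Real.rpow_add (by positivity), ← Real.rpow_add (by positivity), h3]
    ring_nf
  rw [Real.rpow_one] at h5
  linear_combination (α ^ β * τ ^ β) * h5

theorem integrableOn_heatProfile_rpow (hα : 0 < α) (hβ : -1 < β) (hm : 0 < β + m + 1) :
    IntegrableOn (fun s => (α * heatProfile s) ^ β * s ^ m) (Set.Ioo 0 (1 / (4 * Real.pi))) := by
  rw [← image_exp_neg_div, integrableOn_image_iff_integrableOn_abs_deriv_smul measurableSet_Ioi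
    (fun x _ => (hasDerivAt_exp_neg_div x).hasDerivWithinAt) injOn_exp_neg_div]
  refine IntegrableOn.congr_fun ?_ (fun τ hτ => (time_integrand_subst hα hτ).symm)
    measurableSet_Ioi
  exact (integrableOn_rpow_mul_exp_neg_mul_rpow hβ one_pos hm).const_mul _

/-- The substitution `s = e^{-τ} / (4π)` turns the time integrals into Gamma integrals. -/
theorem integral_heatProfile_rpow (hα : 0 < α) (hβ : -1 < β) (hm : 0 < β + m + 1) :
    ∫ s in Set.Ioo 0 (1 / (4 * Real.pi)), (α * heatProfile s) ^ β * s ^ m =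
      α ^ β * (4 * Real.pi) ^ (-(β + m + 1)) *
        ((β + m + 1) ^ (-(β + 1)) * Real.Gamma (β + 1)) := by
  rw [← image_exp_neg_div, integral_image_eq_integral_abs_deriv_smul measurableSet_Ioi
    (fun x _ => (hasDerivAt_exp_neg_div x).hasDerivWithinAt) injOn_exp_neg_div,
    setIntegral_congr_fun measurableSet_Ioi fun τ hτ => time_integrand_subst hα hτ,
    integral_const_mul, integral_rpow_mul_exp_neg_mul_rpow one_pos hβ hm]
  simp

end Time

section Moments

variable {n : ℕ} {α p : ℝ}

theorem integrable_heatDomainMeasure_iff {F : EuclideanSpace ℝ (Fin n) × ℝ → ℝ} :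
    Integrable F (heatDomainMeasure n α) ↔
      IntegrableOn (fun q => ‖q.1‖ ^ 2 / q.2 ^ 2 * F q) (heatDomain n α) := by
  rw [heatDomainMeasure, integrable_withDensity_iff_integrable_smul'
    measurable_heatDensity.ennreal_ofReal (ae_of_all _ fun _ => ENNReal.ofReal_lt_top)]
  refine integrable_congr (ae_of_all _ fun q => ?_)
  simp only [smul_eq_mul]
  rw [ENNReal.toReal_ofReal (by positivity)]

theorem integral_heatDomainMeasure (F : EuclideanSpace ℝ (Fin n) × ℝ → ℝ) :
    ∫ q, F q ∂heatDomainMeasure n α = ∫ q in heatDomain n α, ‖q.1‖ ^ 2 / q.2 ^ 2 * F q := by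
  rw [heatDomainMeasure, integral_withDensity_eq_integral_toReal_smul
    measurable_heatDensity.ennreal_ofReal (ae_of_all _ fun _ => ENNReal.ofReal_lt_top)]
  refine integral_congr_ae (ae_of_all _ fun q => ?_)
  simp only [smul_eq_mul]
  rw [ENNReal.toReal_ofReal (by positivity)]

theorem heatDensity_mul_eq {f : EuclideanSpace ℝ (Fin n) → ℝ} {q : EuclideanSpace ℝ (Fin n) × ℝ}
    (hq : 0 < q.2) (j : ℝ) :
    ‖q.1‖ ^ 2 / q.2 ^ 2 * (f q.1 * q.2 ^ j) = f q.1 * ‖q.1‖ ^ 2 * q.2 ^ (j - 2) := by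
  rw [Real.rpow_sub hq, Real.rpow_two]
  ring

theorem PosHomogeneous.integrable_heatDomainMeasure {f : EuclideanSpace ℝ (Fin n) → ℝ} {d j : ℝ}
    (hα : 0 < α) (hf : PosHomogeneous d f) (hfm : Measurable f)
    (hfi : IntegrableOn (fun y => f y * ‖y‖ ^ 2) (Metric.ball 0 1))
    (hd : 0 < (n : ℝ) + d + 4) (hj : 0 < ((n : ℝ) + d) / 2 + j) :
    Integrable (fun q => f q.1 * q.2 ^ j) (heatDomainMeasure n α) := by
  rw [integrable_heatDomainMeasure_iff]
  refine IntegrableOn.congr_fun ?_ (fun q hq => (heatDensity_mul_eq hq.1 j).symm)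
    measurableSet_heatDomain
  refine hf.mul_norm_sq.integrableOn_heatDomain hα (hfm.mul (by fun_prop))
    (measurable_id.pow_const _) hfi ?_
  exact integrableOn_heatProfile_rpow hα (by linarith) (by linarith)

/-- Moments of the heat ball: the time integral is a Gamma integral, and the space integral is one
over the unit ball. -/
theorem PosHomogeneous.integral_heatDomainMeasure {f : EuclideanSpace ℝ (Fin n) → ℝ} {d j : ℝ}
    (hα : 0 < α) (hf : PosHomogeneous d f) (hfm : Measurable f)
    (hfi : IntegrableOn (fun y => f y * ‖y‖ ^ 2) (Metric.ball 0 1))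
    (hd : 0 < (n : ℝ) + d + 4) (hj : 0 < ((n : ℝ) + d) / 2 + j) :
    ∫ q, f q.1 * q.2 ^ j ∂heatDomainMeasure n α =
      α ^ (((n : ℝ) + d) / 2 + 1) * (4 * Real.pi) ^ (-(((n : ℝ) + d) / 2 + j)) *
        ((((n : ℝ) + d) / 2 + j) ^ (-(((n : ℝ) + d) / 2 + 2)) *
          Real.Gamma (((n : ℝ) + d) / 2 + 2)) *
        ∫ y in Metric.ball 0 1, f y * ‖y‖ ^ 2 := by
  rw [_root_.integral_heatDomainMeasure,
    setIntegral_congr_fun measurableSet_heatDomain fun q hq => heatDensity_mul_eq hq.1 j,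
    hf.mul_norm_sq.setIntegral_heatDomain (w := fun s => s ^ (j - 2)) hα,
    integral_heatProfile_rpow hα (by linarith) (by linarith)]
  · ring_nf
  · refine hf.mul_norm_sq.integrableOn_heatDomain hα (hfm.mul (by fun_prop))
      (measurable_id.pow_const _) hfi ?_
    exact integrableOn_heatProfile_rpow hα (by linarith) (by linarith)

theorem integrable_weight (hα : 0 < α) (hp : 1 < p) (j : ℕ) :
    Integrable (fun q : EuclideanSpace ℝ (Fin (n + 1)) × ℝ => |q.1 0| ^ (p - 2) * q.2 ^ j)
      (heatDomainMeasure (n + 1) α) := by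
  have hn : (0 : ℝ) ≤ n := n.cast_nonneg
  have hj : (0 : ℝ) ≤ j := j.cast_nonneg
  have := (posHomogeneous_weight (n := n) p).integrable_heatDomainMeasure (j := j) hα
    (measurable_weight p)
    (integrableOn_ball_weight_mul hp (by fun_prop) fun y hy => by
      rw [abs_of_nonneg (by positivity)]; nlinarith [norm_nonneg y])
    (by push_cast; linarith) (by push_cast; linarith)
  simpa only [Real.rpow_natCast] using this

/-- The coefficient `(4π)⁻¹ (1 - 2 / (ν + p)) ^ ((ν + p) / 2 + 1)`: the mean of the time variable
over the heat ball of dimension `ν`, with weight `|y 0| ^ (p - 2)`. -/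
noncomputable def heatCoeff (ν p : ℝ) : ℝ :=
  1 / (4 * Real.pi) * (1 - 2 / (ν + p)) ^ ((ν + p) / 2 + 1)

/-- The quadratic form with coefficients `Q`. -/
def quadForm (Q : Fin n → Fin n → ℝ) (y : EuclideanSpace ℝ (Fin n)) : ℝ :=
  ∑ i, ∑ j, Q i j * (y i * y j)

theorem weight_moment_pos (hα : 0 < α) (hp : 1 < p) :
    0 < ∫ q : EuclideanSpace ℝ (Fin (n + 1)) × ℝ, |q.1 0| ^ (p - 2)
      ∂heatDomainMeasure (n + 1) α := by
  have hn : (0 : ℝ) ≤ n := n.cast_nonneg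
  have h := (posHomogeneous_weight (n := n) p).integral_heatDomainMeasure (j := 0) hα
    (measurable_weight p)
    (integrableOn_ball_weight_mul hp (by fun_prop) fun y hy => by
      rw [abs_of_nonneg (by positivity)]; nlinarith [norm_nonneg y])
    (by push_cast; linarith) (by push_cast; linarith)
  simp only [Real.rpow_zero, mul_one] at h
  rw [h]
  have h1 := integral_ball_weight_pos (n := n) hp
  have h2 : 0 < ((n + 1 : ℕ) + (p - 2)) / 2 + 0 := by push_cast; linarith
  have h3 := Real.Gamma_pos_of_pos (s := ((n + 1 : ℕ) + (p - 2)) / 2 + 2) (by linarith)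
  have := Real.pi_pos
  positivity

theorem integral_weight_mul_time (hα : 0 < α) (hp : 1 < p) :
    ∫ q : EuclideanSpace ℝ (Fin (n + 1)) × ℝ, |q.1 0| ^ (p - 2) * q.2
      ∂heatDomainMeasure (n + 1) α =
    heatCoeff (n + 1) p * ∫ q : EuclideanSpace ℝ (Fin (n + 1)) × ℝ, |q.1 0| ^ (p - 2)
      ∂heatDomainMeasure (n + 1) α := by
  have hn : (0 : ℝ) ≤ n := n.cast_nonneg
  have hpi := Real.pi_pos
  have hfi : IntegrableOn (fun y : EuclideanSpace ℝ (Fin (n + 1)) => |y 0| ^ (p - 2) * ‖y‖ ^ 2)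
      (Metric.ball 0 1) := integrableOn_ball_weight_mul hp (by fun_prop) fun y hy => by
    rw [abs_of_nonneg (by positivity)]; nlinarith [norm_nonneg y]
  have h0 := (posHomogeneous_weight (n := n) p).integral_heatDomainMeasure (j := 0) hα
    (measurable_weight p) hfi (by push_cast; linarith) (by push_cast; linarith)
  have h1 := (posHomogeneous_weight (n := n) p).integral_heatDomainMeasure (j := 1) hα
    (measurable_weight p) hfi (by push_cast; linarith) (by push_cast; linarith)
  simp only [Real.rpow_zero, Real.rpow_one, mul_one] at h0 h1
  obtain ⟨c, hc⟩ : ∃ c : ℝ, c = ((n + 1 : ℕ) + (p - 2)) / 2 := ⟨_, rfl⟩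
  have hc0 : 0 < c := by rw [hc]; push_cast; linarith
  rw [← hc] at h0 h1
  have hκ : heatCoeff (n + 1) p = 1 / (4 * Real.pi) * (c / (c + 1)) ^ (c + 2) := by
    have e : (n : ℝ) + 1 + p = 2 * (c + 1) := by rw [hc]; push_cast; ring
    rw [heatCoeff, e]
    congr 2
    · field_simp
      ring
    · ring
  rw [h0, h1, hκ, Real.div_rpow hc0.le (by linarith), add_zero, neg_add c 1,
    Real.rpow_add (x := 4 * Real.pi) (by positivity), Real.rpow_neg_one,
    Real.rpow_neg hc0.le (c + 2),
    Real.rpow_neg (by linarith) (c + 2)]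
  field_simp

theorem measurable_coord_mul (i j : Fin n) :
    Measurable fun y : EuclideanSpace ℝ (Fin n) => y i * y j := by fun_prop

theorem integrableOn_ball_weight_mul_coord (hp : 1 < p) (i j : Fin (n + 1)) :
    IntegrableOn (fun y : EuclideanSpace ℝ (Fin (n + 1)) =>
      |y 0| ^ (p - 2) * (y i * y j) * ‖y‖ ^ 2) (Metric.ball 0 1) := by
  simp only [mul_assoc]
  refine integrableOn_ball_weight_mul hp (by fun_prop) fun y hy => ?_
  rw [abs_mul, abs_mul, abs_of_nonneg (by positivity : 0 ≤ ‖y‖ ^ 2)]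
  have h1 := (abs_coord_le_norm y i).trans hy.le
  have h2 := (abs_coord_le_norm y j).trans hy.le
  have h3 : ‖y‖ ^ 2 ≤ 1 := by nlinarith [norm_nonneg y]
  exact mul_le_one₀ h1 (by positivity) (mul_le_one₀ h2 (by positivity) h3)

theorem integrable_weight_mul_coord (hα : 0 < α) (hp : 1 < p) (i j : Fin (n + 1)) :
    Integrable (fun q : EuclideanSpace ℝ (Fin (n + 1)) × ℝ =>
      |q.1 0| ^ (p - 2) * (q.1 i * q.1 j)) (heatDomainMeasure (n + 1) α) := by
  have hn : (0 : ℝ) ≤ n := n.cast_nonneg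
  have := (posHomogeneous_weight_mul (n := n) p i j).integrable_heatDomainMeasure (j := 0) hα
    ((measurable_weight p).mul (measurable_coord_mul i j))
    (integrableOn_ball_weight_mul_coord hp i j)
    (by push_cast; linarith) (by push_cast; linarith)
  simpa only [Real.rpow_zero, mul_one] using this

theorem integral_weight_mul_coord (hα : 0 < α) (hp : 1 < p) (i j : Fin (n + 1)) :
    ∫ q : EuclideanSpace ℝ (Fin (n + 1)) × ℝ, |q.1 0| ^ (p - 2) * (q.1 i * q.1 j)
      ∂heatDomainMeasure (n + 1) α =
    (if i = j then weightExponent n p i + 1 else 0) * (α / (n + p - 1)) * heatCoeff (n + 1) p *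
      ∫ q : EuclideanSpace ℝ (Fin (n + 1)) × ℝ, |q.1 0| ^ (p - 2)
        ∂heatDomainMeasure (n + 1) α := by
  have hn : (0 : ℝ) ≤ n := n.cast_nonneg
  have hpi := Real.pi_pos
  rw [mul_assoc, ← integral_weight_mul_time hα hp]
  have hfi : IntegrableOn (fun y : EuclideanSpace ℝ (Fin (n + 1)) => |y 0| ^ (p - 2) * ‖y‖ ^ 2)
      (Metric.ball 0 1) := integrableOn_ball_weight_mul hp (by fun_prop) fun y hy => by
    rw [abs_of_nonneg (by positivity)]; nlinarith [norm_nonneg y]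
  have h0 := (posHomogeneous_weight (n := n) p).integral_heatDomainMeasure (j := 1) hα
    (measurable_weight p) hfi (by push_cast; linarith) (by push_cast; linarith)
  have h1 := (posHomogeneous_weight_mul (n := n) p i j).integral_heatDomainMeasure (j := 0) hα
    ((measurable_weight p).mul (measurable_coord_mul i j))
    (integrableOn_ball_weight_mul_coord hp i j) (by push_cast; linarith) (by push_cast; linarith)
  simp only [Real.rpow_zero, Real.rpow_one, mul_one] at h0 h1
  rw [integral_ball_moment hp] at h1
  obtain ⟨c, hc⟩ : ∃ c : ℝ, c = ((n + 1 : ℕ) + p) / 2 := ⟨_, rfl⟩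
  have hc0 : 0 < c := by rw [hc]; push_cast; linarith
  have e : ((n + 1 : ℕ) + (p - 2)) / 2 = c - 1 := by rw [hc]; push_cast; ring
  have e1 : (n : ℝ) + 1 + p = 2 * c := by rw [hc]; push_cast; ring
  have e2 : (n : ℝ) + 3 + p = 2 * (c + 1) := by rw [hc]; push_cast; ring
  rw [e] at h0
  rw [← hc, e1, e2] at h1
  rw [h0, h1, show c - 1 + 2 = c + 1 by ring, show c - 1 + 1 = c by ring, add_zero,
    show c + 2 = c + 1 + 1 by ring, Real.Gamma_add_one (s := c + 1) (by positivity),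
    Real.rpow_add_one hα.ne' c, neg_add (c + 1) 1, Real.rpow_add hc0, Real.rpow_neg_one]
  have h3 : (n : ℝ) + p - 1 ≠ 0 := by linarith
  field_simp

/-- The weighted mean over the heat ball of the second-order part of a Taylor expansion. -/
theorem integral_weight_mul_taylor (hα : 0 < α) (hp : 1 < p) (Q : Fin (n + 1) → Fin (n + 1) → ℝ)
    (b k : ℝ) :
    ∫ q : EuclideanSpace ℝ (Fin (n + 1)) × ℝ,
      |q.1 0| ^ (p - 2) * (1 / 2 * quadForm Q q.1 + b * q.2 - k) ∂heatDomainMeasure (n + 1) α =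
    (∫ q : EuclideanSpace ℝ (Fin (n + 1)) × ℝ, |q.1 0| ^ (p - 2) ∂heatDomainMeasure (n + 1) α) *
      (heatCoeff (n + 1) p *
        (b + α / 2 / (n + p - 1) * (∑ i, Q i i + (p - 2) * Q 0 0)) - k) := by
  have hexp : ∀ q : EuclideanSpace ℝ (Fin (n + 1)) × ℝ,
      |q.1 0| ^ (p - 2) * (1 / 2 * quadForm Q q.1 + b * q.2 - k) =
      (1 / 2 * ∑ i, ∑ j, Q i j * (|q.1 0| ^ (p - 2) * (q.1 i * q.1 j))) +
      b * (|q.1 0| ^ (p - 2) * q.2) - k * |q.1 0| ^ (p - 2) := by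
    intro q
    have : ∑ i, ∑ j, Q i j * (|q.1 0| ^ (p - 2) * (q.1 i * q.1 j)) =
        |q.1 0| ^ (p - 2) * quadForm Q q.1 := by
      simp only [quadForm, Finset.mul_sum]
      exact Finset.sum_congr rfl fun i _ => Finset.sum_congr rfl fun j _ => by ring
    rw [this]
    ring
  have hi1 := fun i j => (integrable_weight_mul_coord (n := n) hα hp i j).const_mul (Q i j)
  have hi2 : Integrable (fun q : EuclideanSpace ℝ (Fin (n + 1)) × ℝ =>
      ∑ i, ∑ j, Q i j * (|q.1 0| ^ (p - 2) * (q.1 i * q.1 j))) (heatDomainMeasure (n + 1) α) :=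
    integrable_finsetSum _ fun i _ => integrable_finsetSum _ fun j _ => hi1 i j
  have hi3 := integrable_weight (n := n) hα hp 1
  have hi4 := integrable_weight (n := n) hα hp 0
  simp only [pow_one, pow_zero, mul_one] at hi3 hi4
  have hi5 : Integrable (fun q : EuclideanSpace ℝ (Fin (n + 1)) × ℝ =>
      1 / 2 * (∑ i, ∑ j, Q i j * (|q.1 0| ^ (p - 2) * (q.1 i * q.1 j))) +
      b * (|q.1 0| ^ (p - 2) * q.2)) (heatDomainMeasure (n + 1) α) :=
    (hi2.const_mul _).add (hi3.const_mul _)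
  simp only [hexp]
  rw [integral_sub hi5 (hi4.const_mul _),
    integral_add (hi2.const_mul _) (hi3.const_mul _), integral_const_mul, integral_const_mul,
    integral_const_mul, integral_finsetSum _ fun i _ => integrable_finsetSum _ fun j _ => hi1 i j]
  have hs : ∀ i, ∫ q : EuclideanSpace ℝ (Fin (n + 1)) × ℝ,
      ∑ j, Q i j * (|q.1 0| ^ (p - 2) * (q.1 i * q.1 j)) ∂heatDomainMeasure (n + 1) α =
      (Q i i + (if i = 0 then (p - 2) * Q i i else 0)) *
        ((α / (n + p - 1)) * heatCoeff (n + 1) p *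
        ∫ q : EuclideanSpace ℝ (Fin (n + 1)) × ℝ, |q.1 0| ^ (p - 2)
          ∂heatDomainMeasure (n + 1) α) := by
    intro i
    rw [integral_finsetSum _ fun j _ => hi1 i j]
    simp only [integral_const_mul, integral_weight_mul_coord hα hp]
    rw [Finset.sum_eq_single i]
    · rw [if_pos rfl, weightExponent]
      split_ifs <;> ring
    · intro j _ hj
      rw [if_neg hj.symm]
      ring
    · simp
  rw [Finset.sum_congr rfl fun i _ => hs i, ← Finset.sum_mul, Finset.sum_add_distrib,
    Finset.sum_ite_eq', if_pos (Finset.mem_univ _), integral_weight_mul_time hα hp]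
  ring

theorem isFiniteMeasure_heatDomainMeasure (hα : 0 < α) :
    IsFiniteMeasure (heatDomainMeasure (n + 1) α) := by
  have h := integrable_weight (n := n) hα one_lt_two 0
  simp only [sub_self, Real.rpow_zero, pow_zero, mul_one] at h
  exact (integrable_const_iff_isFiniteMeasure one_ne_zero).1 h

end Moments

/-! ### First-order asymptotics for `1 < p < ∞` -/

section SignedPow

/-- For `0 < q ≤ 1` the increments of `signedPow q` are bounded as the derivative at `a` suggests,
also across the singularity at `0`. -/
theorem abs_signedPow_add_sub_le {q : ℝ} (hq : 0 < q) (hq1 : q ≤ 1) {a : ℝ} (ha : a ≠ 0) (b : ℝ) :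
    |signedPow q (a + b) - signedPow q a| ≤ 2 * |b| * |a| ^ (q - 1) := by
  wlog hpos : 0 < a generalizing a b
  · have h := this (neg_ne_zero.2 ha) (-b) (neg_pos.2 (lt_of_le_of_ne (not_lt.1 hpos) ha))
    rw [← neg_add, signedPow_neg, signedPow_neg, abs_neg, abs_neg] at h
    rwa [neg_sub_neg, abs_sub_comm] at h
  have haq : 0 < a ^ q := Real.rpow_pos_of_pos hpos q
  rw [signedPow_of_pos hpos, abs_of_pos hpos, Real.rpow_sub_one hpos.ne']
  have hb : |b| * (a ^ q / a) = a ^ q * |b / a| := by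
    rw [abs_div, abs_of_pos hpos]; ring
  rw [mul_assoc, hb]
  have hfac : a + b = a * (1 + b / a) := by field_simp
  have hx := abs_nonneg (b / a)
  rcases lt_trichotomy (a + b) 0 with h | h | h
  · have h1 : 1 < -(b / a) := by
      rw [hfac] at h
      have := (pos_iff_neg_of_mul_neg h).1 hpos
      linarith
    have h2 : -(a + b) = a * (-(b / a) - 1) := by rw [hfac]; ring
    rw [signedPow_of_neg h, h2, Real.mul_rpow hpos.le (by linarith)]
    have h3 : (-(b / a) - 1) ^ q ≤ -(b / a) := by
      calc (-(b / a) - 1) ^ q ≤ (-(b / a)) ^ q :=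
            Real.rpow_le_rpow (by linarith) (by linarith) hq.le
        _ ≤ (-(b / a)) ^ (1 : ℝ) := Real.rpow_le_rpow_of_exponent_le h1.le hq1
        _ = _ := Real.rpow_one _
    have h4 : 0 ≤ (-(b / a) - 1) ^ q := Real.rpow_nonneg (by linarith) q
    rw [abs_of_nonpos (by nlinarith), abs_of_neg (by linarith)]
    nlinarith
  · rw [h, signedPow_zero_right, zero_sub, abs_neg, abs_of_pos haq]
    have : b / a = -1 := by rw [div_eq_iff hpos.ne']; linarith
    rw [this]
    norm_num
    linarith
  · have h1 : 0 < 1 + b / a := by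
      rw [hfac] at h
      exact (pos_iff_pos_of_mul_pos h).1 hpos
    rw [signedPow_of_pos h, hfac, Real.mul_rpow hpos.le h1.le]
    have h2 : |(1 + b / a) ^ q - 1| ≤ |b / a| := by
      rcases le_total 0 (b / a) with h3 | h3
      · rw [abs_of_nonneg h3, abs_of_nonneg (sub_nonneg.2 (Real.one_le_rpow (by linarith) hq.le))]
        have := Real.rpow_le_rpow_of_exponent_le (by linarith : 1 ≤ 1 + b / a) hq1
        rw [Real.rpow_one] at this
        linarith
      · rw [abs_of_nonpos h3, abs_of_nonpos
          (sub_nonpos.2 (Real.rpow_le_one h1.le (by linarith) hq.le))]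
        have := Real.rpow_le_rpow_of_exponent_ge h1 (by linarith) hq1
        rw [Real.rpow_one] at this
        linarith
    rw [show a ^ q * (1 + b / a) ^ q - a ^ q = a ^ q * ((1 + b / a) ^ q - 1) by ring, abs_mul,
      abs_of_pos haq]
    nlinarith

theorem abs_signedPow_sub_le {q : ℝ} (hq : 1 ≤ q) {K a b : ℝ} (ha : |a| ≤ K) (hb : |b| ≤ K) :
    |signedPow q a - signedPow q b| ≤ q * K ^ (q - 1) * |a - b| := by
  have hK : 0 ≤ K := (abs_nonneg a).trans ha
  wlog hab : b ≤ a generalizing a b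
  · rw [abs_sub_comm, abs_sub_comm a]
    exact this hb ha (le_of_not_ge hab)
  wlog ha0 : 0 ≤ a generalizing a b
  · have h := this (a := -b) (b := -a) (by rwa [abs_neg]) (by rwa [abs_neg]) (by linarith)
      (by linarith)
    rw [signedPow_neg, signedPow_neg] at h
    rwa [neg_sub_neg, neg_sub_neg] at h
  rw [abs_of_nonneg (sub_nonneg.2 (signedPow_monotone (by linarith) hab)),
    abs_of_nonneg (sub_nonneg.2 hab)]
  rw [abs_of_nonneg ha0] at ha
  have hpow : ∀ x, 0 ≤ x → x ≤ K → x ^ q ≤ K ^ (q - 1) * x := by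
    intro x hx hxK
    rw [show x ^ q = x ^ (q - 1) * x by
      rw [← Real.rpow_add_one' hx (by linarith), sub_add_cancel]]
    exact mul_le_mul_of_nonneg_right (Real.rpow_le_rpow hx hxK (by linarith)) hx
  have hKq : 0 ≤ K ^ (q - 1) := Real.rpow_nonneg hK _
  rcases le_or_gt 0 b with hb0 | hb0
  · have h1 := abs_rpow_sub_le_abs_sub_rpow hq a (a - b)
    rw [sub_sub_cancel, abs_of_nonneg ha0, abs_of_nonneg hb0] at h1
    have h2 : ∀ x, 0 ≤ x → signedPow q x = x ^ q := by
      intro x hx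
      rcases hx.eq_or_lt with rfl | hx
      · rw [signedPow_zero_right, Real.zero_rpow (by linarith)]
      · exact signedPow_of_pos hx
    rw [h2 a ha0, h2 b hb0]
    have h3 : signedPow (q - 1) a ≤ K ^ (q - 1) := (le_abs_self _).trans
      ((abs_signedPow_le _ _).trans (Real.rpow_le_rpow (abs_nonneg _)
        (by rwa [abs_of_nonneg ha0]) (by linarith)))
    have h4 : q * signedPow (q - 1) a * (a - b) ≤ q * K ^ (q - 1) * (a - b) := by gcongr
    linarith
  · rw [abs_of_neg hb0] at hb
    have h1 : signedPow q a ≤ K ^ (q - 1) * a := by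
      refine (le_abs_self _).trans ((abs_signedPow_le _ _).trans ?_)
      rw [abs_of_nonneg ha0]
      exact hpow a ha0 ha
    have h2 := hpow (-b) (by linarith) hb
    rw [signedPow_of_neg hb0]
    have h3 : K ^ (q - 1) * (a - b) ≤ q * (K ^ (q - 1) * (a - b)) :=
      le_mul_of_one_le_left (mul_nonneg hKq (by linarith)) hq
    linarith

theorem hasDerivAt_signedPow {a : ℝ} (ha : a ≠ 0) (q : ℝ) :
    HasDerivAt (signedPow q) (q * |a| ^ (q - 1)) a := by
  rcases lt_or_gt_of_ne ha with h | h
  · have h1 := ((hasDerivAt_neg a).rpow_const (p := q) (Or.inl (neg_ne_zero.2 ha))).neg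
    rw [abs_of_neg h]
    refine HasDerivAt.congr_of_eventuallyEq (f := fun x => -(-x) ^ q) ?_ ?_
    · rwa [neg_one_mul, neg_mul, neg_neg] at h1
    · filter_upwards [Iio_mem_nhds h] with x hx using signedPow_of_neg hx
  · have h1 := Real.hasDerivAt_rpow_const (x := a) (p := q) (Or.inl ha)
    rw [abs_of_pos h]
    refine HasDerivAt.congr_of_eventuallyEq (f := fun x => x ^ q) h1 ?_
    filter_upwards [Ioi_mem_nhds h] with x hx using signedPow_of_pos hx

end SignedPow

section Symmetry

variable {n : ℕ} {α : ℝ}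

/-- The measure on the heat ball is invariant under `y ↦ -y`. -/
theorem integral_heatDomainMeasure_eq_zero_of_odd {F : EuclideanSpace ℝ (Fin n) × ℝ → ℝ}
    (hF : ∀ q, F (-q.1, q.2) = -F q) : ∫ q, F q ∂heatDomainMeasure n α = 0 := by
  rw [integral_heatDomainMeasure, ← integral_indicator measurableSet_heatDomain]
  set G := (heatDomain n α).indicator fun q => ‖q.1‖ ^ 2 / q.2 ^ 2 * F q with hG
  have hmp : MeasurePreserving (fun q : EuclideanSpace ℝ (Fin n) × ℝ => (-q.1, q.2)) :=
    (Measure.measurePreserving_neg volume).prod (MeasurePreserving.id volume)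
  have h := hmp.integral_comp ((MeasurableEquiv.neg _).prodCongr
    (MeasurableEquiv.refl ℝ)).measurableEmbedding G
  have hodd : ∀ q, G (-q.1, q.2) = -G q := by
    intro q
    have hmem : ((-q.1, q.2) : EuclideanSpace ℝ (Fin n) × ℝ) ∈ heatDomain n α ↔
        q ∈ heatDomain n α := by simp [heatDomain]
    by_cases hq : q ∈ heatDomain n α
    · rw [hG, Set.indicator_of_mem hq, Set.indicator_of_mem (hmem.2 hq), hF]
      simp
    · rw [hG, Set.indicator_of_notMem hq, Set.indicator_of_notMem (mt hmem.1 hq), neg_zero]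
  simp only [hodd, integral_neg] at h
  linarith

theorem volume_setOf_coord_eq_zero :
    volume {y : EuclideanSpace ℝ (Fin (n + 1)) | y 0 = 0} = 0 := by
  have h := Measure.addHaar_submodule (volume : Measure (EuclideanSpace ℝ (Fin (n + 1))))
    (LinearMap.ker (EuclideanSpace.proj (𝕜 := ℝ) (0 : Fin (n + 1))).toLinearMap) ?_
  · convert h using 2
    ext y
    simp
  · intro h
    have : EuclideanSpace.single (0 : Fin (n + 1)) (1 : ℝ) ∈
        LinearMap.ker (EuclideanSpace.proj (𝕜 := ℝ) (0 : Fin (n + 1))).toLinearMap := by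
      rw [h]; trivial
    simp at this

theorem ae_coord_ne_zero : ∀ᵐ q ∂heatDomainMeasure (n + 1) α, q.1 0 ≠ 0 := by
  refine (heatDomainMeasure_absolutelyContinuous.trans
    Measure.absolutelyContinuous_restrict).ae_le ?_
  change volume {q : EuclideanSpace ℝ (Fin (n + 1)) × ℝ | q.1 0 ≠ 0}ᶜ = 0
  have : {q : EuclideanSpace ℝ (Fin (n + 1)) × ℝ | q.1 0 ≠ 0}ᶜ =
      {y : EuclideanSpace ℝ (Fin (n + 1)) | y 0 = 0} ×ˢ Set.univ := by
    ext q; simp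
  rw [this, Measure.volume_eq_prod, Measure.prod_prod, volume_setOf_coord_eq_zero, zero_mul]

end Symmetry

section Expansion

/-- The family `f ε` of functions on the heat ball has the first-order expansion
`lam * y 0 + ε * (⟨Q y, y⟩ / 2 + b * s) + o(ε)`, uniformly on the heat ball. -/
structure IsHeatExpansion (n : ℕ) (α lam : ℝ) (Q : Fin (n + 1) → Fin (n + 1) → ℝ) (b : ℝ)
    (f : ℝ → EuclideanSpace ℝ (Fin (n + 1)) × ℝ → ℝ) : Prop where
  continuousOn : ∀ᶠ ε in 𝓝[>] (0 : ℝ), ContinuousOn (f ε) (heatDomain (n + 1) α)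
  approx : ∀ η > 0, ∀ᶠ ε in 𝓝[>] (0 : ℝ), ∀ q ∈ heatDomain (n + 1) α,
    |f ε q - (lam * q.1 0 + ε * (1 / 2 * quadForm Q q.1 + b * q.2))| ≤ η * ε

variable {n : ℕ} {α lam b p : ℝ} {Q : Fin (n + 1) → Fin (n + 1) → ℝ}
  {f : ℝ → EuclideanSpace ℝ (Fin (n + 1)) × ℝ → ℝ}

theorem continuous_quadForm {n : ℕ} (Q : Fin n → Fin n → ℝ) : Continuous (quadForm Q) := by
  unfold quadForm
  fun_prop

theorem exists_bound_heatDomain {n : ℕ} {α : ℝ} (hα : 0 < α)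
    {g : EuclideanSpace ℝ (Fin n) × ℝ → ℝ} (hg : Continuous g) :
    ∃ M, 0 < M ∧ ∀ q ∈ heatDomain n α, |g q| ≤ M := by
  obtain ⟨R, hR⟩ := heatDomain_subset (n := n) hα
  obtain ⟨M, hM⟩ := ((isCompact_closedBall (0 : EuclideanSpace ℝ (Fin n)) R).prod
    (isCompact_Icc (a := (0 : ℝ)) (b := 1))).exists_bound_of_continuousOn hg.continuousOn
  exact ⟨max M 1, by positivity, fun q hq => (hM q (hR hq)).trans (le_max_left _ _)⟩

/-- The second-order part of the expansion, recovered from `f ε` and lowered by the constant `k`. -/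
noncomputable def secondOrder (lam : ℝ) (f : ℝ → EuclideanSpace ℝ (Fin (n + 1)) × ℝ → ℝ) (k ε : ℝ)
    (q : EuclideanSpace ℝ (Fin (n + 1)) × ℝ) : ℝ :=
  ε⁻¹ * (f ε q - lam * q.1 0) - k

theorem secondOrder_spec {k ε : ℝ} (hε : 0 < ε) (q : EuclideanSpace ℝ (Fin (n + 1)) × ℝ) :
    f ε q - ε * k = lam * q.1 0 + ε * secondOrder lam f k ε q := by
  rw [secondOrder]
  field_simp
  ring

theorem IsHeatExpansion.secondOrder_approx (hf : IsHeatExpansion n α lam Q b f) (k : ℝ) {η : ℝ}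
    (hη : 0 < η) : ∀ᶠ ε in 𝓝[>] (0 : ℝ), ∀ q ∈ heatDomain (n + 1) α,
      |secondOrder lam f k ε q - (1 / 2 * quadForm Q q.1 + b * q.2 - k)| ≤ η := by
  filter_upwards [hf.approx η hη, self_mem_nhdsWithin] with ε h hε q hq
  have hε : 0 < ε := hε
  have h1 := h q hq
  have h2 : f ε q - (lam * q.1 0 + ε * (1 / 2 * quadForm Q q.1 + b * q.2)) =
      ε * (secondOrder lam f k ε q - (1 / 2 * quadForm Q q.1 + b * q.2 - k)) := by
    rw [secondOrder]
    field_simp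
    ring
  rw [h2, abs_mul, abs_of_pos hε, mul_comm] at h1
  exact le_of_mul_le_mul_right h1 hε

theorem IsHeatExpansion.secondOrder_bound (hα : 0 < α) (hf : IsHeatExpansion n α lam Q b f)
    (k : ℝ) : ∃ M, 0 < M ∧ ∀ᶠ ε in 𝓝[>] (0 : ℝ), ∀ q ∈ heatDomain (n + 1) α,
      |secondOrder lam f k ε q| ≤ M := by
  have hc : Continuous fun q : EuclideanSpace ℝ (Fin (n + 1)) × ℝ =>
      1 / 2 * quadForm Q q.1 + b * q.2 - k := by
    have := (continuous_quadForm Q).comp (continuous_fst (X := EuclideanSpace ℝ (Fin (n + 1)))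
      (Y := ℝ))
    exact ((this.const_mul _).add (continuous_snd.const_mul _)).sub continuous_const
  obtain ⟨M, hM, hb⟩ := exists_bound_heatDomain hα hc
  refine ⟨M + 1, by linarith, ?_⟩
  filter_upwards [hf.secondOrder_approx k one_pos] with ε h q hq
  have h1 := abs_sub_abs_le_abs_sub (secondOrder lam f k ε q)
    (1 / 2 * quadForm Q q.1 + b * q.2 - k)
  linarith [h q hq, hb q hq]

theorem IsHeatExpansion.secondOrder_tendsto (hf : IsHeatExpansion n α lam Q b f) (k : ℝ)
    {q : EuclideanSpace ℝ (Fin (n + 1)) × ℝ} (hq : q ∈ heatDomain (n + 1) α) :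
    Tendsto (fun ε => secondOrder lam f k ε q) (𝓝[>] 0)
      (𝓝 (1 / 2 * quadForm Q q.1 + b * q.2 - k)) := by
  rw [Metric.tendsto_nhds]
  intro η hη
  filter_upwards [hf.secondOrder_approx k (half_pos hη)] with ε h
  rw [Real.dist_eq]
  linarith [h q hq]

theorem IsHeatExpansion.bounded (hα : 0 < α) (hf : IsHeatExpansion n α lam Q b f) :
    ∃ K, 0 ≤ K ∧ ∀ᶠ ε in 𝓝[>] (0 : ℝ), ∀ q ∈ heatDomain (n + 1) α, |f ε q| ≤ K := by
  obtain ⟨M, hM, h⟩ := hf.secondOrder_bound hα 0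
  obtain ⟨A, hA, hA'⟩ := exists_bound_heatDomain (n := n + 1) hα
    (g := fun q => lam * q.1 0) (by fun_prop)
  refine ⟨A + M, by linarith, ?_⟩
  filter_upwards [h, Ioo_mem_nhdsGT one_pos] with ε h hε q hq
  have h1 := secondOrder_spec (lam := lam) (f := f) (k := 0) hε.1 q
  rw [mul_zero, sub_zero] at h1
  rw [h1]
  refine (abs_add_le _ _).trans (add_le_add (hA' q hq) ?_)
  rw [abs_mul, abs_of_pos hε.1]
  have := h q hq
  nlinarith [abs_nonneg (secondOrder lam f 0 ε q), hε.2]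

theorem tendsto_difference_quotient {φ : ℝ → ℝ} {φ' a h : ℝ} (hφ : HasDerivAt φ φ' a) {k : ℝ → ℝ}
    (hk : Tendsto k (𝓝[>] 0) (𝓝 h)) :
    Tendsto (fun ε => ε⁻¹ * (φ (a + ε * k ε) - φ a)) (𝓝[>] 0) (𝓝 (φ' * h)) := by
  have h0 : Tendsto (fun ε : ℝ => a + ε * k ε) (𝓝[>] 0) (𝓝 a) := by
    have h1 : Tendsto (fun ε : ℝ => ε) (𝓝[>] 0) (𝓝 0) := nhdsWithin_le_nhds
    simpa using (h1.mul hk).const_add a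
  have h1 := ((continuousAt_dslope_same.2 hφ.differentiableAt).tendsto.comp h0).mul hk
  rw [dslope_same, hφ.deriv] at h1
  refine h1.congr' ?_
  filter_upwards [self_mem_nhdsWithin] with ε hε
  have hε : ε ≠ 0 := ne_of_gt hε
  have h2 := sub_smul_dslope φ a (a + ε * k ε)
  rw [add_sub_cancel_left, smul_eq_mul] at h2
  rw [← h2, Function.comp_apply]
  field_simp

/-- The mean of `⟨Q y, y⟩ / 2 + b * s` over the heat ball of dimension `ν` with weight
`|y 0| ^ (p - 2)`, in terms of the trace and the first diagonal entry of `Q`. -/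
noncomputable def limitMean (ν p b trQ Q₀₀ : ℝ) : ℝ :=
  heatCoeff ν p * (b + ν / (ν + p - 2) * (trQ + (p - 2) * Q₀₀))

/-- The leading part `signedPow (p - 1) (lam * y 0)` is odd, so the integral is of order `ε`, and
its coefficient is the integral of the derivative `(p - 1) * |lam * y 0| ^ (p - 2)` times the
second-order part. It vanishes exactly at `k = limitMean`. For `p < 2` the derivative is unbounded
but integrable. -/
theorem IsHeatExpansion.tendsto_integral_signedPow (hp : 1 < p) (hlam : 0 < lam)
    (hα : α = 2 * (n + 1)) (hf : IsHeatExpansion n α lam Q b f) :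
    ∃ C > 0, ∀ k, Tendsto
      (fun ε => ε⁻¹ * ∫ q, signedPow (p - 1) (f ε q - ε * k) ∂heatDomainMeasure (n + 1) α)
      (𝓝[>] 0) (𝓝 (C * (limitMean (n + 1) p b (∑ i, Q i i) (Q 0 0) - k))) := by
  have hα0 : 0 < α := by rw [hα]; positivity
  have := isFiniteMeasure_heatDomainMeasure (n := n) hα0
  have hW := weight_moment_pos (n := n) hα0 hp
  refine ⟨(p - 1) * lam ^ (p - 2) * ∫ q : EuclideanSpace ℝ (Fin (n + 1)) × ℝ, |q.1 0| ^ (p - 2)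
      ∂heatDomainMeasure (n + 1) α,
    mul_pos (mul_pos (by linarith) (Real.rpow_pos_of_pos hlam _)) hW, fun k => ?_⟩
  obtain ⟨M, hM, hbd⟩ := hf.secondOrder_bound hα0 k
  obtain ⟨A, hA, hA'⟩ := exists_bound_heatDomain (n := n + 1) hα0
    (g := fun q => lam * q.1 0) (by fun_prop)
  have hlin_cont : ContinuousOn (fun q : EuclideanSpace ℝ (Fin (n + 1)) × ℝ => lam * q.1 0)
    (heatDomain (n + 1) α) := by fun_prop
  have hlin := integrable_signedPow_sub (aestronglyMeasurable_heatDomainMeasure hlin_cont)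
    (ae_heatDomainMeasure_of_forall hA') (q := p - 1) (by linarith) 0
  simp only [sub_zero] at hlin
  have hlin0 : ∫ q : EuclideanSpace ℝ (Fin (n + 1)) × ℝ, signedPow (p - 1) (lam * q.1 0)
      ∂heatDomainMeasure (n + 1) α = 0 :=
    integral_heatDomainMeasure_eq_zero_of_odd fun q => by
      rw [← signedPow_neg]; congr 1; simp
  obtain ⟨K, hK, hfK⟩ := hf.bounded hα0
  have hlim : (p - 1) * lam ^ (p - 2) * (∫ q : EuclideanSpace ℝ (Fin (n + 1)) × ℝ,
      |q.1 0| ^ (p - 2) ∂heatDomainMeasure (n + 1) α) *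
        (limitMean (n + 1) p b (∑ i, Q i i) (Q 0 0) - k) =
      ∫ q : EuclideanSpace ℝ (Fin (n + 1)) × ℝ, (p - 1) * |lam * q.1 0| ^ (p - 1 - 1) *
        (1 / 2 * quadForm Q q.1 + b * q.2 - k) ∂heatDomainMeasure (n + 1) α := by
    have h1 := integral_weight_mul_taylor (n := n) hα0 hp Q b k
    have h2 : α / 2 / (n + p - 1) = ((n : ℝ) + 1) / (n + 1 + p - 2) := by
      rw [hα]; congr 1 <;> ring
    rw [h2] at h1
    rw [limitMean, mul_assoc, ← h1, ← integral_const_mul]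
    congr 1
    ext q
    rw [abs_mul, abs_of_pos hlam, show p - 1 - 1 = p - 2 by ring,
      Real.mul_rpow hlam.le (abs_nonneg _)]
    ring
  rw [hlim]
  -- Subtracting the vanishing integral of the leading part produces a difference quotient.
  have hquot : ∀ᶠ ε in 𝓝[>] (0 : ℝ),
      ∫ q, ε⁻¹ * (signedPow (p - 1) (f ε q - ε * k) - signedPow (p - 1) (lam * q.1 0))
        ∂heatDomainMeasure (n + 1) α =
      ε⁻¹ * ∫ q, signedPow (p - 1) (f ε q - ε * k) ∂heatDomainMeasure (n + 1) α := by
    filter_upwards [hf.continuousOn, hfK] with ε hc hb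
    rw [integral_const_mul, integral_sub (integrable_signedPow_sub
      (aestronglyMeasurable_heatDomainMeasure hc) (ae_heatDomainMeasure_of_forall hb)
      (by linarith) _) hlin, hlin0, sub_zero]
  refine Tendsto.congr' hquot ?_
  refine tendsto_integral_filter_of_dominated_convergence
    (fun q => if p ≤ 2 then 2 * M * |lam * q.1 0| ^ (p - 2) else (p - 1) * (A + M) ^ (p - 2) * M)
    ?_ ?_ ?_ ?_
  · filter_upwards [hf.continuousOn] with ε hc
    refine AEStronglyMeasurable.const_mul (AEStronglyMeasurable.sub ?_ hlin.aestronglyMeasurable) _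
    exact ((measurable_signedPow _).comp_aemeasurable
      ((aestronglyMeasurable_heatDomainMeasure hc).aemeasurable.sub_const _)).aestronglyMeasurable
  · filter_upwards [hbd, Ioo_mem_nhdsGT one_pos] with ε hb hε
    filter_upwards [ae_heatDomainMeasure_of_forall hb, ae_heatDomainMeasure_of_forall hA',
      ae_coord_ne_zero] with q h1 h2 h3
    have ha : lam * q.1 0 ≠ 0 := mul_ne_zero hlam.ne' h3
    rw [secondOrder_spec hε.1, norm_mul, norm_inv, Real.norm_of_nonneg hε.1.le, Real.norm_eq_abs]
    rw [inv_mul_le_iff₀ hε.1]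
    have h4 : |ε * secondOrder lam f k ε q| ≤ ε * M := by
      rw [abs_mul, abs_of_pos hε.1]
      exact mul_le_mul_of_nonneg_left h1 hε.1.le
    split_ifs with hp2
    · refine (abs_signedPow_add_sub_le (by linarith) (by linarith) ha _).trans ?_
      rw [show p - 1 - 1 = p - 2 by ring]
      have := Real.rpow_nonneg (abs_nonneg (lam * q.1 0)) (p - 2)
      nlinarith
    · refine (abs_signedPow_sub_le (K := A + M) (by linarith) ?_ (by linarith)).trans ?_
      · refine (abs_add_le _ _).trans (add_le_add h2 (h4.trans ?_))
        nlinarith [hε.2]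
      · rw [show p - 1 - 1 = p - 2 by ring, add_sub_cancel_left]
        have : 0 ≤ (p - 1) * (A + M) ^ (p - 2) := by
          have : 0 ≤ p - 1 := by linarith
          positivity
        nlinarith
  · split_ifs with hp2
    · have := (integrable_weight (n := n) hα0 hp 0).const_mul (2 * M * lam ^ (p - 2))
      refine this.congr (ae_of_all _ fun q => ?_)
      simp only [abs_mul, abs_of_pos hlam]
      rw [Real.mul_rpow hlam.le (abs_nonneg _)]
      ring
    · exact integrable_const _
  · filter_upwards [ae_heatDomainMeasure_of_forall (fun q hq => hq), ae_coord_ne_zero]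
      with q hq h3
    have ha : lam * q.1 0 ≠ 0 := mul_ne_zero hlam.ne' h3
    refine (tendsto_difference_quotient (hasDerivAt_signedPow ha (p - 1))
      (hf.secondOrder_tendsto k hq)).congr' ?_
    filter_upwards [self_mem_nhdsWithin] with ε hε
    rw [secondOrder_spec hε]

end Expansion

/-! ### First-order asymptotics for `p = 1` -/

section Slicing

variable {n : ℕ}

/-- The point of `ℝⁿ⁺¹` with first coordinate `r` and remaining coordinates `y`. -/
def euclideanCons (r : ℝ) (y : EuclideanSpace ℝ (Fin n)) : EuclideanSpace ℝ (Fin (n + 1)) :=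
  WithLp.toLp 2 (Fin.cons r y.ofLp)

@[simp] theorem euclideanCons_zero (r : ℝ) (y : EuclideanSpace ℝ (Fin n)) :
    euclideanCons r y 0 = r := rfl

@[simp] theorem euclideanCons_succ (r : ℝ) (y : EuclideanSpace ℝ (Fin n)) (i : Fin n) :
    euclideanCons r y i.succ = y i := rfl

theorem norm_sq_euclideanCons (r : ℝ) (y : EuclideanSpace ℝ (Fin n)) :
    ‖euclideanCons r y‖ ^ 2 = r ^ 2 + ‖y‖ ^ 2 := by
  rw [EuclideanSpace.norm_sq_eq, EuclideanSpace.norm_sq_eq, Fin.sum_univ_succ]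
  simp

theorem continuous_euclideanCons :
    Continuous fun z : ℝ × EuclideanSpace ℝ (Fin n) => euclideanCons z.1 z.2 := by
  refine (PiLp.continuous_toLp 2 _).comp (continuous_pi fun i => ?_)
  refine Fin.cases ?_ (fun j => ?_) i
  · simpa using continuous_fst
  · simp only [Fin.cons_succ]
    fun_prop

theorem measurePreserving_euclideanCons :
    MeasurePreserving fun z : ℝ × EuclideanSpace ℝ (Fin n) => euclideanCons z.1 z.2 := by
  have h1 := (MeasurePreserving.id (volume : Measure ℝ)).prod (PiLp.volume_preserving_ofLp (Fin n))
  have h2 := (volume_preserving_piFinSuccAbove (fun _ : Fin (n + 1) => ℝ) 0).symm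
  have h3 := PiLp.volume_preserving_toLp (Fin (n + 1))
  convert h3.comp (h2.comp h1) using 1
  · ext z i
    refine Fin.cases ?_ (fun j => ?_) i <;>
      simp [MeasurableEquiv.piFinSuccAbove_symm_apply, Fin.insertNthEquiv]
  · rfl

/-- Coordinates on space-time adapted to the hyperplane `y 0 = 0`, in which the distance to the
hyperplane is measured in units of `ε`. -/
def sliceMap (ε : ℝ) (w : (EuclideanSpace ℝ (Fin n) × ℝ) × ℝ) :
    EuclideanSpace ℝ (Fin (n + 1)) × ℝ :=
  (euclideanCons (ε * w.2) w.1.1, w.1.2)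

theorem continuous_sliceMap (ε : ℝ) : Continuous (sliceMap (n := n) ε) :=
  (continuous_euclideanCons.comp (by fun_prop :
    Continuous fun w : (EuclideanSpace ℝ (Fin n) × ℝ) × ℝ => (ε * w.2, w.1.1))).prodMk (by fun_prop)

theorem measurableEmbedding_sliceMap {ε : ℝ} (hε : ε ≠ 0) :
    MeasurableEmbedding (sliceMap (n := n) ε) := by
  refine (continuous_sliceMap ε).measurableEmbedding ?_
  rintro ⟨⟨y, s⟩, r⟩ ⟨⟨y', s'⟩, r'⟩ h
  simp only [sliceMap, Prod.mk.injEq] at h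
  have h0 := congrArg (fun v : EuclideanSpace ℝ (Fin (n + 1)) => v 0) h.1
  simp only [euclideanCons_zero, mul_right_inj' hε] at h0
  have h1 : y = y' := by
    ext i
    simpa using congrArg (fun v : EuclideanSpace ℝ (Fin (n + 1)) => v i.succ) h.1
  rw [h0, h1, h.2]

theorem measurePreserving_sliceMap_one : MeasurePreserving (sliceMap (n := n) 1) := by
  have h1 := Measure.measurePreserving_swap (μ := (volume : Measure (EuclideanSpace ℝ (Fin n) × ℝ)))
    (ν := (volume : Measure ℝ))
  have h2 := (volume_preserving_prodAssoc (α₁ := ℝ) (β₁ := EuclideanSpace ℝ (Fin n))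
    (γ₁ := ℝ)).symm
  have h3 := (measurePreserving_euclideanCons (n := n)).prod
    (MeasurePreserving.id (volume : Measure ℝ))
  convert h3.comp (h2.comp h1) using 1
  · ext w <;> simp [sliceMap, MeasurableEquiv.prodAssoc]
  · rfl
  · rfl

theorem map_sliceMap {ε : ℝ} (hε : 0 < ε) :
    (volume : Measure ((EuclideanSpace ℝ (Fin n) × ℝ) × ℝ)).map (sliceMap ε) =
      ENNReal.ofReal ε⁻¹ • volume := by
  have h1 : sliceMap (n := n) ε = sliceMap 1 ∘ Prod.map id (fun r => ε * r) := by
    ext w <;> simp [sliceMap]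
  have h2 : (volume : Measure ((EuclideanSpace ℝ (Fin n) × ℝ) × ℝ)).map
      (Prod.map id fun r => ε * r) = ENNReal.ofReal ε⁻¹ • volume := by
    rw [Measure.volume_eq_prod (EuclideanSpace ℝ (Fin n) × ℝ) ℝ,
      ← Measure.map_prod_map _ _ measurable_id (measurable_const_mul ε),
      Measure.map_id, Real.map_volume_mul_left hε.ne', Measure.prod_smul_right,
      abs_of_pos (inv_pos.2 hε)]
  rw [h1, ← Measure.map_map measurePreserving_sliceMap_one.measurable (by fun_prop), h2,
    Measure.map_smul, measurePreserving_sliceMap_one.map_eq]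

theorem integral_comp_sliceMap {ε : ℝ} (hε : 0 < ε)
    (G : EuclideanSpace ℝ (Fin (n + 1)) × ℝ → ℝ) :
    ∫ w, G (sliceMap ε w) = ε⁻¹ * ∫ q, G q := by
  rw [← (measurableEmbedding_sliceMap hε.ne').integral_map, map_sliceMap hε,
    integral_smul_measure, ENNReal.toReal_ofReal (inv_nonneg.2 hε.le), smul_eq_mul]

theorem aestronglyMeasurable_comp_sliceMap {ε : ℝ} (hε : 0 < ε)
    {G : EuclideanSpace ℝ (Fin (n + 1)) × ℝ → ℝ} (hG : AEStronglyMeasurable G) :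
    AEStronglyMeasurable fun w : (EuclideanSpace ℝ (Fin n) × ℝ) × ℝ => G (sliceMap ε w) := by
  refine AEStronglyMeasurable.comp_measurable (f := sliceMap ε) ?_
    (continuous_sliceMap ε).measurable
  rw [map_sliceMap hε]
  exact hG.smul_measure _

theorem fst_mem_heatDomain_of_sliceMap {α ε : ℝ} {w : (EuclideanSpace ℝ (Fin n) × ℝ) × ℝ}
    (h : sliceMap ε w ∈ heatDomain (n + 1) α) : w.1 ∈ heatDomain n α := by
  refine ⟨h.1, lt_of_le_of_lt ?_ h.2⟩
  simp only [sliceMap, norm_sq_euclideanCons]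
  nlinarith [sq_nonneg (ε * w.2)]

theorem tendsto_sliceMap (w : (EuclideanSpace ℝ (Fin n) × ℝ) × ℝ) :
    Tendsto (fun ε => sliceMap ε w) (𝓝[>] 0) (𝓝 (euclideanCons 0 w.1.1, w.1.2)) := by
  have h : Continuous fun ε : ℝ => sliceMap ε w :=
    (continuous_euclideanCons.comp (by fun_prop : Continuous fun ε : ℝ => (ε * w.2, w.1.1))).prodMk
      continuous_const
  have h1 := (h.tendsto 0).mono_left (nhdsWithin_le_nhds (s := Set.Ioi 0))
  simpa [sliceMap] using h1

theorem cons_zero_mem_heatDomain {α : ℝ} {z : EuclideanSpace ℝ (Fin n) × ℝ}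
    (h : z ∈ heatDomain n α) : (euclideanCons 0 z.1, z.2) ∈ heatDomain (n + 1) α := by
  refine ⟨h.1, ?_⟩
  simpa [norm_sq_euclideanCons] using h.2

theorem quadForm_cons_zero (Q : Fin (n + 1) → Fin (n + 1) → ℝ) (y : EuclideanSpace ℝ (Fin n)) :
    quadForm Q (euclideanCons 0 y) = quadForm (fun i j => Q i.succ j.succ) y := by
  simp [quadForm, Fin.sum_univ_succ]

end Slicing

section SignIntegral

theorem integral_sign_add_sub_sign {lam : ℝ} (hlam : 0 < lam) (h : ℝ) :
    ∫ r : ℝ, (Real.sign (lam * r + h) - Real.sign r) = 2 * h / lam := by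
  have hne : ∀ c : ℝ, ∀ᵐ r : ℝ, r ≠ c := fun c => by
    simp [ae_iff]
  have hfac : ∀ r, lam * r + h = lam * (r + h / lam) := fun r => by field_simp
  rcases le_total 0 h with hh | hh
  · have h1 : (fun r : ℝ => Real.sign (lam * r + h) - Real.sign r) =ᵐ[volume]
        (Set.Ioo (-(h / lam)) 0).indicator fun _ => 2 := by
      filter_upwards [hne 0, hne (-(h / lam))] with r h0 h1
      have hd : 0 ≤ h / lam := by positivity
      by_cases hr : r ∈ Set.Ioo (-(h / lam)) 0
      · rw [Set.indicator_of_mem hr, hfac, Real.sign_of_pos (mul_pos hlam (by linarith [hr.1])),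
          Real.sign_of_neg hr.2]
        norm_num
      · rw [Set.indicator_of_notMem hr]
        rcases lt_or_gt_of_ne h0 with h2 | h2
        · have h3 : r < -(h / lam) :=
            lt_of_le_of_ne (not_lt.1 fun h3 => hr ⟨h3, h2⟩) h1
          rw [hfac, Real.sign_of_neg (mul_neg_of_pos_of_neg hlam (by linarith)),
            Real.sign_of_neg h2, sub_self]
        · rw [hfac, Real.sign_of_pos (mul_pos hlam (by linarith)), Real.sign_of_pos h2, sub_self]
    rw [integral_congr_ae h1, integral_indicator measurableSet_Ioo, integral_const]
    simp only [measureReal_restrict_apply_univ, Real.volume_real_Ioo, smul_eq_mul]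
    rw [max_eq_left (by simp; positivity)]
    ring
  · have h1 : (fun r : ℝ => Real.sign (lam * r + h) - Real.sign r) =ᵐ[volume]
        (Set.Ioo 0 (-(h / lam))).indicator fun _ => -2 := by
      filter_upwards [hne 0, hne (-(h / lam))] with r h0 h1
      have hd : h / lam ≤ 0 := div_nonpos_of_nonpos_of_nonneg hh hlam.le
      by_cases hr : r ∈ Set.Ioo 0 (-(h / lam))
      · rw [Set.indicator_of_mem hr, hfac,
          Real.sign_of_neg (mul_neg_of_pos_of_neg hlam (by linarith [hr.2])),
          Real.sign_of_pos hr.1]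
        norm_num
      · rw [Set.indicator_of_notMem hr]
        rcases lt_or_gt_of_ne h0 with h2 | h2
        · rw [hfac, Real.sign_of_neg (mul_neg_of_pos_of_neg hlam (by linarith)),
            Real.sign_of_neg h2, sub_self]
        · have h3 : -(h / lam) < r :=
            lt_of_le_of_ne (not_lt.1 fun h3 => hr ⟨h2, h3⟩) h1.symm
          rw [hfac, Real.sign_of_pos (mul_pos hlam (by linarith)), Real.sign_of_pos h2, sub_self]
    rw [integral_congr_ae h1, integral_indicator measurableSet_Ioo, integral_const]
    have hd : h / lam ≤ 0 := div_nonpos_of_nonpos_of_nonneg hh hlam.le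
    simp only [measureReal_restrict_apply_univ, Real.volume_real_Ioo, smul_eq_mul]
    rw [max_eq_left (by linarith)]
    ring

theorem sign_eq_of_large {lam M h r : ℝ} (hlam : 0 < lam) (hh : |h| ≤ M) (hr : M / lam < |r|) :
    Real.sign (lam * r + h) = Real.sign r := by
  have hM := (abs_nonneg h).trans hh
  rw [div_lt_iff₀ hlam] at hr
  have h1 := abs_le.1 hh
  rcases lt_or_ge 0 r with h2 | h2
  · rw [abs_of_pos h2] at hr
    rw [Real.sign_of_pos h2, Real.sign_of_pos (by linarith)]
  · have h3 : r < 0 := lt_of_le_of_ne h2 fun h0 => by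
      rw [h0, abs_zero, zero_mul] at hr
      linarith
    rw [abs_of_neg h3] at hr
    rw [Real.sign_of_neg h3, Real.sign_of_neg (by linarith)]

theorem sign_mul_of_pos {c : ℝ} (hc : 0 < c) (r : ℝ) : Real.sign (c * r) = Real.sign r := by
  rcases lt_trichotomy r 0 with h | h | h
  · rw [Real.sign_of_neg h, Real.sign_of_neg (mul_neg_of_pos_of_neg hc h)]
  · rw [h, mul_zero]
  · rw [Real.sign_of_pos h, Real.sign_of_pos (mul_pos hc h)]

theorem continuousAt_sign {a : ℝ} (ha : a ≠ 0) : ContinuousAt Real.sign a := by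
  rcases lt_or_gt_of_ne ha with h | h
  · refine (continuousAt_const (y := (-1 : ℝ))).congr ?_
    filter_upwards [Iio_mem_nhds h] with x hx using (Real.sign_of_neg hx).symm
  · refine (continuousAt_const (y := (1 : ℝ))).congr ?_
    filter_upwards [Ioi_mem_nhds h] with x hx using (Real.sign_of_pos hx).symm

end SignIntegral

section MedianLimit

variable {n : ℕ} {α lam b : ℝ}

theorem integrableOn_heatProfile_div_sq (hα : 0 < α) :
    IntegrableOn (fun z : EuclideanSpace ℝ (Fin (n + 1)) × ℝ =>
      α * heatProfile z.2 * z.2 ^ (-2 : ℝ)) (heatDomain (n + 1) α) := by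
  have hone : PosHomogeneous 0 fun _ : EuclideanSpace ℝ (Fin (n + 1)) => (1 : ℝ) := by
    intro r _ y
    simp
  have hn : (0 : ℝ) ≤ n := n.cast_nonneg
  have h := hone.integrableOn_heatDomain (n := n + 1)
    (w := fun s => α * heatProfile s * s ^ (-2 : ℝ)) hα measurable_const ?_ ?_ ?_
  · simpa only [one_mul] using h
  · exact (continuous_heatProfile.measurable.const_mul α).mul (measurable_id.pow_const _)
  · exact integrableOn_const (measure_ball_lt_top).ne
  · have h1 := integrableOn_heatProfile_rpow (β := ((n + 1 : ℕ) + 0 : ℝ) / 2 + 1) (m := -2) hα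
      (by push_cast; linarith) (by push_cast; linarith)
    refine IntegrableOn.congr_fun h1 (fun s hs => ?_) measurableSet_Ioo
    rw [Real.rpow_add_one (mul_pos hα (heatProfile_pos hs)).ne']
    ring

theorem ae_lam_mul_add_ne_zero {Z : Type*} [MeasurableSpace Z] {μ : Measure Z}
    (hlam : lam ≠ 0) {h : Z → ℝ} (hm : Measurable h) :
    ∀ᵐ w ∂μ.prod (volume : Measure ℝ), lam * w.2 + h w.1 ≠ 0 := by
  have hms : MeasurableSet {w : Z × ℝ | lam * w.2 + h w.1 = 0} :=
    measurableSet_eq_fun ((measurable_snd.const_mul lam).add (hm.comp measurable_fst))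
      measurable_const
  have h0 := (Measure.measure_prod_null (μ := μ) (ν := (volume : Measure ℝ)) hms).2
    (ae_of_all _ fun z => by
      have : Prod.mk z ⁻¹' {w : Z × ℝ | lam * w.2 + h w.1 = 0} ⊆ {-(h z) / lam} := by
        intro r hr
        have hr : lam * r + h z = 0 := hr
        rw [Set.mem_singleton_iff, eq_div_iff hlam]
        linarith
      exact measure_mono_null this (by simp))
  refine measure_mono_null ?_ h0
  intro w hw
  by_contra hcon
  exact hw hcon

theorem tendsto_norm_sq_sliceMap (w : (EuclideanSpace ℝ (Fin n) × ℝ) × ℝ) :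
    Tendsto (fun ε => ‖(sliceMap ε w).1‖ ^ 2) (𝓝[>] 0) (𝓝 (‖w.1.1‖ ^ 2)) := by
  have h0 : Continuous fun q : EuclideanSpace ℝ (Fin (n + 1)) × ℝ => ‖q.1‖ ^ 2 := by fun_prop
  have h1 := (h0.tendsto _).comp (tendsto_sliceMap w)
  simp only [norm_sq_euclideanCons] at h1
  simpa [Function.comp_def] using h1

theorem IsHeatExpansion.secondOrder_tendsto_slice {Q : Fin (n + 1) → Fin (n + 1) → ℝ}
    {f : ℝ → EuclideanSpace ℝ (Fin (n + 1)) × ℝ → ℝ} (hf : IsHeatExpansion n α lam Q b f) (k : ℝ)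
    {w : (EuclideanSpace ℝ (Fin n) × ℝ) × ℝ} (hw : w.1 ∈ heatDomain n α) :
    Tendsto (fun ε => secondOrder lam f k ε (sliceMap ε w)) (𝓝[>] 0)
      (𝓝 (1 / 2 * quadForm (fun i j => Q i.succ j.succ) w.1.1 + b * w.1.2 - k)) := by
  have hev : ∀ᶠ ε in 𝓝[>] (0 : ℝ), sliceMap ε w ∈ heatDomain (n + 1) α :=
    (tendsto_sliceMap w).eventually (isOpen_heatDomain.mem_nhds (cons_zero_mem_heatDomain hw))
  have hcontP : Continuous fun q : EuclideanSpace ℝ (Fin (n + 1)) × ℝ =>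
      1 / 2 * quadForm Q q.1 + b * q.2 - k := by
    have := (continuous_quadForm Q).comp
      (continuous_fst (X := EuclideanSpace ℝ (Fin (n + 1))) (Y := ℝ))
    exact ((this.const_mul _).add (continuous_snd.const_mul _)).sub continuous_const
  have h1 := (hcontP.tendsto _).comp (tendsto_sliceMap w)
  simp only [quadForm_cons_zero] at h1
  have h2 : Tendsto (fun ε => secondOrder lam f k ε (sliceMap ε w) -
      (1 / 2 * quadForm Q (sliceMap ε w).1 + b * (sliceMap ε w).2 - k)) (𝓝[>] 0) (𝓝 0) := by
    rw [Metric.tendsto_nhds]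
    intro η hη
    filter_upwards [hf.secondOrder_approx k (half_pos hη), hev] with ε h3 h4
    rw [Real.dist_eq, sub_zero]
    linarith [h3 _ h4]
  simpa [Function.comp_def] using h2.add h1

/-- For `p = 1` the difference quotients of `signedPow 0` concentrate on the hyperplane `y 0 = 0`.
Slicing the heat ball by its parallels and rescaling the distance to it by `ε` leaves an
integral over the slice `y 0 = 0`, a heat domain of one dimension less. There the density
`|y|² / s²` is that of `heatDomainMeasure`, and the moments needed are those with `p = 2`. -/
theorem IsHeatExpansion.tendsto_integral_sign {Q : Fin (n + 2) → Fin (n + 2) → ℝ}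
    {f : ℝ → EuclideanSpace ℝ (Fin (n + 2)) × ℝ → ℝ} (hlam : 0 < lam)
    (hα : α = 2 * (n + 2)) (hf : IsHeatExpansion (n + 1) α lam Q b f) :
    ∃ C > 0, ∀ k, Tendsto
      (fun ε => ε⁻¹ * ∫ q, Real.sign (f ε q - ε * k) ∂heatDomainMeasure (n + 2) α)
      (𝓝[>] 0) (𝓝 (C * (limitMean (n + 2) 1 b (∑ i, Q i i) (Q 0 0) - k))) := by
  have hα0 : 0 < α := by rw [hα]; positivity
  have := isFiniteMeasure_heatDomainMeasure (n := n + 1) hα0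
  have hW := weight_moment_pos (n := n) hα0 one_lt_two
  refine ⟨2 / lam * ∫ q : EuclideanSpace ℝ (Fin (n + 1)) × ℝ, |q.1 0| ^ ((2 : ℝ) - 2)
      ∂heatDomainMeasure (n + 1) α, by positivity, fun k => ?_⟩
  obtain ⟨M, hM, hbd⟩ := hf.secondOrder_bound hα0 k
  obtain ⟨K, hK, hfK⟩ := hf.bounded hα0
  set Q' : Fin (n + 1) → Fin (n + 1) → ℝ := fun i j => Q i.succ j.succ with hQ'
  set h₀ : EuclideanSpace ℝ (Fin (n + 1)) × ℝ → ℝ :=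
    fun z => 1 / 2 * quadForm Q' z.1 + b * z.2 - k with hh₀
  have hh₀m : Measurable h₀ :=
    ((((continuous_quadForm Q').measurable.comp measurable_fst).const_mul _).add
      (measurable_snd.const_mul _)).sub_const _
  set G : ℝ → EuclideanSpace ℝ (Fin (n + 2)) × ℝ → ℝ := fun ε =>
    (heatDomain (n + 2) α).indicator fun q =>
      ‖q.1‖ ^ 2 / q.2 ^ 2 * (Real.sign (f ε q - ε * k) - Real.sign (lam * q.1 0)) with hG
  set L : (EuclideanSpace ℝ (Fin (n + 1)) × ℝ) × ℝ → ℝ := fun w =>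
    (heatDomain (n + 1) α).indicator (fun z => ‖z.1‖ ^ 2 / z.2 ^ 2) w.1 *
      (Real.sign (lam * w.2 + h₀ w.1) - Real.sign w.2) with hL
  set B : (EuclideanSpace ℝ (Fin (n + 1)) × ℝ) × ℝ → ℝ := fun w =>
    (heatDomain (n + 1) α).indicator (fun z => α * heatProfile z.2 * z.2 ^ (-2 : ℝ)) w.1 *
      (Set.Icc (-(M / lam)) (M / lam)).indicator (fun _ => 2) w.2 with hB
  have hBint : Integrable B := by
    refine Integrable.mul_prod ?_ ?_
    · rw [integrable_indicator_iff measurableSet_heatDomain]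
      exact integrableOn_heatProfile_div_sq hα0
    · rw [integrable_indicator_iff measurableSet_Icc]
      exact integrableOn_const (measure_Icc_lt_top).ne
  have hBnn : ∀ w, 0 ≤ B w := fun w => by
    refine mul_nonneg (Set.indicator_nonneg (fun z hz => ?_) _)
      (Set.indicator_nonneg (fun _ _ => zero_le_two) _)
    have := heatProfile_pos_of_mem hα0 hz
    have := hz.1
    positivity
  have hGmeas : ∀ ε, ContinuousOn (f ε) (heatDomain (n + 2) α) → AEStronglyMeasurable (G ε) := by
    intro ε hc
    rw [hG, aestronglyMeasurable_indicator_iff measurableSet_heatDomain]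
    have h1 := (hc.aestronglyMeasurable (μ := volume) measurableSet_heatDomain).aemeasurable
    have h2 : Measurable fun q : EuclideanSpace ℝ (Fin (n + 2)) × ℝ => lam * q.1 0 := by fun_prop
    exact (measurable_heatDensity.aemeasurable.mul
      ((measurable_real_sign.comp_aemeasurable (h1.sub_const _)).sub
        (measurable_real_sign.comp h2).aemeasurable)).aestronglyMeasurable
  have hlin : Integrable (fun q : EuclideanSpace ℝ (Fin (n + 2)) × ℝ => Real.sign (lam * q.1 0))
      (heatDomainMeasure (n + 2) α) := by
    refine Integrable.of_bound (C := 1) ?_ (ae_of_all _ fun q => abs_sign_le_one _)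
    exact (measurable_real_sign.comp (by fun_prop)).aestronglyMeasurable
  have hlin0 : ∫ q : EuclideanSpace ℝ (Fin (n + 2)) × ℝ, Real.sign (lam * q.1 0)
      ∂heatDomainMeasure (n + 2) α = 0 :=
    integral_heatDomainMeasure_eq_zero_of_odd fun q => by
      rw [← Real.sign_neg]; congr 1; simp
  have hquot : ∀ᶠ ε in 𝓝[>] (0 : ℝ), ∫ w, G ε (sliceMap ε w) =
      ε⁻¹ * ∫ q, Real.sign (f ε q - ε * k) ∂heatDomainMeasure (n + 2) α := by
    filter_upwards [hf.continuousOn, hfK, self_mem_nhdsWithin] with ε hc hb hε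
    have h1 := integrable_signedPow_sub (aestronglyMeasurable_heatDomainMeasure hc)
      (ae_heatDomainMeasure_of_forall hb) le_rfl (ε * k)
    simp only [signedPow_zero_left] at h1
    rw [integral_comp_sliceMap hε, hG, integral_indicator measurableSet_heatDomain,
      ← integral_heatDomainMeasure, integral_sub h1 hlin, hlin0, sub_zero]
  -- Points whose rescaled distance to the hyperplane exceeds `M / lam` do not contribute.
  have hdom : ∀ᶠ ε in 𝓝[>] (0 : ℝ), ∀ w, ‖G ε (sliceMap ε w)‖ ≤ B w := by
    filter_upwards [hbd, self_mem_nhdsWithin] with ε hb hε w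
    have hε : 0 < ε := hε
    by_cases hw : sliceMap ε w ∈ heatDomain (n + 2) α
    · have hw' := fst_mem_heatDomain_of_sliceMap hw
      have hs : 0 < w.1.2 := hw.1
      rw [hG]
      simp only [Set.indicator_of_mem hw]
      rw [secondOrder_spec hε]
      set h := secondOrder lam f k ε (sliceMap ε w)
      have hcoord : (sliceMap ε w).1 0 = ε * w.2 := rfl
      have hsnd : (sliceMap ε w).2 = w.1.2 := rfl
      rw [hcoord, show lam * (ε * w.2) + ε * h = ε * (lam * w.2 + h) by ring,
        show lam * (ε * w.2) = ε * lam * w.2 by ring, sign_mul_of_pos hε,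
        sign_mul_of_pos (mul_pos hε hlam), hsnd]
      by_cases hr : w.2 ∈ Set.Icc (-(M / lam)) (M / lam)
      · rw [hB]
        simp only [Set.indicator_of_mem hw', Set.indicator_of_mem hr]
        rw [norm_mul, Real.norm_of_nonneg (by positivity)]
        refine mul_le_mul ?_ ?_ (norm_nonneg _) ?_
        · rw [Real.rpow_neg hs.le, Real.rpow_two, div_eq_mul_inv]
          exact mul_le_mul_of_nonneg_right hw.2.le (by positivity)
        · refine (norm_sub_le _ _).trans ?_
          have h1 := abs_sign_le_one (lam * w.2 + h)
          have h2 := abs_sign_le_one w.2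
          simp only [Real.norm_eq_abs]
          linarith
        · have := heatProfile_pos_of_mem hα0 hw'
          positivity
      · have hr' : M / lam < |w.2| := by
          by_contra! hcon
          exact hr (abs_le.1 hcon)
        rw [sign_eq_of_large hlam (hb _ hw) hr', sub_self, mul_zero, norm_zero]
        exact hBnn w
    · rw [hG]
      simp only [Set.indicator_of_notMem hw, norm_zero]
      exact hBnn w
  have hlimae : ∀ᵐ w, Tendsto (fun ε => G ε (sliceMap ε w)) (𝓝[>] 0) (𝓝 (L w)) := by
    have hne := ae_lam_mul_add_ne_zero
      (μ := (volume : Measure (EuclideanSpace ℝ (Fin (n + 1)) × ℝ))) hlam.ne' hh₀m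
    rw [← Measure.volume_eq_prod] at hne
    filter_upwards [hne] with w hw
    by_cases hD : w.1 ∈ heatDomain (n + 1) α
    · have hlimpt := tendsto_sliceMap w
      have hmem := cons_zero_mem_heatDomain hD
      have hev : ∀ᶠ ε in 𝓝[>] (0 : ℝ), sliceMap ε w ∈ heatDomain (n + 2) α :=
        hlimpt.eventually (isOpen_heatDomain.mem_nhds hmem)
      have hP := hf.secondOrder_tendsto_slice k hD
      have hsign : Tendsto (fun ε => Real.sign (lam * w.2 + secondOrder lam f k ε (sliceMap ε w)))
          (𝓝[>] 0) (𝓝 (Real.sign (lam * w.2 + h₀ w.1))) :=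
        (continuousAt_sign hw).tendsto.comp (hP.const_add _)
      have hnorm := (tendsto_norm_sq_sliceMap w).div_const (w.1.2 ^ 2)
      rw [hL]
      simp only [Set.indicator_of_mem hD]
      refine (hnorm.mul (hsign.sub_const _)).congr' ?_
      filter_upwards [hev, self_mem_nhdsWithin] with ε h1 hε
      have hε : 0 < ε := hε
      rw [hG]
      simp only [Set.indicator_of_mem h1]
      rw [secondOrder_spec hε]
      have hcoord : (sliceMap ε w).1 0 = ε * w.2 := rfl
      rw [hcoord, show ∀ h, lam * (ε * w.2) + ε * h = ε * (lam * w.2 + h) by intro h; ring,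
        show lam * (ε * w.2) = ε * lam * w.2 by ring, sign_mul_of_pos hε,
        sign_mul_of_pos (mul_pos hε hlam)]
      rfl
    · have h1 : ∀ ε, G ε (sliceMap ε w) = 0 := fun ε => by
        rw [hG]
        exact Set.indicator_of_notMem (fun h => hD (fst_mem_heatDomain_of_sliceMap h)) _
      have h2 : L w = 0 := by
        rw [hL]
        simp only [Set.indicator_of_notMem hD, zero_mul]
      simp only [h1, h2]
      exact tendsto_const_nhds
  have hlim := tendsto_integral_filter_of_dominated_convergence (l := 𝓝[>] (0 : ℝ)) B
    (by filter_upwards [hf.continuousOn, self_mem_nhdsWithin] with ε hc hε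
          using aestronglyMeasurable_comp_sliceMap hε (hGmeas ε hc))
    (hdom.mono fun ε h => ae_of_all _ h) hBint hlimae
  have hLint : Integrable L := by
    refine Integrable.mono' hBint ?_ ?_
    · refine Measurable.aestronglyMeasurable (Measurable.mul ?_ ?_)
      · exact (measurable_heatDensity.indicator measurableSet_heatDomain).comp measurable_fst
      · exact (measurable_real_sign.comp ((measurable_snd.const_mul _).add
          (hh₀m.comp measurable_fst))).sub (measurable_real_sign.comp measurable_snd)
    · filter_upwards [hlimae] with w hw
      exact le_of_tendsto hw.norm (hdom.mono fun ε h => h w)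
  have hLval : ∫ w, L w = 2 / lam * (∫ q : EuclideanSpace ℝ (Fin (n + 1)) × ℝ,
      |q.1 0| ^ ((2 : ℝ) - 2) ∂heatDomainMeasure (n + 1) α) *
        (limitMean (n + 2) 1 b (∑ i, Q i i) (Q 0 0) - k) := by
    rw [Measure.volume_eq_prod] at hLint ⊢
    rw [integral_prod _ hLint]
    have h1 : ∀ z, ∫ r, L (z, r) = 2 / lam * (heatDomain (n + 1) α).indicator
        (fun z => ‖z.1‖ ^ 2 / z.2 ^ 2 * h₀ z) z := by
      intro z
      rw [hL]
      simp only
      rw [integral_const_mul, integral_sign_add_sub_sign hlam]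
      by_cases hz : z ∈ heatDomain (n + 1) α
      · simp only [Set.indicator_of_mem hz]
        ring
      · simp only [Set.indicator_of_notMem hz]
        ring
    simp only [h1]
    rw [integral_const_mul, integral_indicator measurableSet_heatDomain,
      ← integral_heatDomainMeasure, mul_assoc]
    congr 1
    have h2 := integral_weight_mul_taylor (n := n) hα0 one_lt_two Q' b k
    have h3 : ∀ q : EuclideanSpace ℝ (Fin (n + 1)) × ℝ,
        |q.1 0| ^ ((2 : ℝ) - 2) * (1 / 2 * quadForm Q' q.1 + b * q.2 - k) = h₀ q := by
      intro q
      rw [sub_self, Real.rpow_zero, one_mul]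
    simp only [h3] at h2
    rw [h2, limitMean]
    congr 2
    have h4 : heatCoeff ((n : ℝ) + 1) 2 = heatCoeff (n + 2) 1 := by
      rw [heatCoeff, heatCoeff, show (n : ℝ) + 1 + 2 = n + 2 + 1 by ring]
    rw [h4, hα, Fin.sum_univ_succ (fun i => Q i i)]
    have h5 : ((n : ℝ) + 2 - 1) = n + 1 := by ring
    have h6 : ((n : ℝ) + 2 + 1 - 2) = n + 1 := by ring
    rw [h5, h6]
    congr 2
    rw [hQ']
    ring
  rw [← hLval]
  exact hlim.congr' hquot

end MedianLimit

/-! ### Asymptotics of the means of an expansion -/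

section FiniteExponent

variable {n : ℕ} {α lam b : ℝ} {Q : Fin (n + 1) → Fin (n + 1) → ℝ}
  {f : ℝ → EuclideanSpace ℝ (Fin (n + 1)) × ℝ → ℝ} {p : ℝ≥0∞}

theorem IsHeatExpansion.exists_tendsto (hp : 1 ≤ p) (hp' : p ≠ ∞) (hnp : ¬(n = 0 ∧ p = 1))
    (hlam : 0 < lam) (hα : α = 2 * (n + 1)) (hf : IsHeatExpansion n α lam Q b f) :
    ∃ C > 0, ∀ k, Tendsto
      (fun ε => ε⁻¹ * ∫ q, signedPow (p.toReal - 1) (f ε q - ε * k) ∂heatDomainMeasure (n + 1) α)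
      (𝓝[>] 0) (𝓝 (C * (limitMean (n + 1) p.toReal b (∑ i, Q i i) (Q 0 0) - k))) := by
  rcases eq_or_ne p 1 with rfl | h1
  · obtain ⟨m, rfl⟩ : ∃ m, n = m + 1 := Nat.exists_eq_succ_of_ne_zero fun h => hnp ⟨h, rfl⟩
    have hα' : α = 2 * ((m : ℝ) + 2) := by rw [hα]; push_cast; ring
    obtain ⟨C, hC, h⟩ := hf.tendsto_integral_sign hlam hα'
    refine ⟨C, hC, fun k => ?_⟩
    simp only [ENNReal.toReal_one, sub_self, signedPow_zero_left]
    convert h k using 5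
    push_cast
    ring
  · refine hf.tendsto_integral_signedPow ?_ hlam hα
    rw [← ENNReal.toReal_one]
    exact (ENNReal.toReal_lt_toReal ENNReal.one_ne_top hp').2 (lt_of_le_of_ne hp h1.symm)

theorem IsHeatExpansion.existsUnique_isPMean (hp : 1 ≤ p) (hp' : p ≠ ∞)
    (hα : 0 < α) (hf : IsHeatExpansion n α lam Q b f) :
    ∀ᶠ ε in 𝓝[>] (0 : ℝ), ∃! m, IsPMean p (f ε) (heatDomainMeasure (n + 1) α) m := by
  have := isFiniteMeasure_heatDomainMeasure (n := n) hα
  obtain ⟨K, hK, hfK⟩ := hf.bounded hα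
  filter_upwards [hf.continuousOn, hfK] with ε hc hb
  have hm := aestronglyMeasurable_heatDomainMeasure hc
  have hb' := ae_heatDomainMeasure_of_forall hb
  obtain ⟨m, h⟩ := exists_isPMean hp hp' hm hb' hK
  exact ⟨m, h, fun m' h' => IsPMean.eq hp hp' (heatDomainMeasure_ne_zero hα) hm hb'
    (fun a b hab hgap => ae_le_or_ae_ge_of_gap hα hc hab hgap) h' h⟩

/-- The signs of the integrals at `c = ε * (limitMean ± η)` enclose every mean. -/
theorem IsHeatExpansion.isPMean_approx (hp : 1 ≤ p) (hp' : p ≠ ∞) (hnp : ¬(n = 0 ∧ p = 1))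
    (hlam : 0 < lam) (hα : α = 2 * (n + 1)) (hf : IsHeatExpansion n α lam Q b f) {η : ℝ}
    (hη : 0 < η) :
    ∀ᶠ ε in 𝓝[>] (0 : ℝ), ∀ m, IsPMean p (f ε) (heatDomainMeasure (n + 1) α) m →
      |m - ε * limitMean (n + 1) p.toReal b (∑ i, Q i i) (Q 0 0)| ≤ η * ε := by
  have hα0 : 0 < α := by rw [hα]; positivity
  have := isFiniteMeasure_heatDomainMeasure (n := n) hα0
  obtain ⟨K, hK, hfK⟩ := hf.bounded hα0
  obtain ⟨C, hC, hlim⟩ := hf.exists_tendsto hp hp' hnp hlam hα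
  set c := limitMean (n + 1) p.toReal b (∑ i, Q i i) (Q 0 0)
  have h1 := (hlim (c - η)).eventually_const_lt (u := 0) (by
    rw [sub_sub_cancel]; positivity)
  have h2 := (hlim (c + η)).eventually_lt_const (u := 0) (by
    rw [sub_add_cancel_left, mul_neg, neg_lt_zero]; positivity)
  filter_upwards [hf.continuousOn, hfK, h1, h2, self_mem_nhdsWithin] with ε hc hb h1 h2 hε m hm
  have hε : 0 < ε := hε
  have hms := aestronglyMeasurable_heatDomainMeasure hc
  have hb' := ae_heatDomainMeasure_of_forall hb
  have h3 := hm.le_of_integral_pos hp hp' hms hb' (pos_of_mul_pos_right h1 (inv_nonneg.2 hε.le))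
  have h4 := hm.le_of_integral_neg hp hp' hms hb' (by
    by_contra! hcon
    exact absurd h2 (not_lt.2 (mul_nonneg (inv_nonneg.2 hε.le) hcon)))
  rw [abs_le]
  constructor <;> nlinarith

end FiniteExponent

section Top

variable {n : ℕ} {α lam b : ℝ} {Q : Fin (n + 1) → Fin (n + 1) → ℝ}
  {f : ℝ → EuclideanSpace ℝ (Fin (n + 1)) × ℝ → ℝ}

/-- The maximum `√(α / (4πe))` of `y 0` over the closed heat ball, attained at the single point
`(maxRadius α, 0, …, 0)` at time `1 / (4πe)`. -/
noncomputable def maxRadius (α : ℝ) : ℝ := Real.sqrt (α * (1 / (4 * Real.pi * Real.exp 1)))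

/-- The value of `⟨Q y, y⟩ / 2 + b * s` at the points `(± maxRadius α, 0, …, 0)` at time
`1 / (4πe)`. -/
noncomputable def maxValue (α b Q₀₀ : ℝ) : ℝ :=
  1 / 2 * (Q₀₀ * (α * (1 / (4 * Real.pi * Real.exp 1)))) + b * (1 / (4 * Real.pi * Real.exp 1))

theorem quadForm_single (Q : Fin (n + 1) → Fin (n + 1) → ℝ) (r : ℝ) :
    quadForm Q (EuclideanSpace.single 0 r) = Q 0 0 * r ^ 2 := by
  unfold quadForm
  rw [Finset.sum_eq_single 0, Finset.sum_eq_single 0]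
  · simp only [PiLp.single_apply, if_true]
    ring
  · intro j _ hj; simp [hj]
  · simp
  · intro i _ hi; simp [hi]
  · simp

theorem quadForm_neg_arg (Q : Fin n → Fin n → ℝ) (y : EuclideanSpace ℝ (Fin n)) :
    quadForm Q (-y) = quadForm Q y := by
  simp [quadForm]

theorem quadForm_neg_coeff (Q : Fin n → Fin n → ℝ) (y : EuclideanSpace ℝ (Fin n)) :
    quadForm (-Q) y = -quadForm Q y := by
  simp [quadForm]

theorem continuous_taylorPart (Q : Fin n → Fin n → ℝ) (b : ℝ) :
    Continuous fun q : EuclideanSpace ℝ (Fin n) × ℝ => 1 / 2 * quadForm Q q.1 + b * q.2 := by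
  have := (continuous_quadForm Q).comp (continuous_fst (X := EuclideanSpace ℝ (Fin n)) (Y := ℝ))
  exact (this.const_mul _).add (continuous_snd.const_mul _)

theorem coord_le_maxRadius (hα : 0 < α) {q : EuclideanSpace ℝ (Fin (n + 1)) × ℝ} (hs : 0 ≤ q.2)
    (hq : ‖q.1‖ ^ 2 ≤ α * heatProfile q.2) : q.1 0 ≤ maxRadius α := by
  refine (le_abs_self _).trans ((abs_coord_le_norm _ _).trans (Real.le_sqrt_of_sq_le ?_))
  exact hq.trans (mul_le_mul_of_nonneg_left (heatProfile_le hs) hα.le)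

theorem eq_of_coord_eq_maxRadius (hα : 0 < α) {q : EuclideanSpace ℝ (Fin (n + 1)) × ℝ}
    (hs : 0 ≤ q.2) (hq : ‖q.1‖ ^ 2 ≤ α * heatProfile q.2) (h : q.1 0 = maxRadius α) :
    q = (EuclideanSpace.single 0 (maxRadius α), 1 / (4 * Real.pi * Real.exp 1)) := by
  have hpi := Real.pi_pos
  have hR : maxRadius α ^ 2 = α * (1 / (4 * Real.pi * Real.exp 1)) :=
    Real.sq_sqrt (by positivity)
  have hnorm : ‖q.1‖ ^ 2 = q.1 0 ^ 2 + ∑ i : Fin n, q.1 i.succ ^ 2 := by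
    rw [EuclideanSpace.norm_sq_eq, Fin.sum_univ_succ]
    simp
  have hnn : 0 ≤ ∑ i : Fin n, q.1 i.succ ^ 2 := Finset.sum_nonneg fun i _ => sq_nonneg _
  have hle := mul_le_mul_of_nonneg_left (heatProfile_le hs) hα.le
  rw [h, hR] at hnorm
  have hs' : q.2 = 1 / (4 * Real.pi * Real.exp 1) := by
    by_contra hne
    have := mul_lt_mul_of_pos_left (heatProfile_lt hs hne) hα
    linarith
  have h0 : ∑ i : Fin n, q.1 i.succ ^ 2 = 0 := le_antisymm (by linarith) hnn
  rw [Finset.sum_eq_zero_iff_of_nonneg fun i _ => sq_nonneg _] at h0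
  refine Prod.ext ?_ hs'
  ext i
  refine Fin.cases ?_ (fun j => ?_) i
  · simpa using h
  · simpa using h0 j (Finset.mem_univ j)

/-- An upper bound for the perturbed linear function near its unique maximum point. -/
theorem eventually_le_max (hα : 0 < α) (hlam : 0 < lam) (Q : Fin (n + 1) → Fin (n + 1) → ℝ)
    (b : ℝ) {η : ℝ} (hη : 0 < η) :
    ∀ᶠ ε in 𝓝[>] (0 : ℝ), ∀ q ∈ heatDomain (n + 1) α,
      lam * q.1 0 + ε * (1 / 2 * quadForm Q q.1 + b * q.2) ≤
        lam * maxRadius α + ε * (maxValue α b (Q 0 0) + η) := by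
  have hpi := Real.pi_pos
  set h : EuclideanSpace ℝ (Fin (n + 1)) × ℝ → ℝ :=
    fun q => 1 / 2 * quadForm Q q.1 + b * q.2 with hh
  have hc : Continuous h := continuous_taylorPart Q b
  have hmax : h (EuclideanSpace.single 0 (maxRadius α), 1 / (4 * Real.pi * Real.exp 1)) =
      maxValue α b (Q 0 0) := by
    simp only [hh, quadForm_single, maxValue]
    rw [maxRadius, Real.sq_sqrt (by positivity)]
  obtain ⟨R, hR⟩ := heatDomain_subset (n := n + 1) hα
  set K : Set (EuclideanSpace ℝ (Fin (n + 1)) × ℝ) :=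
    (Metric.closedBall 0 R ×ˢ Set.Icc 0 1) ∩
      ({q | ‖q.1‖ ^ 2 ≤ α * heatProfile q.2} ∩ {q | maxValue α b (Q 0 0) + η ≤ h q}) with hK
  have hKc : IsCompact K :=
    ((isCompact_closedBall _ _).prod isCompact_Icc).inter_right
      ((isClosed_le (by fun_prop) (continuous_const.mul
        (continuous_heatProfile.comp continuous_snd))).inter (isClosed_le continuous_const hc))
  -- Away from the maximum point the linear part stays below its maximum by a fixed amount.
  obtain ⟨δ, hδ, hgap⟩ : ∃ δ > 0, ∀ q ∈ K, lam * q.1 0 ≤ lam * maxRadius α - δ := by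
    rcases K.eq_empty_or_nonempty with he | hne
    · exact ⟨1, one_pos, by simp [he]⟩
    · obtain ⟨q₁, hq₁, hm⟩ := hKc.exists_isMaxOn hne
        (f := fun q : EuclideanSpace ℝ (Fin (n + 1)) × ℝ => lam * q.1 0) (by fun_prop)
      refine ⟨lam * maxRadius α - lam * q₁.1 0, ?_, fun q hq => ?_⟩
      · have h1 := coord_le_maxRadius hα hq₁.1.2.1 hq₁.2.1
        have h2 : q₁.1 0 ≠ maxRadius α := fun h3 => by
          have h4 := eq_of_coord_eq_maxRadius hα hq₁.1.2.1 hq₁.2.1 h3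
          have h5 : maxValue α b (Q 0 0) + η ≤ h q₁ := hq₁.2.2
          rw [h4, hmax] at h5
          linarith
        have h3 := lt_of_le_of_ne h1 h2
        have := mul_lt_mul_of_pos_left h3 hlam
        linarith
      · have : lam * q.1 0 ≤ lam * q₁.1 0 := hm hq
        linarith
  obtain ⟨M, hM, hbd⟩ := exists_bound_heatDomain hα
    (hc.sub (continuous_const (y := maxValue α b (Q 0 0) + η)))
  filter_upwards [Ioo_mem_nhdsGT (show 0 < δ / M by positivity)] with ε hε q hq
  have hεM : ε * M ≤ δ := by
    have := hε.2.le
    rwa [le_div_iff₀ hM] at this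
  by_cases hqK : maxValue α b (Q 0 0) + η ≤ h q
  · have h1 := hgap q ⟨hR hq, hq.2.le, hqK⟩
    have h2 := (abs_le.1 (hbd q hq)).2
    have h3 := mul_le_mul_of_nonneg_left h2 hε.1.le
    rw [Pi.sub_apply, mul_sub] at h3
    change lam * q.1 0 + ε * h q ≤ _
    linarith
  · have h1 := coord_le_maxRadius hα hq.1.le hq.2.le
    have h2 := mul_le_mul_of_nonneg_left h1 hlam.le
    have h3 := mul_le_mul_of_nonneg_left (not_le.1 hqK).le hε.1.le
    change lam * q.1 0 + ε * h q ≤ _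
    linarith

theorem single_mem_heatDomain {r : ℝ} (hr0 : 0 ≤ r) (hr : r < maxRadius α) :
    (EuclideanSpace.single 0 r, 1 / (4 * Real.pi * Real.exp 1)) ∈ heatDomain (n + 1) α := by
  have hpi := Real.pi_pos
  refine ⟨by positivity, ?_⟩
  simp only [PiLp.norm_single, heatProfile_max]
  rw [Real.norm_of_nonneg hr0]
  exact (Real.lt_sqrt hr0).1 hr

/-- A lower bound for the supremum, obtained by approaching the maximum point from inside. -/
theorem max_le_of_forall_le (hα : 0 < α) {g : EuclideanSpace ℝ (Fin (n + 1)) × ℝ → ℝ} {ε η S : ℝ}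
    (hg : ∀ q ∈ heatDomain (n + 1) α,
      |g q - (lam * q.1 0 + ε * (1 / 2 * quadForm Q q.1 + b * q.2))| ≤ η * ε)
    (hS : ∀ q ∈ heatDomain (n + 1) α, g q ≤ S) :
    lam * maxRadius α + ε * (maxValue α b (Q 0 0) - η) ≤ S := by
  have hpi := Real.pi_pos
  have hR : 0 < maxRadius α := Real.sqrt_pos.2 (by positivity)
  set s := 1 / (4 * Real.pi * Real.exp 1) with hs
  have hc : Continuous fun r : ℝ => lam * r + ε * (1 / 2 * (Q 0 0 * r ^ 2) + b * s) - η * ε := by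
    fun_prop
  have hlim := (hc.tendsto (maxRadius α)).mono_left
    (nhdsWithin_le_nhds (s := Set.Iio (maxRadius α)))
  have h1 := le_of_tendsto (b := S) hlim (by
    filter_upwards [Ioo_mem_nhdsLT hR] with r hr
    have hmem := single_mem_heatDomain (n := n) hr.1.le hr.2
    have h2 := (abs_le.1 (hg _ hmem)).1
    have h3 := hS _ hmem
    simp only [quadForm_single, PiLp.single_apply, if_true] at h2
    linarith)
  have h4 : maxRadius α ^ 2 = α * s := Real.sq_sqrt (by positivity)
  rw [h4] at h1
  refine le_trans (le_of_eq ?_) h1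
  rw [maxValue, ← hs]
  ring

theorem IsHeatExpansion.existsUnique_isPMean_top (hα : 0 < α)
    (hf : IsHeatExpansion n α lam Q b f) :
    ∀ᶠ ε in 𝓝[>] (0 : ℝ), ∃! m, IsPMean ∞ (f ε) (heatDomainMeasure (n + 1) α) m := by
  obtain ⟨K, hK, hfK⟩ := hf.bounded hα
  filter_upwards [hfK] with ε hb
  obtain ⟨S, I, -, -, h⟩ := exists_isPMean_top_iff (heatDomainMeasure_ne_zero hα)
    (ae_heatDomainMeasure_of_forall hb)
  exact ⟨(S + I) / 2, (h _).2 rfl, fun m hm => (h m).1 hm⟩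

/-- The supremum and the infimum are attained asymptotically at two opposite points, where the
linear part cancels in the midpoint and the second-order part takes the same value. -/
theorem IsHeatExpansion.isPMean_top_approx (hlam : 0 < lam) (hα : 0 < α)
    (hf : IsHeatExpansion n α lam Q b f) {η : ℝ} (hη : 0 < η) :
    ∀ᶠ ε in 𝓝[>] (0 : ℝ), ∀ m, IsPMean ∞ (f ε) (heatDomainMeasure (n + 1) α) m →
      |m - ε * maxValue α b (Q 0 0)| ≤ η * ε := by
  obtain ⟨K, hK, hfK⟩ := hf.bounded hα
  filter_upwards [hf.continuousOn, hfK, hf.approx _ (half_pos hη), self_mem_nhdsWithin,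
    eventually_le_max hα hlam Q b (half_pos hη), eventually_le_max hα hlam (-Q) (-b) (half_pos hη)]
    with ε hc hb happ hε hmax hmin m hm
  have hε : 0 < ε := hε
  obtain ⟨S, I, hS, hI, h⟩ := exists_isPMean_top_iff (heatDomainMeasure_ne_zero hα)
    (ae_heatDomainMeasure_of_forall hb)
  have hneg : ∀ q ∈ heatDomain (n + 1) α, (-q.1, q.2) ∈ heatDomain (n + 1) α := by
    intro q hq
    simpa [heatDomain] using hq
  have hval : maxValue α (-b) ((-Q) 0 0) = -maxValue α b (Q 0 0) := by
    simp only [maxValue, Pi.neg_apply]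
    ring
  have hS1 : S ≤ lam * maxRadius α + ε * (maxValue α b (Q 0 0) + η / 2) + η / 2 * ε :=
    (hS _).1 (ae_heatDomainMeasure_of_forall fun q hq => by
      have h1 := (abs_le.1 (happ q hq)).2
      have h2 := hmax q hq
      linarith)
  have hI1 : -(lam * maxRadius α) + ε * (maxValue α b (Q 0 0) - η / 2) - η / 2 * ε ≤ I :=
    (hI _).1 (ae_heatDomainMeasure_of_forall fun q hq => by
      have h1 := (abs_le.1 (happ q hq)).1
      have h2 := hmin _ (hneg q hq)
      rw [hval] at h2
      simp only [quadForm_neg_coeff, quadForm_neg_arg, PiLp.neg_apply] at h2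
      linarith)
  have hS2 := max_le_of_forall_le hα happ (forall_le_of_ae_le hc ((hS S).2 le_rfl))
  have hI2 := max_le_of_forall_le (Q := -Q) (b := -b) (lam := lam) (ε := ε) (η := η / 2)
    (g := fun q => -f ε (-q.1, q.2)) (S := -I) hα
    (fun q hq => by
      have h1 := happ _ (hneg q hq)
      rw [← abs_neg] at h1
      convert h1 using 2
      simp only [quadForm_neg_coeff, quadForm_neg_arg, PiLp.neg_apply]
      ring)
    (fun q hq => by
      have h1 := forall_le_of_ae_le (f := fun q => -f ε q) hc.neg (r := -I)
        (((hI I).2 le_rfl).mono fun q hq => neg_le_neg hq)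
      exact h1 _ (hneg q hq))
  rw [hval] at hI2
  rw [(h m).1 hm, abs_le]
  constructor <;> nlinarith

end Top

/-! ### Rescaling of heat balls -/

section Scaling

variable {N : ℕ} {ε : ℝ} (L : EuclideanSpace ℝ (Fin N) ≃ₗᵢ[ℝ] EuclideanSpace ℝ (Fin N))
  (x : EuclideanSpace ℝ (Fin N)) (t : ℝ)

/-- The parabolic rescaling, composed with a rotation and a time reversal, that maps the normalized
heat domain onto the heat ball `E_ε(x,t)`. -/
noncomputable def heatScaling (ε : ℝ) (q : EuclideanSpace ℝ (Fin N) × ℝ) :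
    EuclideanSpace ℝ (Fin N) × ℝ :=
  (x + ε • L q.1, t - ε ^ 2 * q.2)

theorem continuous_heatScaling : Continuous (heatScaling L x t ε) := by
  unfold heatScaling
  fun_prop

theorem measurableEmbedding_heatScaling (hε : ε ≠ 0) :
    MeasurableEmbedding (heatScaling L x t ε) := by
  refine (continuous_heatScaling L x t).measurableEmbedding fun q q' h => ?_
  simp only [heatScaling, Prod.mk.injEq, add_right_inj, sub_right_inj] at h
  refine Prod.ext (L.injective (smul_right_injective _ hε h.1)) ?_
  exact mul_left_cancel₀ (pow_ne_zero 2 hε) h.2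

theorem map_heatScaling (hε : 0 < ε) :
    (volume : Measure (EuclideanSpace ℝ (Fin N) × ℝ)).map (heatScaling L x t ε) =
      ENNReal.ofReal (ε ^ (N + 2))⁻¹ • volume := by
  have h1 : (volume : Measure (EuclideanSpace ℝ (Fin N))).map (fun y => x + ε • L y) =
      ENNReal.ofReal (ε ^ N)⁻¹ • volume := by
    have e : (fun y => x + ε • L y) = (fun y => x + y) ∘ (fun y => ε • y) ∘ L := rfl
    rw [e, ← Measure.map_map (by fun_prop) (by fun_prop),
      ← Measure.map_map (by fun_prop) (by fun_prop), L.measurePreserving.map_eq,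
      Measure.map_addHaar_smul _ hε.ne', Measure.map_smul, map_add_left_eq_self,
      finrank_euclideanSpace_fin, abs_of_pos (by positivity)]
  have h2 : (volume : Measure ℝ).map (fun s => t - ε ^ 2 * s) =
      ENNReal.ofReal (ε ^ 2)⁻¹ • volume := by
    have e : (fun s => t - ε ^ 2 * s) = (fun s => t + s) ∘ (fun s => -ε ^ 2 * s) := by
      ext s; simp; ring
    rw [e, ← Measure.map_map (by fun_prop) (by fun_prop),
      Real.map_volume_mul_left (neg_ne_zero.2 (by positivity)), Measure.map_smul,
      map_add_left_eq_self, inv_neg, abs_neg, abs_of_pos (by positivity)]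
  have e : heatScaling L x t ε = Prod.map (fun y => x + ε • L y) (fun s => t - ε ^ 2 * s) := rfl
  rw [e, Measure.volume_eq_prod, ← Measure.map_prod_map _ _ (by fun_prop) (by fun_prop), h1, h2,
    Measure.prod_smul_left, Measure.prod_smul_right, smul_smul,
    ← ENNReal.ofReal_mul (by positivity)]
  congr 2
  rw [pow_add, mul_inv]

theorem lintegral_eq_mul_lintegral_heatScaling (hε : 0 < ε)
    (F : EuclideanSpace ℝ (Fin N) × ℝ → ℝ≥0∞) :
    ∫⁻ q, F q = ENNReal.ofReal (ε ^ (N + 2)) * ∫⁻ q, F (heatScaling L x t ε q) := by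
  rw [← (measurableEmbedding_heatScaling L x t hε.ne').lintegral_map, map_heatScaling L x t hε,
    lintegral_smul_measure, smul_eq_mul, ← mul_assoc, ← ENNReal.ofReal_mul (by positivity),
    mul_inv_cancel₀ (by positivity), ENNReal.ofReal_one, one_mul]

theorem heatScaling_mem_heatBall_iff (hε : 0 < ε) (q : EuclideanSpace ℝ (Fin N) × ℝ) :
    heatScaling L x t ε q ∈ heatBall ε x t ↔ q ∈ heatDomain N (2 * N) := by
  have hpi := Real.pi_pos
  have hlt : t - ε ^ 2 * q.2 < t ↔ 0 < q.2 := by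
    rw [sub_lt_self_iff]
    exact mul_pos_iff_of_pos_left (by positivity)
  simp only [heatBall, heatDomain, heatScaling, Set.mem_ofPred_eq, hlt]
  refine and_congr_right fun hs => ?_
  have h1 : x - (x + ε • L q.1) = -(ε • L q.1) := by abel
  have h2 : ‖x - (x + ε • L q.1)‖ ^ 2 / (4 * (ε ^ 2 * q.2)) = ‖q.1‖ ^ 2 / (4 * q.2) := by
    rw [h1, norm_neg, norm_smul, Real.norm_of_nonneg hε.le, L.norm_map, mul_pow]
    field_simp
  have h3 : 0 < 4 * Real.pi * (ε ^ 2 * q.2) := by positivity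
  rw [sub_sub_cancel, heatFundamental, if_pos (by positivity), h2, ← Real.log_lt_log_iff
    (by positivity) (by positivity), Real.log_mul (by positivity) (by positivity), Real.log_exp,
    Real.log_rpow h3, Real.log_inv, Real.log_pow,
    show 4 * Real.pi * (ε ^ 2 * q.2) = ε ^ 2 * (4 * Real.pi * q.2) by ring,
    Real.log_mul (by positivity) (by positivity), Real.log_pow, heatProfile_eq]
  have h4 : ‖q.1‖ ^ 2 / (4 * q.2) < -(N / 2) * Real.log (4 * Real.pi * q.2) ↔
      ‖q.1‖ ^ 2 < 2 * N * (q.2 * -Real.log (4 * Real.pi * q.2)) := by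
    rw [div_lt_iff₀ (by positivity)]
    ring_nf
  rw [← h4]
  push_cast
  constructor <;> intro h <;> linarith

theorem measurableSet_heatBall (hε : 0 < ε) : MeasurableSet (heatBall ε x t) := by
  have h : heatScaling (LinearIsometryEquiv.refl ℝ _) x t ε '' heatDomain N (2 * N) =
      heatBall ε x t := by
    ext q
    constructor
    · rintro ⟨q, hq, rfl⟩
      exact (heatScaling_mem_heatBall_iff _ x t hε q).2 hq
    · intro hq
      have hs : heatScaling (LinearIsometryEquiv.refl ℝ _) x t ε
          (ε⁻¹ • (q.1 - x), (ε ^ 2)⁻¹ * (t - q.2)) = q := by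
        refine Prod.ext ?_ ?_
        · simp [heatScaling, smul_smul, mul_inv_cancel₀ hε.ne']
        · simp only [heatScaling]
          field_simp
          ring
      refine ⟨_, ?_, hs⟩
      rw [← heatScaling_mem_heatBall_iff (LinearIsometryEquiv.refl ℝ _) x t hε, hs]
      exact hq
  rw [← h]
  exact (measurableEmbedding_heatScaling _ x t hε.ne').measurableSet_image.2
    measurableSet_heatDomain

/-- Up to a factor, `ν` on the heat ball is the image of the measure on the normalized domain. -/
theorem heatBallMeasure_eq_map (hε : 0 < ε) :
    heatBallMeasure ε x t =
      ENNReal.ofReal (ε ^ N) • (heatDomainMeasure N (2 * N)).map (heatScaling L x t ε) := by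
  ext A hA
  have hemb := measurableEmbedding_heatScaling L x t hε.ne'
  rw [Measure.smul_apply, hemb.map_apply, heatBallMeasure, heatDomainMeasure,
    withDensity_apply _ hA, withDensity_apply _ (hemb.measurable hA),
    Measure.restrict_restrict hA, Measure.restrict_restrict (hemb.measurable hA),
    ← lintegral_indicator (hA.inter (measurableSet_heatBall x t hε)),
    ← lintegral_indicator ((hemb.measurable hA).inter measurableSet_heatDomain),
    lintegral_eq_mul_lintegral_heatScaling L x t hε, smul_eq_mul]
  have key : ∀ q, (A ∩ heatBall ε x t).indicator
      (fun q => ENNReal.ofReal (‖x - q.1‖ ^ 2 / (t - q.2) ^ 2)) (heatScaling L x t ε q) =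
      ENNReal.ofReal (ε ^ 2)⁻¹ * ((heatScaling L x t ε ⁻¹' A) ∩ heatDomain N (2 * N)).indicator
        (fun q => ENNReal.ofReal (‖q.1‖ ^ 2 / q.2 ^ 2)) q := by
    intro q
    have hmem : heatScaling L x t ε q ∈ A ∩ heatBall ε x t ↔
        q ∈ (heatScaling L x t ε ⁻¹' A) ∩ heatDomain N (2 * N) :=
      and_congr_right fun _ => heatScaling_mem_heatBall_iff L x t hε q
    by_cases hq : q ∈ (heatScaling L x t ε ⁻¹' A) ∩ heatDomain N (2 * N)
    · rw [Set.indicator_of_mem hq, Set.indicator_of_mem (hmem.2 hq),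
        ← ENNReal.ofReal_mul (by positivity)]
      congr 1
      have h1 : x - (x + ε • L q.1) = -(ε • L q.1) := by abel
      have hs : 0 < q.2 := hq.2.1
      simp only [heatScaling]
      rw [h1, norm_neg, norm_smul, Real.norm_of_nonneg hε.le, L.norm_map, sub_sub_cancel]
      field_simp
    · rw [Set.indicator_of_notMem hq, Set.indicator_of_notMem (mt hmem.1 hq), mul_zero]
  simp only [key]
  rw [lintegral_const_mul' _ _ ENNReal.ofReal_ne_top, ← mul_assoc,
    ← ENNReal.ofReal_mul (by positivity)]
  congr 2
  rw [pow_add]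
  field_simp

/-- The heat `p`-mean of `u` is, up to an affine change, the `p`-mean of the rescaled increments
of `u` on the normalized domain. -/
theorem isHeatPMean_iff (hε : 0 < ε) (p : ℝ≥0∞) (u : EuclideanSpace ℝ (Fin N) × ℝ → ℝ)
    (a m : ℝ) :
    IsHeatPMean p ε u x t m ↔
      IsPMean p (fun q => ε⁻¹ * (u (heatScaling L x t ε q) - a)) (heatDomainMeasure N (2 * N))
        (ε⁻¹ * (m - a)) := by
  have hK1 : ENNReal.ofReal (ε ^ N) ^ (1 / p).toReal * ‖ε‖ₑ ≠ 0 := by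
    refine mul_ne_zero ?_ (by simpa using hε.ne')
    rw [← pos_iff_ne_zero]
    exact ENNReal.rpow_pos (ENNReal.ofReal_pos.2 (by positivity)) ENNReal.ofReal_ne_top
  have hK2 : ENNReal.ofReal (ε ^ N) ^ (1 / p).toReal * ‖ε‖ₑ ≠ ∞ :=
    ENNReal.mul_ne_top (ENNReal.rpow_ne_top_of_nonneg ENNReal.toReal_nonneg ENNReal.ofReal_ne_top)
      enorm_ne_top
  have h : ∀ c : ℝ, eLpNorm (fun q => u q - c) p (heatBallMeasure ε x t) =
      ENNReal.ofReal (ε ^ N) ^ (1 / p).toReal * ‖ε‖ₑ *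
        eLpNorm (fun q => ε⁻¹ * (u (heatScaling L x t ε q) - a) - ε⁻¹ * (c - a)) p
          (heatDomainMeasure N (2 * N)) := by
    intro c
    rw [heatBallMeasure_eq_map L x t hε, eLpNorm_smul_measure_of_ne_zero
      (ENNReal.ofReal_pos.2 (by positivity)).ne',
      (measurableEmbedding_heatScaling L x t hε.ne').eLpNorm_map_measure, smul_eq_mul, mul_assoc,
      ← eLpNorm_const_smul]
    congr 2
    ext q
    simp only [Function.comp_apply, Pi.smul_apply, smul_eq_mul]
    field_simp
    ring
  unfold IsHeatPMean IsPMean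
  simp only [h, ENNReal.mul_le_mul_iff_right hK1 hK2]
  refine ⟨fun h c => ?_, fun h c => h _⟩
  have := h (a + ε * c)
  rwa [add_sub_cancel_left, inv_mul_cancel_left₀ hε.ne'] at this

end Scaling

/-! ### Taylor expansion and the normalized `p`-Laplacian -/

section Taylor

/-- Second-order Taylor expansion: by the mean value inequality the remainder is controlled by its
derivative, which is the first-order remainder of `fderiv ℝ v`. -/
theorem ContDiffAt.taylor_two_isLittleO {E : Type*} [NormedAddCommGroup E] [NormedSpace ℝ E]
    {v : E → ℝ} {x : E} (hv : ContDiffAt ℝ 2 v x) :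
    (fun w => v (x + w) - v x - fderiv ℝ v x w - 1 / 2 * fderiv ℝ (fderiv ℝ v) x w w)
      =o[𝓝 0] fun w => ‖w‖ ^ 2 := by
  set A := fderiv ℝ v x with hA
  set B := fderiv ℝ (fderiv ℝ v) x with hB
  have hsymm : ∀ w z, B w z = B z w := hv.isSymmSndFDerivAt (by simp)
  have hd2 : HasFDerivAt (fderiv ℝ v) B x :=
    ((hv.fderiv_right (m := 1) (by norm_num)).differentiableAt one_ne_zero).hasFDerivAt
  have hd1 : ∀ᶠ y in 𝓝 x, DifferentiableAt ℝ v y :=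
    (hv.eventually (by simp)).mono fun y hy => hy.differentiableAt two_ne_zero
  have hshift : Tendsto (fun w : E => x + w) (𝓝 0) (𝓝 x) := by
    have : Continuous fun w : E => x + w := by fun_prop
    simpa using this.tendsto 0
  have hd2' := hasFDerivAt_iff_isLittleO_nhds_zero.1 hd2
  rw [isLittleO_iff]
  intro η hη
  have hev := (hshift.eventually hd1).and (hd2'.def hη)
  obtain ⟨δ, hδ, hball⟩ := Metric.eventually_nhds_iff_ball.1 hev
  filter_upwards [Metric.ball_mem_nhds (0 : E) hδ] with w hw
  rw [mem_ball_zero_iff] at hw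
  have hder : ∀ z ∈ Metric.closedBall (0 : E) ‖w‖,
      HasFDerivWithinAt (fun w => v (x + w) - v x - A w - 1 / 2 * B w w)
        (fderiv ℝ v (x + z) - A - B z) (Metric.closedBall 0 ‖w‖) z := by
    intro z hz
    rw [mem_closedBall_zero_iff] at hz
    have h1 := (hball z (by rw [mem_ball_zero_iff]; linarith)).1.hasFDerivAt
    have h2 : HasFDerivAt (fun w => v (x + w)) (fderiv ℝ v (x + z)) z := by
      rw [hasFDerivAt_comp_add_left]
      exact h1
    have h3 : HasFDerivAt (fun w => B w w) (B z + B.flip z) z := by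
      have := B.hasFDerivAt (x := z) |>.clm_apply (hasFDerivAt_id z)
      simpa using this
    have h4 := ((h2.sub_const (v x)).sub (A.hasFDerivAt (x := z))).sub (h3.const_mul (1 / 2))
    refine (h4.congr_fderiv ?_).hasFDerivWithinAt
    ext y
    simp only [sub_apply, smul_apply, add_apply, ContinuousLinearMap.flip_apply, smul_eq_mul,
      hsymm y z]
    ring
  have hbound : ∀ z ∈ Metric.closedBall (0 : E) ‖w‖,
      ‖fderiv ℝ v (x + z) - A - B z‖ ≤ η * ‖w‖ := by
    intro z hz
    rw [mem_closedBall_zero_iff] at hz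
    have h1 := (hball z (by rw [mem_ball_zero_iff]; linarith)).2
    exact h1.trans (mul_le_mul_of_nonneg_left hz hη.le)
  have := (convex_closedBall (0 : E) ‖w‖).norm_image_sub_le_of_norm_hasFDerivWithin_le
    hder hbound (Metric.mem_closedBall_self (norm_nonneg w))
    (by rw [mem_closedBall_zero_iff] : w ∈ Metric.closedBall (0 : E) ‖w‖)
  simp only [add_zero, sub_self, map_zero, mul_zero, sub_zero]
    at this
  rw [Real.norm_of_nonneg (by positivity : (0 : ℝ) ≤ ‖w‖ ^ 2)]
  calc _ ≤ η * ‖w‖ * ‖w‖ := this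
    _ = _ := by ring

variable {E : Type*} [NormedAddCommGroup E] [NormedSpace ℝ E] {u : E × ℝ → ℝ} {x : E} {t : ℝ}

/-- Taylor expansion to second order in space and first order in time, on parabolic cylinders. -/
theorem parabolic_taylor (hu : ContDiffAt ℝ 2 u (x, t)) (R : ℝ) {η : ℝ} (hη : 0 < η) :
    ∀ᶠ ε in 𝓝[>] (0 : ℝ), ∀ w : E, ‖w‖ ≤ R → ∀ s ∈ Set.Icc (0 : ℝ) 1,
      |u (x + ε • w, t - ε ^ 2 * s) - u (x, t) - ε * fderiv ℝ (fun y => u (y, t)) x w -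
        ε ^ 2 * (1 / 2 * fderiv ℝ (fderiv ℝ fun y => u (y, t)) x w w -
          deriv (fun s => u (x, s)) t * s)| ≤ η * ε ^ 2 := by
  wlog hR : 0 < R generalizing R
  · filter_upwards [this 1 one_pos] with ε h w hw
    exact h w (hw.trans (by linarith))
  have hv : ContDiffAt ℝ 2 (fun y => u (y, t)) x :=
    hu.comp x (f := fun y => (y, t)) (contDiffAt_id.prodMk contDiffAt_const)
  have hspace := hv.taylor_two_isLittleO
  obtain ⟨η', hη', hηR⟩ : ∃ η' > 0, η' * R ^ 2 ≤ η / 2 :=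
    ⟨η / 2 / R ^ 2, by positivity, le_of_eq (by field_simp)⟩
  obtain ⟨δ₁, hδ₁, h₁⟩ := Metric.eventually_nhds_iff_ball.1 (hspace.def hη')
  have hstrict : HasStrictFDerivAt u (fderiv ℝ u (x, t)) (x, t) := hu.hasStrictFDerivAt two_ne_zero
  have hut : fderiv ℝ u (x, t) (0, 1) = deriv (fun s => u (x, s)) t := by
    have h1 : HasDerivAt (fun s : ℝ => (x, s)) ((0 : E), (1 : ℝ)) t :=
      (hasDerivAt_const t x).prodMk (hasDerivAt_id t)
    exact (hstrict.hasFDerivAt.comp_hasDerivAt t h1).deriv.symm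
  have htime := (hasStrictFDerivAt_iff_isLittleO.1 hstrict).def (half_pos hη)
  obtain ⟨δ₂, hδ₂, h₂⟩ := Metric.eventually_nhds_iff_ball.1 htime
  filter_upwards [Ioo_mem_nhdsGT (show 0 < min 1 (min (δ₁ / R) (min (δ₂ / R) δ₂)) by positivity)]
    with ε hε w hw s hs
  have hε0 : 0 < ε := hε.1
  have hε1 : ε < 1 := hε.2.trans_le (min_le_left _ _)
  have hεR1 : ε * R < δ₁ := by
    rw [← lt_div_iff₀ hR]
    exact hε.2.trans_le ((min_le_right _ _).trans (min_le_left _ _))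
  have hεR2 : ε * R < δ₂ := by
    rw [← lt_div_iff₀ hR]
    exact hε.2.trans_le ((min_le_right _ _).trans ((min_le_right _ _).trans (min_le_left _ _)))
  have hε2 : ε < δ₂ :=
    hε.2.trans_le ((min_le_right _ _).trans ((min_le_right _ _).trans (min_le_right _ _)))
  have hεw : ‖ε • w‖ ≤ ε * R := by
    rw [norm_smul, Real.norm_of_nonneg hε0.le]
    exact mul_le_mul_of_nonneg_left hw hε0.le
  have e1 := h₁ (ε • w) (by rw [mem_ball_zero_iff]; linarith)
  simp only [map_smul, smul_apply, smul_eq_mul] at e1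
  rw [Real.norm_eq_abs, Real.norm_of_nonneg (by positivity : (0 : ℝ) ≤ ‖ε • w‖ ^ 2)] at e1
  have e1' : η' * ‖ε • w‖ ^ 2 ≤ η / 2 * ε ^ 2 := by
    have : ‖ε • w‖ ^ 2 ≤ (ε * R) ^ 2 := pow_le_pow_left₀ (norm_nonneg _) hεw 2
    nlinarith [sq_nonneg ε]
  have hεs : |ε ^ 2 * s| ≤ ε ^ 2 := by
    rw [abs_of_nonneg (mul_nonneg (sq_nonneg ε) hs.1)]
    exact mul_le_of_le_one_right (sq_nonneg ε) hs.2
  have hsq : ε ^ 2 < δ₂ := by nlinarith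
  have e2 := h₂ ((x + ε • w, t - ε ^ 2 * s), (x + ε • w, t)) (by
    rw [Metric.mem_ball, Prod.dist_eq, Prod.dist_eq, Prod.dist_eq, max_lt_iff, max_lt_iff,
      max_lt_iff]
    simp only [dist_self_add_left, dist_self, Real.dist_eq]
    refine ⟨⟨by linarith, ?_⟩, by linarith, hδ₂⟩
    rw [sub_sub_cancel_left, abs_neg]
    linarith)
  have hdiff : ((x + ε • w, t - ε ^ 2 * s) : E × ℝ) - (x + ε • w, t) =
      (-(ε ^ 2 * s)) • ((0 : E), (1 : ℝ)) := by
    simp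
  simp only [hdiff, map_smul, hut, smul_eq_mul] at e2
  have e2' : ‖(-(ε ^ 2 * s)) • ((0 : E), (1 : ℝ))‖ ≤ ε ^ 2 := by
    rw [norm_smul, Real.norm_eq_abs, abs_neg]
    simpa [Prod.norm_def] using hεs
  rw [Real.norm_eq_abs] at e2
  have e3 : η / 2 * ‖(-(ε ^ 2 * s)) • ((0 : E), (1 : ℝ))‖ ≤ η / 2 * ε ^ 2 :=
    mul_le_mul_of_nonneg_left e2' (half_pos hη).le
  have e1'' := abs_le.1 (e1.trans e1')
  have e2'' := abs_le.1 (e2.trans e3)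
  rw [abs_le]
  constructor <;> linarith [e1''.1, e1''.2, e2''.1, e2''.2]

end Taylor

section Laplacian

variable {N : ℕ} {v : EuclideanSpace ℝ (Fin N) → ℝ} {x : EuclideanSpace ℝ (Fin N)}

theorem inner_gradient_eq_fderiv (v : EuclideanSpace ℝ (Fin N) → ℝ)
    (x w : EuclideanSpace ℝ (Fin N)) : inner ℝ (gradient v x) w = fderiv ℝ v x w := by
  simp [gradient]

theorem ContDiffAt.differentiableAt_gradient (hv : ContDiffAt ℝ 2 v x) :
    DifferentiableAt ℝ (gradient v) x := by
  rw [differentiableAt_euclidean]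
  intro i
  have h : (fun y => gradient v y i) = fun y => fderiv ℝ v y (EuclideanSpace.single i 1) := by
    ext y
    rw [← inner_gradient_eq_fderiv, EuclideanSpace.inner_single_right]
    simp
  rw [h]
  exact ((hv.fderiv_right (m := 1) (by norm_num)).differentiableAt one_ne_zero).clm_apply
    (differentiableAt_const _)

theorem inner_fderiv_gradient (hv : ContDiffAt ℝ 2 v x) (w z : EuclideanSpace ℝ (Fin N)) :
    inner ℝ (fderiv ℝ (gradient v) x w) z = fderiv ℝ (fderiv ℝ v) x w z := by
  have h1 := (hv.differentiableAt_gradient.hasFDerivAt.inner ℝ (hasFDerivAt_const z x))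
  have h2 := ((hv.fderiv_right (m := 1) (by norm_num)).differentiableAt
    one_ne_zero).hasFDerivAt.clm_apply (hasFDerivAt_const z x)
  simp only [inner_gradient_eq_fderiv] at h1
  have h3 := congrArg (fun T => T w) (h1.unique h2)
  simpa using h3

/-- The matrix of the second derivative of `v` at `x` in a family `e` of vectors, which will be an
orthonormal basis. -/
noncomputable def hessianMatrix {ι : Type*} (v : EuclideanSpace ℝ (Fin N) → ℝ)
    (x : EuclideanSpace ℝ (Fin N)) (e : ι → EuclideanSpace ℝ (Fin N)) (i j : ι) : ℝ :=
  fderiv ℝ (fderiv ℝ v) x (e i) (e j)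

theorem sum_hessianMatrix_diag {ι ι' : Type*} [Fintype ι] [Fintype ι'] (hv : ContDiffAt ℝ 2 v x)
    (e : OrthonormalBasis ι ℝ (EuclideanSpace ℝ (Fin N)))
    (e' : OrthonormalBasis ι' ℝ (EuclideanSpace ℝ (Fin N))) :
    ∑ i, hessianMatrix v x e i i = ∑ i, hessianMatrix v x e' i i := by
  have h := LinearMap.trace_eq_sum_inner (fderiv ℝ (gradient v) x).toLinearMap e
  have h' := LinearMap.trace_eq_sum_inner (fderiv ℝ (gradient v) x).toLinearMap e'
  rw [h] at h'
  simp only [ContinuousLinearMap.coe_coe] at h'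
  simpa only [hessianMatrix, ← inner_fderiv_gradient hv, real_inner_comm] using h'

theorem normalizedPLaplacian_top (hv : ContDiffAt ℝ 2 v x) (hξ : gradient v x ≠ 0) {ι : Type*}
    (e : ι → EuclideanSpace ℝ (Fin N)) {i₀ : ι} (he : e i₀ = ‖gradient v x‖⁻¹ • gradient v x) :
    normalizedPLaplacian ∞ v x = hessianMatrix v x e i₀ i₀ := by
  have h0 : ‖gradient v x‖ ≠ 0 := norm_ne_zero_iff.2 hξ
  rw [normalizedPLaplacian, if_pos rfl, hessianMatrix, he, ← inner_fderiv_gradient hv, map_smul,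
    real_inner_smul_left, real_inner_smul_right]
  field_simp

/-- Product rule for the divergence form: in an orthonormal basis whose vector `e i₀` is the
direction of the gradient, the normalized `p`-Laplacian is the trace of the Hessian plus `p - 2`
times the second derivative in that direction. -/
theorem normalizedPLaplacian_of_ne_top {p : ℝ≥0∞} (hp : p ≠ ∞) (hv : ContDiffAt ℝ 2 v x)
    (hξ : gradient v x ≠ 0) {ι : Type*} [Fintype ι]
    (e : OrthonormalBasis ι ℝ (EuclideanSpace ℝ (Fin N))) {i₀ : ι}
    (he : e i₀ = ‖gradient v x‖⁻¹ • gradient v x) :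
    normalizedPLaplacian p v x =
      ∑ i, hessianMatrix v x e i i + (p.toReal - 2) * hessianMatrix v x e i₀ i₀ := by
  have h0 : 0 < ‖gradient v x‖ := norm_pos_iff.2 hξ
  rw [← normalizedPLaplacian_top hv hξ e he, normalizedPLaplacian, if_neg hp,
    normalizedPLaplacian, if_pos rfl,
    sum_hessianMatrix_diag hv e (EuclideanSpace.basisFun (Fin N) ℝ)]
  set r := p.toReal - 2
  set ξ := gradient v x with hξdef
  set G := fderiv ℝ (gradient v) x with hG
  have hg : HasFDerivAt (gradient v) G x := hv.differentiableAt_gradient.hasFDerivAt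
  have hpow : ∀ a : ℝ, 0 ≤ a → a ^ r = (a ^ 2) ^ (r / 2) := fun a ha => by
    rw [← Real.rpow_natCast_mul ha]
    congr 1
    push_cast
    ring
  have hV := (hg.norm_sq.rpow_const (p := r / 2) (Or.inl (by positivity))).smul hg
  simp only [← hpow _ (norm_nonneg _)] at hV
  have hexp : (‖ξ‖ ^ 2) ^ (r / 2 - 1) = ‖ξ‖ ^ r / ‖ξ‖ ^ 2 := by
    rw [Real.rpow_sub_one (by positivity), ← hpow _ h0.le]
  have hcoord : inner ℝ (G ξ) ξ = ∑ i, inner ℝ ξ (G (EuclideanSpace.single i 1)) * ξ i := by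
    have hsum : G ξ = ∑ i, ξ i • G (EuclideanSpace.single i 1) := by
      conv_lhs => rw [← (EuclideanSpace.basisFun (Fin N) ℝ).sum_repr ξ]
      simp
    rw [real_inner_comm]
    rw [hsum]
    simp only [inner_sum, real_inner_smul_right, mul_comm]
  have hdiag : ∀ i, hessianMatrix v x (EuclideanSpace.basisFun (Fin N) ℝ) i i =
      G (EuclideanSpace.single i 1) i := fun i => by
    rw [hessianMatrix, ← inner_fderiv_gradient hv, EuclideanSpace.basisFun_apply,
      EuclideanSpace.inner_single_right]
    simp [hG]
  have hr : 0 < ‖ξ‖ ^ r := Real.rpow_pos_of_pos h0 r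
  have hV' : fderiv ℝ (fun y => ‖gradient v y‖ ^ r • gradient v y) x = _ := hV.fderiv
  rw [vectorDiv, hV', hcoord]
  simp only [hdiag, ← hξdef, hexp]
  rw [div_eq_iff hr.ne', add_mul, Finset.sum_mul, Finset.sum_div, Finset.mul_sum, Finset.sum_mul,
    ← Finset.sum_add_distrib]
  refine Finset.sum_congr rfl fun i _ => ?_
  simp
  field_simp

end Laplacian

/-! ### Asymptotics of the heat means -/

/-- Every nonzero vector spans the first axis of some orthonormal basis. -/
theorem exists_orthonormalBasis_zero_eq {n : ℕ} {ξ : EuclideanSpace ℝ (Fin (n + 1))}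
    (hξ : ξ ≠ 0) :
    ∃ e : OrthonormalBasis (Fin (n + 1)) ℝ (EuclideanSpace ℝ (Fin (n + 1))),
      e 0 = ‖ξ‖⁻¹ • ξ := by
  have h : Orthonormal ℝ (Set.domRestrict {(0 : Fin (n + 1))} fun _ => ‖ξ‖⁻¹ • ξ) := by
    refine ⟨fun i => ?_, fun i j hij => absurd (Subsingleton.elim i j) hij⟩
    simp [norm_smul, norm_ne_zero_iff.2 hξ]
  obtain ⟨e, he⟩ := h.exists_orthonormalBasis_extension_of_card_eq (by simp)
  exact ⟨e, he 0 rfl⟩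

section

variable {n : ℕ} {u : EuclideanSpace ℝ (Fin (n + 1)) × ℝ → ℝ}
  {x : EuclideanSpace ℝ (Fin (n + 1))} {t : ℝ}

theorem quadForm_hessianMatrix (v : EuclideanSpace ℝ (Fin (n + 1)) → ℝ)
    (e : OrthonormalBasis (Fin (n + 1)) ℝ (EuclideanSpace ℝ (Fin (n + 1))))
    (y : EuclideanSpace ℝ (Fin (n + 1))) :
    quadForm (hessianMatrix v x e) y =
      fderiv ℝ (fderiv ℝ v) x (e.repr.symm y) (e.repr.symm y) := by
  have : e.repr.symm y = ∑ i, y i • e i := (e.sum_repr_symm y).symm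
  rw [this]
  simp only [quadForm, hessianMatrix, map_sum, map_smul, sum_apply, smul_apply, smul_eq_mul,
    Finset.mul_sum]
  rw [Finset.sum_comm]
  exact Finset.sum_congr rfl fun i _ => Finset.sum_congr rfl fun j _ => by ring

/-- By Taylor's formula, the difference quotients of `u` over shrinking heat balls have a
first-order expansion, in coordinates whose first axis is the direction of the gradient. Time is
reversed on the normalized domain, whence the sign of the time derivative. -/
theorem isHeatExpansion_of_contDiffOn {Ω : Set (EuclideanSpace ℝ (Fin (n + 1)))} (hΩ : IsOpen Ω)
    {T : ℝ} (hu : ContDiffOn ℝ 2 u (Ω ×ˢ Set.Ioo 0 T)) (hxt : (x, t) ∈ Ω ×ˢ Set.Ioo 0 T)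
    {α : ℝ} (hα : 0 < α)
    {e : OrthonormalBasis (Fin (n + 1)) ℝ (EuclideanSpace ℝ (Fin (n + 1)))}
    (he : e 0 = ‖gradient (fun y => u (y, t)) x‖⁻¹ • gradient (fun y => u (y, t)) x)
    (hgrad : gradient (fun y => u (y, t)) x ≠ 0) :
    IsHeatExpansion n α ‖gradient (fun y => u (y, t)) x‖
      (hessianMatrix (fun y => u (y, t)) x e) (-deriv (fun s => u (x, s)) t)
      fun ε q => ε⁻¹ * (u (heatScaling e.repr.symm x t ε q) - u (x, t)) := by
  obtain ⟨M, hM⟩ := heatDomain_subset (n := n + 1) hα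
  have hopen : IsOpen (Ω ×ˢ Set.Ioo 0 T) := hΩ.prod isOpen_Ioo
  have hut : ContDiffAt ℝ 2 u (x, t) := hu.contDiffAt (hopen.mem_nhds hxt)
  constructor
  · obtain ⟨δ, hδ, hball⟩ := Metric.isOpen_iff.1 hopen _ hxt
    filter_upwards [Ioo_mem_nhdsGT (show 0 < min 1 (δ / (|M| + 1)) by positivity)] with ε hε
    have hε0 : 0 < ε := hε.1
    have hε1 : ε < 1 := hε.2.trans_le (min_le_left _ _)
    have hεM : ε * (|M| + 1) < δ := by
      rw [← lt_div_iff₀ (by positivity)]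
      exact hε.2.trans_le (min_le_right _ _)
    refine continuousOn_const.mul (ContinuousOn.sub ?_ continuousOn_const)
    refine hu.continuousOn.comp (continuous_heatScaling ..).continuousOn fun q hq => hball ?_
    obtain ⟨hq1, hq2⟩ := hM hq
    rw [mem_closedBall_zero_iff] at hq1
    have hM' := le_abs_self M
    have h1 : ε * ‖q.1‖ < δ := by nlinarith
    have h2 : |ε ^ 2 * q.2| < δ := by
      rw [abs_of_nonneg (mul_nonneg (sq_nonneg ε) hq2.1)]
      nlinarith [hq2.1, hq2.2, abs_nonneg M, mul_le_of_le_one_right (sq_nonneg ε) hq2.2]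
    rw [Metric.mem_ball, Prod.dist_eq, max_lt_iff]
    simp only [heatScaling, dist_self_add_left, Real.dist_eq, sub_sub_cancel_left, abs_neg]
    refine ⟨?_, h2⟩
    rw [norm_smul, LinearIsometryEquiv.norm_map, Real.norm_of_nonneg hε0.le]
    exact h1
  · intro η hη
    filter_upwards [parabolic_taylor hut M hη, self_mem_nhdsWithin] with ε hε hε0 q hq
    rw [Set.mem_Ioi] at hε0
    obtain ⟨hq1, hq2⟩ := hM hq
    rw [mem_closedBall_zero_iff] at hq1
    have h := hε (e.repr.symm q.1) (by rwa [LinearIsometryEquiv.norm_map]) q.2 hq2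
    have hlin : fderiv ℝ (fun y => u (y, t)) x (e.repr.symm q.1) =
        ‖gradient (fun y => u (y, t)) x‖ * q.1 0 := by
      have h0 : ‖gradient (fun y => u (y, t)) x‖ ≠ 0 := norm_ne_zero_iff.2 hgrad
      have h1 : gradient (fun y => u (y, t)) x = ‖gradient (fun y => u (y, t)) x‖ • e 0 := by
        rw [he, smul_smul, mul_inv_cancel₀ h0, one_smul]
      rw [← inner_gradient_eq_fderiv, h1, real_inner_smul_left, norm_smul, norm_norm,
        e.norm_eq_one, mul_one, ← e.repr_apply_apply, LinearIsometryEquiv.apply_symm_apply]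
    rw [hlin, ← quadForm_hessianMatrix] at h
    have hfac : ε⁻¹ * (u (heatScaling e.repr.symm x t ε q) - u (x, t)) -
        (‖gradient (fun y => u (y, t)) x‖ * q.1 0 +
          ε * (1 / 2 * quadForm (hessianMatrix (fun y => u (y, t)) x e) q.1 +
            -deriv (fun s => u (x, s)) t * q.2)) =
        ε⁻¹ * (u (x + ε • e.repr.symm q.1, t - ε ^ 2 * q.2) - u (x, t) -
          ε * (‖gradient (fun y => u (y, t)) x‖ * q.1 0) -
          ε ^ 2 * (1 / 2 * quadForm (hessianMatrix (fun y => u (y, t)) x e) q.1 -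
            deriv (fun s => u (x, s)) t * q.2)) := by
      rw [heatScaling]
      field_simp
      ring
    rw [hfac, abs_mul, abs_of_pos (inv_pos.2 hε0)]
    calc _ ≤ ε⁻¹ * (η * ε ^ 2) := mul_le_mul_of_nonneg_left h (inv_pos.2 hε0).le
      _ = η * ε := by field_simp

/-- If the rescaled means are `ε c + o(ε)`, then the heat mean is `u(x,t) + c ε² + o(ε²)`. -/
theorem heatPMean_isLittleO {p : ℝ≥0∞} {c : ℝ}
    (L : EuclideanSpace ℝ (Fin (n + 1)) ≃ₗᵢ[ℝ] EuclideanSpace ℝ (Fin (n + 1)))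
    (hex : ∀ᶠ ε : ℝ in 𝓝[>] 0, ∃! m : ℝ, IsHeatPMean p ε u x t m)
    (happrox : ∀ η > 0, ∀ᶠ ε in 𝓝[>] (0 : ℝ), ∀ m,
      IsPMean p (fun q => ε⁻¹ * (u (heatScaling L x t ε q) - u (x, t)))
        (heatDomainMeasure (n + 1) (2 * ((n + 1 : ℕ) : ℝ))) m → |m - ε * c| ≤ η * ε) :
    (fun ε : ℝ => heatPMean p ε u x t - (u (x, t) + c * ε ^ 2)) =o[𝓝[>] 0] fun ε : ℝ => ε ^ 2 := by
  rw [isLittleO_iff]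
  intro η hη
  filter_upwards [hex, happrox η hη, self_mem_nhdsWithin] with ε hm happ hε
  rw [Set.mem_Ioi] at hε
  have hmean : IsHeatPMean p ε u x t (heatPMean p ε u x t) := Classical.epsilon_spec hm.exists
  have h := happ _ ((isHeatPMean_iff L x t hε p u (u (x, t)) _).1 hmean)
  rw [Real.norm_eq_abs, Real.norm_of_nonneg (sq_nonneg ε)]
  have hfac : heatPMean p ε u x t - (u (x, t) + c * ε ^ 2) =
      ε * (ε⁻¹ * (heatPMean p ε u x t - u (x, t)) - ε * c) := by
    field_simp
    ring
  rw [hfac, abs_mul, abs_of_pos hε]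
  calc _ ≤ ε * (η * ε) := mul_le_mul_of_nonneg_left h hε.le
    _ = _ := by ring

end

theorem mainTheorem4 {N : ℕ} (p : ℝ≥0∞) (hp : 1 ≤ p) (hNp : ¬ (N = 1 ∧ p = 1))
    (Ω : Set (EuclideanSpace ℝ (Fin N))) (hΩ : IsOpen Ω) (T : ℝ)
    (u : EuclideanSpace ℝ (Fin N) × ℝ → ℝ)
    (hu : ContDiffOn ℝ 2 u (Ω ×ˢ Set.Ioo 0 T))
    (x : EuclideanSpace ℝ (Fin N)) (t : ℝ) (hxt : (x, t) ∈ Ω ×ˢ Set.Ioo 0 T)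
    (hgrad : gradient (fun y => u (y, t)) x ≠ 0) :
    (∀ᶠ ε : ℝ in 𝓝[>] 0, ∃! m : ℝ, IsHeatPMean p ε u x t m) ∧
    (p ≠ ∞ →
      (fun ε : ℝ => heatPMean p ε u x t -
        (u (x, t) +
          1 / (4 * Real.pi) *
            (1 - 2 / ((N : ℝ) + p.toReal)) ^ (((N : ℝ) + p.toReal) / 2 + 1) *
            (-deriv (fun s => u (x, s)) t +
              (N : ℝ) / ((N : ℝ) + p.toReal - 2) *
                normalizedPLaplacian p (fun y => u (y, t)) x) * ε ^ 2))
        =o[𝓝[>] 0] fun ε : ℝ => ε ^ 2) ∧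
    (p = ∞ →
      (fun ε : ℝ => heatPMean p ε u x t -
        (u (x, t) +
          1 / (4 * Real.pi) * Real.exp (-1) *
            (-deriv (fun s => u (x, s)) t +
              (N : ℝ) * normalizedPLaplacian p (fun y => u (y, t)) x) * ε ^ 2))
        =o[𝓝[>] 0] fun ε : ℝ => ε ^ 2) := by
  obtain _ | n := N
  · exact absurd (Subsingleton.elim _ _) hgrad
  obtain ⟨e, he⟩ := exists_orthonormalBasis_zero_eq hgrad
  have hv : ContDiffAt ℝ 2 (fun y => u (y, t)) x :=
    (hu.contDiffAt ((hΩ.prod isOpen_Ioo).mem_nhds hxt)).comp x (f := fun y => (y, t))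
      (contDiffAt_id.prodMk contDiffAt_const)
  have hα : (0 : ℝ) < 2 * ((n + 1 : ℕ) : ℝ) := by positivity
  have hexp := isHeatExpansion_of_contDiffOn hΩ hu hxt hα he hgrad
  have hlam : 0 < ‖gradient (fun y => u (y, t)) x‖ := norm_pos_iff.2 hgrad
  have hex : ∀ᶠ ε : ℝ in 𝓝[>] 0, ∃! m : ℝ, IsHeatPMean p ε u x t m := by
    have h : ∀ᶠ ε in 𝓝[>] (0 : ℝ), ∃! m,
        IsPMean p (fun q => ε⁻¹ * (u (heatScaling e.repr.symm x t ε q) - u (x, t)))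
          (heatDomainMeasure (n + 1) (2 * ((n + 1 : ℕ) : ℝ))) m := by
      by_cases hp' : p = ∞
      · rw [hp']
        exact hexp.existsUnique_isPMean_top hα
      · exact hexp.existsUnique_isPMean hp hp' hα
    filter_upwards [h, self_mem_nhdsWithin] with ε hε hε0
    obtain ⟨m, hm, huniq⟩ := hε
    have hε0 : 0 < ε := hε0
    refine ⟨u (x, t) + ε * m, ?_, fun m' hm' => ?_⟩
    · refine (isHeatPMean_iff e.repr.symm x t hε0 p u (u (x, t)) _).2 ?_
      rwa [add_sub_cancel_left, inv_mul_cancel_left₀ hε0.ne']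
    · rw [← huniq _ ((isHeatPMean_iff e.repr.symm x t hε0 p u (u (x, t)) _).1 hm'),
        mul_inv_cancel_left₀ hε0.ne', add_sub_cancel]
  refine ⟨hex, fun hp' => ?_, ?_⟩
  · rw [normalizedPLaplacian_of_ne_top hp' hv hgrad e he]
    refine heatPMean_isLittleO e.repr.symm hex fun η hη => ?_
    have h := hexp.isPMean_approx hp hp' (fun h => hNp ⟨by rw [h.1], h.2⟩) hlam
      (by push_cast; rfl) hη
    simpa only [limitMean, heatCoeff, Nat.cast_add, Nat.cast_one] using h
  · rintro rfl
    rw [normalizedPLaplacian_top hv hgrad e he]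
    refine heatPMean_isLittleO e.repr.symm hex fun η hη => ?_
    have hc : 1 / (4 * Real.pi) * Real.exp (-1) * (-deriv (fun s => u (x, s)) t +
        ((n + 1 : ℕ) : ℝ) * hessianMatrix (fun y => u (y, t)) x e 0 0) =
        maxValue (2 * ((n + 1 : ℕ) : ℝ)) (-deriv (fun s => u (x, s)) t)
          (hessianMatrix (fun y => u (y, t)) x e 0 0) := by
      rw [maxValue, Real.exp_neg]
      field_simp
      ring
    rw [hc]
    exact hexp.isPMean_top_approx hlam hα hη
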